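/- Let $p,q\ge 0$. Let $S=S_0\oplus S_1$ be a supercommutative ring (a $\mathbb Z/2$-graded ring with $ab=(-1)^{|a||b|}ba$ for homogeneous $a,b$, and $a^2=0$ for odd $a$), and let $A$ be an even $p|q\times p|q$ supermatrix over $S$ (the matrix of an even operator on a free $S$-module of rank $p|q$ in a homogeneous basis): the entries of the diagonal blocks $A_{00},A_{11}$ are even and those of $A_{01},A_{10}$ are odd. Let $$R_A(z)=\operatorname{Ber}(1+zA)=\sum_{k\ge 0}c_k(A)z^k,\qquad \operatorname{Ber}M=\frac{\det(M_{00}-M_{01}M_{11}^{-1}M_{10})}{\det M_{11}},$$ be its characteristic function, expanded at $z=0$, with $c_k(A)\in S_0$, $c_0(A)=1$ and $c_k(A)=0$ for $k<0$. For a sequence $(c_k)_{k\in\mathbb Z}$ write $|c_k\dots c_{k+n-1}|_n=\det(c_{k+i+j})_{0\le i,j\le n-1}$. Let $F_r=\frac{\partial}{\partial c_r}|c_{p-q+1}\dots c_{p+1}|_{q+1}$, let $H_k(z)=z^k-c_1z^{k-1}+\dots+(-1)^kc_k$ for $k\ge0$ and $H_k=0$ for $k<0$, and put $$\tilde P_A(z)=\sum_{r=p-q}^{p+q}(-1)^rF_{r+1}H_r(z)\Big|_{c_k=c_k(A)}\in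 S_0[z].$$ Let $\varepsilon=(-1)^{q(q-1)/2}$, and for $P=1+a_1z+\dots+a_pz^p$ and $Q=1+b_1z+\dots+b_qz^q$ let $\operatorname{Res}(P,Q)$ be the Sylvester resultant in formal degrees $p,q$, so normalized that $\operatorname{Res}\bigl(\prod_i(1+\lambda_iz),\prod_\alpha(1+\mu_\alpha z)\bigr)=\prod_{i,\alpha}(\lambda_i-\mu_\alpha)$. Then: 1. Each coefficient of $\tilde P_A$ is a polynomial with integer coefficients, depending only on $p,q$ (and not on $S$ and $A$), in the entries of $A$, and $\tilde P_{B^{-1}AB}=\tilde P_A$ for every even invertible $B$. 2. $\tilde P_A(A)=0$. 3. If $R_A=P/Q$ with $P=1+a_1z+\dots+a_pz^p$, $Q=1+b_1z+\dots+b_qz^q$ over $S_0$, then $|c_{p-q+1}(A)\dots c_p(A)|_q=\varepsilon\operatorname{Res}(P,Q)$ and $\tilde P_A=\varepsilon\operatorname{Res}(P,Q)\cdot P_A$, where $P_A(z)=(-z)^{p+q}P(-1/z)\,Q(-1/z)$. Such a pair $(P,Q)$ exists and is unique if $|c_{p-q+1}(A)\dots c_p(A)|_q$ is invertible in $S_0$.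 4. If $\lambda_1,\dots,\lambda_p,\mu_1,\dots,\mu_q\in S_0$ are eigenvalues of $A$ in the sense that $R_A(z)=\prod_i(1+\lambda_iz)/\prod_\alpha(1+\mu_\alpha z)$ (which holds in particular if $A=B\operatorname{diag}(\lambda_1,\dots,\lambda_p,\mu_1,\dots,\mu_q)B^{-1}$ with $B$ even and invertible), then $$\tilde P_A(z)=\varepsilon R\prod_i(\lambda_i-z)\prod_\alpha(\mu_\alpha-z),\qquad R=\prod_{i,\alpha}(\lambda_i-\mu_\alpha)=\operatorname{Res}\Bigl(\prod_i(1+\lambda_iz),\prod_\alpha(1+\mu_\alpha z)\Bigr).$$ 5. Let $A$ be generic: in $S$ itself or in some supercommutative ring $T\supseteq S$ (with compatible grading) $A$ has eigenvalues $\lambda_i,\mu_\alpha$ in the sense of 4 such that all differences $\lambda_i-\lambda_j$ ($i\ne j$), $\mu_\alpha-\mu_\beta$ ($\alpha\neq\beta$), $\lambda_i-\mu_\alpha$ are invertible in $T$, and $|c_{p-q+1}(A)\dots c_p(A)|_q$ is invertible in $S_0$ (automatic if $T=S$). Then $\tilde P_A$ is a minimal polynomial of $A$: it annihilates $A$, its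 leading coefficient is invertible, it has the least degree among nonzero annihilating polynomials, and it divides every annihilating polynomial of $A$, with coefficients in $S_0$ or in $S$. -/

import Mathlib

open Polynomial

universe u v

noncomputable section

namespace SuperCH

/-! ## Supercommutative rings -/

/-- A `ℤ/2`-graded ring is supercommutative if `a b = (-1)^{|a||b|} b a` for homogeneous `a`, `b`
and the square of every odd element is zero (the latter is automatic if `2` is invertible). -/
class IsSupercommutative {S : Type*} [Ring S] (𝒮 : ZMod 2 → AddSubgroup S) : Prop where
  mul_comm' : ∀ {i j : ZMod 2} {a b : S}, a ∈ 𝒮 i → b ∈ 𝒮 j →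
    a * b = (-1) ^ (i.val * j.val) * (b * a)
  odd_mul_self : ∀ {a : S}, a ∈ 𝒮 1 → a * a = 0

section Basic

variable {S : Type*} [Ring S] (𝒮 : ZMod 2 → AddSubgroup S) [GradedRing 𝒮]

/-- The subring of even elements. -/
abbrev EvenPart : Subring S := SetLike.GradeZero.subring 𝒮

/-- The projection of the ring onto its even part. -/
def evenProj (x : S) : EvenPart 𝒮 := ⟨(DirectSum.decompose 𝒮 x 0 : S), SetLike.coe_mem _⟩

variable [IsSupercommutative 𝒮]

theorem even_comm {a : S} (ha : a ∈ 𝒮 0) (b : S) : a * b = b * a := by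
  induction b using DirectSum.Decomposition.inductionOn 𝒮 with
  | zero => simp
  | homogeneous b =>
    have := IsSupercommutative.mul_comm' ha b.2
    simpa using this
  | add b c hb hc => rw [mul_add, add_mul, hb, hc]

instance : CommRing (EvenPart 𝒮) :=
  { (inferInstance : Ring (EvenPart 𝒮)) with
    mul_comm := fun a b => Subtype.ext (even_comm 𝒮 a.2 b) }

instance : Algebra (EvenPart 𝒮) S where
  algebraMap := (EvenPart 𝒮).subtype
  commutes' a x := even_comm 𝒮 a.2 x
  smul_def' _ _ := rfl

/-! ## Even supermatrices and the Berezinian -/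

/-- Parity of an index of a `p|q` supermatrix: the first `p` are even, the last `q` are odd. -/
def parity {p q : ℕ} : Fin p ⊕ Fin q → ZMod 2 := Sum.elim (fun _ => 0) (fun _ => 1)

/-- An even `p|q × p|q` supermatrix: even entries in the diagonal blocks, odd entries in the
antidiagonal blocks. -/
def IsEvenMatrix {p q : ℕ} (M : Matrix (Fin p ⊕ Fin q) (Fin p ⊕ Fin q) S) : Prop :=
  ∀ i j, M i j ∈ 𝒮 (parity i + parity j)

/-- The Berezinian `det (M₀₀ - M₀₁ M₁₁⁻¹ M₁₀) / det M₁₁` of an even supermatrix with invertible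
block `M₁₁`. For an even `M` all entries of the two matrices whose determinants are taken
are even, so that `evenProj` only changes their type. -/
def berezinian {p q : ℕ} (M : Matrix (Fin p ⊕ Fin q) (Fin p ⊕ Fin q) S) : EvenPart 𝒮 :=
  let N : Matrix (Fin q) (Fin q) (EvenPart 𝒮) := M.toBlocks₂₂.map (evenProj 𝒮)
  let Ninv : Matrix (Fin q) (Fin q) S := (N⁻¹).map Subtype.val
  ((M.toBlocks₁₁ - M.toBlocks₁₂ * Ninv * M.toBlocks₂₁).map (evenProj 𝒮)).det * Ring.inverse N.det

end Basic

/-! ## Formal power series over a supercommutative ring, with an even variable -/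

section PowerSeries

variable {S : Type*} [Ring S] (𝒮 : ZMod 2 → AddSubgroup S)

/-- The grading of `S⟦z⟧`: a series is of degree `i` if all its coefficients are. -/
def psGrading (i : ZMod 2) : AddSubgroup (PowerSeries S) where
  carrier := {f | ∀ n, PowerSeries.coeff n f ∈ 𝒮 i}
  zero_mem' n := by simp [(𝒮 i).zero_mem]
  add_mem' hf hg n := by simpa using (𝒮 i).add_mem (hf n) (hg n)
  neg_mem' hf n := by simpa using (𝒮 i).neg_mem (hf n)

theorem mem_psGrading {i : ZMod 2} {f : PowerSeries S} :
    f ∈ psGrading 𝒮 i ↔ ∀ n, PowerSeries.coeff n f ∈ 𝒮 i := Iff.rfl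

variable [GradedRing 𝒮]

instance : SetLike.GradedMonoid (psGrading 𝒮) where
  one_mem n := by
    rw [PowerSeries.coeff_one]
    split_ifs
    · exact SetLike.GradedOne.one_mem
    · exact (𝒮 0).zero_mem
  mul_mem i j f g hf hg n := by
    rw [PowerSeries.coeff_mul]
    exact (𝒮 (i + j)).sum_mem fun x _ => SetLike.GradedMul.mul_mem (hf _) (hg _)

/-- The homogeneous component of a power series, taken coefficientwise. -/
def psComponent (i : ZMod 2) : PowerSeries S →+ psGrading 𝒮 i where
  toFun f := ⟨PowerSeries.mk fun n => (DirectSum.decompose 𝒮 (PowerSeries.coeff n f) i : S),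
    fun n => by simp⟩
  map_zero' := by ext n; simp
  map_add' f g := by ext n; simp

instance : GradedRing (psGrading 𝒮) where
  toDecomposition := DirectSum.Decomposition.ofAddHom (psGrading 𝒮)
    (∑ i : ZMod 2, (DirectSum.of (fun i => psGrading 𝒮 i) i).comp (psComponent 𝒮 i))
    (by
      ext f n
      simp only [AddMonoidHom.comp_apply, AddMonoidHom.finsetSum_apply, map_sum,
        DirectSum.coeAddMonoidHom_of, AddMonoidHom.id_apply]
      simp only [psComponent, AddMonoidHom.coe_mk, ZeroHom.coe_mk, PowerSeries.coeff_mk]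
      classical
      have := DirectSum.sum_support_decompose 𝒮 (PowerSeries.coeff n f)
      conv_rhs => rw [← this]
      symm
      apply Finset.sum_subset (Finset.subset_univ _)
      intro i _ hi
      simpa using hi)
    (by
      refine DirectSum.addHom_ext fun i f => ?_
      simp only [AddMonoidHom.comp_apply, AddMonoidHom.finsetSum_apply,
        DirectSum.coeAddMonoidHom_of, AddMonoidHom.id_apply]
      rw [Finset.sum_eq_single i]
      · congr 1
        ext n
        simp [psComponent, DirectSum.decompose_of_mem_same 𝒮 (f.2 n)]
      · intro j _ hj
        have : psComponent 𝒮 j (f : PowerSeries S) = 0 := by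
          ext n
          simp [psComponent, DirectSum.decompose_of_mem_ne 𝒮 (f.2 n) hj.symm]
        rw [this, map_zero]
      · simp)

instance [IsSupercommutative 𝒮] : IsSupercommutative (psGrading 𝒮) where
  mul_comm' {i j f g} hf hg := by
    ext n
    have hs : ∀ (m : ℕ) (h : PowerSeries S), PowerSeries.coeff n ((-1) ^ m * h) =
        (-1) ^ m * PowerSeries.coeff n h := by
      intro m h
      rcases neg_one_pow_eq_or (PowerSeries S) m with h1 | h1 <;>
      rcases Nat.even_or_odd m with h2 | h2 <;> simp [h2.neg_one_pow]
    rw [hs, PowerSeries.coeff_mul, PowerSeries.coeff_mul, Finset.mul_sum,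
      ← Finset.Nat.sum_antidiagonal_swap]
    refine Finset.sum_congr rfl fun x _ => ?_
    exact IsSupercommutative.mul_comm' (hf _) (hg _)
  odd_mul_self {f} hf := by
    ext n
    rw [PowerSeries.coeff_mul, map_zero]
    refine Finset.sum_involution (fun x _ => x.swap) ?_ ?_ ?_ ?_
    · intro x _
      have := IsSupercommutative.mul_comm' (hf x.1) (hf x.2)
      have h1 : (1 : ZMod 2).val = 1 := rfl
      simp only [Prod.fst_swap, Prod.snd_swap]
      rw [this]
      simp [h1]
    · intro x _ hx h
      apply hx
      have : x.1 = x.2 := by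
        have := congrArg Prod.snd h
        simpa using this
      rw [this]
      exact IsSupercommutative.odd_mul_self (hf _)
    · intro x hx
      simpa [add_comm] using hx
    · intro x _
      simp

end PowerSeries

/-! ## The characteristic function of an even supermatrix -/

section CharFun

variable {S : Type*} [Ring S] (𝒮 : ZMod 2 → AddSubgroup S) [GradedRing 𝒮] [IsSupercommutative 𝒮]
variable {p q : ℕ}

/-- The characteristic function `R_A(z) = Ber (1 + z A)`, expanded at `z = 0`. -/
def charFun (A : Matrix (Fin p ⊕ Fin q) (Fin p ⊕ Fin q) S) : EvenPart (psGrading 𝒮) :=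
  berezinian (psGrading 𝒮)
    (1 + A.map fun a => (PowerSeries.X : PowerSeries S) * PowerSeries.C a)

/-- The coefficients `c_k(A)` of the expansion `R_A(z) = ∑ c_k(A) z^k`; `c_k(A) = 0` for
`k < 0`. -/
def c (A : Matrix (Fin p ⊕ Fin q) (Fin p ⊕ Fin q) S) (k : ℤ) : EvenPart 𝒮 :=
  if 0 ≤ k then ⟨PowerSeries.coeff k.toNat (charFun 𝒮 A : PowerSeries S), (charFun 𝒮 A).2 _⟩ else 0

/-- The characteristic function as a power series with coefficients in the even part. -/
def charSeries (A : Matrix (Fin p ⊕ Fin q) (Fin p ⊕ Fin q) S) : PowerSeries (EvenPart 𝒮) :=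
  PowerSeries.mk fun n => c 𝒮 A n

/-- `R_A = P / Q` with polynomials `P = 1 + a₁ z + ⋯ + a_p z^p` and `Q = 1 + b₁ z + ⋯ + b_q z^q`
over the even part. -/
structure IsCharFraction (A : Matrix (Fin p ⊕ Fin q) (Fin p ⊕ Fin q) S)
    (P Q : (EvenPart 𝒮)[X]) : Prop where
  coeff_zero_num : P.coeff 0 = 1
  coeff_zero_den : Q.coeff 0 = 1
  natDegree_num : P.natDegree ≤ p
  natDegree_den : Q.natDegree ≤ q
  mul_den : charSeries 𝒮 A * (Q : PowerSeries (EvenPart 𝒮)) = (P : PowerSeries (EvenPart 𝒮))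

/-- `l₁, …, l_p` are the even and `m₁, …, m_q` the odd eigenvalues of `A`, in the sense that
`R_A(z) = ∏ (1 + l_i z) / ∏ (1 + m_α z)`. -/
def IsEigenvalueSystem (A : Matrix (Fin p ⊕ Fin q) (Fin p ⊕ Fin q) S)
    (l : Fin p → EvenPart 𝒮) (m : Fin q → EvenPart 𝒮) : Prop :=
  IsCharFraction 𝒮 A (∏ i, (1 + C (l i) * X)) (∏ α, (1 + C (m α) * X))

/-- `A` is similar, by an even invertible matrix, to the diagonal matrix with diagonal entries
`l₁, …, l_p, m₁, …, m_q`: there is a basis of `p` even eigenvectors with eigenvalues `l_i` and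
`q` odd eigenvectors with eigenvalues `m_α`. -/
def IsDiagonalizedTo (A : Matrix (Fin p ⊕ Fin q) (Fin p ⊕ Fin q) S)
    (l : Fin p → EvenPart 𝒮) (m : Fin q → EvenPart 𝒮) : Prop :=
  ∃ B : (Matrix (Fin p ⊕ Fin q) (Fin p ⊕ Fin q) S)ˣ, IsEvenMatrix 𝒮 B.val ∧
    A = B.val * Matrix.diagonal (Sum.elim (fun i => (l i : S)) (fun α => (m α : S))) * B.inv

/-- All differences of the eigenvalues are invertible. -/
structure AllDifferencesInvertible {R : Type*} [CommRing R] (l : Fin p → R) (m : Fin q → R) :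
    Prop where
  even_even : ∀ i j, i ≠ j → IsUnit (l i - l j)
  even_odd : ∀ i α, IsUnit (l i - m α)
  odd_odd : ∀ α β, α ≠ β → IsUnit (m α - m β)

/-- `P` is a minimal polynomial of `A`: it annihilates `A`, its leading coefficient is invertible,
its degree is the least among nonzero annihilating polynomials, and it divides all annihilating
polynomials, be their coefficients in the even part or in the whole ring `S`. -/
structure IsMinimalPolynomial (A : Matrix (Fin p ⊕ Fin q) (Fin p ⊕ Fin q) S)
    (P : (EvenPart 𝒮)[X]) : Prop where
  annihilates : aeval A P = 0
  isUnit_leadingCoeff : IsUnit P.leadingCoeff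
  natDegree_le : ∀ f : S[X], f ≠ 0 → (f.sum fun k s => s • A ^ k) = 0 → P.natDegree ≤ f.natDegree
  dvd_even : ∀ f : (EvenPart 𝒮)[X], aeval A f = 0 → P ∣ f
  dvd : ∀ f : S[X], (f.sum fun k s => s • A ^ k) = 0 → P.map (EvenPart 𝒮).subtype ∣ f

end CharFun

/-! ## Hankel determinants and the modified characteristic polynomial -/

section Hankel

variable {R : Type*} [CommRing R]

/-- The Hankel determinant `|x_k … x_{k+n-1}|_n` of order `n`, with entries `x_{k+i+j}`. -/
def hankelDet (x : ℤ → R) (k : ℤ) (n : ℕ) : R :=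
  (Matrix.of fun i j : Fin n => x (k + (i : ℤ) + (j : ℤ))).det

/-- `F_r`, the partial derivative with respect to `c_r` of `|c_{p-q+1} … c_{p+1}|_{q+1}`, as a
polynomial in the variables `c_k`. -/
def hankelPartial (p q : ℕ) (r : ℤ) : MvPolynomial ℤ ℤ :=
  MvPolynomial.pderiv r (hankelDet (MvPolynomial.X : ℤ → MvPolynomial ℤ ℤ) (p - q + 1) (q + 1))

/-- The Cayley--Hamilton polynomial `H_k(z) = z^k - x_1 z^{k-1} + ⋯ + (-1)^k x_k` of a sequence
with `x_0 = 1`; it is zero for `k < 0`. -/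
def cayleyHamiltonPoly (x : ℤ → R) (k : ℤ) : R[X] :=
  ∑ i ∈ Finset.Icc 0 k, C ((-1) ^ i.natAbs * x i) * X ^ (k - i).toNat

/-- `∑_{r=p-q}^{p+q} (-1)^r F_{r+1} H_r(z)`, with the variables `c_k` replaced by the values
`x k`. -/
def modifiedPoly (p q : ℕ) (x : ℤ → R) : R[X] :=
  ∑ r ∈ Finset.Icc ((p : ℤ) - q) (p + q),
    C ((-1) ^ r.natAbs * MvPolynomial.aeval x (hankelPartial p q (r + 1))) * cayleyHamiltonPoly x r

/-- `(-z)^n P(-1/z) = ∑ a_i (-z)^{n-i}` for `P = ∑ a_i z^i` of degree at most `n`. -/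
def reflectNeg (n : ℕ) (P : R[X]) : R[X] :=
  ∑ i ∈ Finset.range (n + 1), C (P.coeff i) * (-X) ^ (n - i)

end Hankel

/-- The modified characteristic polynomial of an even `p|q × p|q` supermatrix `A`. -/
def modifiedCharPoly {S : Type*} [Ring S] (𝒮 : ZMod 2 → AddSubgroup S) [GradedRing 𝒮]
    [IsSupercommutative 𝒮] {p q : ℕ} (A : Matrix (Fin p ⊕ Fin q) (Fin p ⊕ Fin q) S) :
    (EvenPart 𝒮)[X] :=
  modifiedPoly p q (c 𝒮 A)

end SuperCH

end

/-! If the characteristic function is a fraction `P/Q`, then `R_A · Q = P` is a linear recurrence of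
length q+1 for the coefficients c_k. The reversed coefficients of `Q` are therefore a kernel vector,
with an entry 1, of the Hankel matrix of order q+1 (`IsFraction.row_mul_den`). So its determinant
vanishes and, the matrix being symmetric, its adjugate has the rank-one form of
`adjugate_of_mulVec_eq_zero`. The F_r are sums of entries of this adjugate, which gives the
factorization `IsFraction.modifiedPoly_eq`. The Hankel determinant of order q is a resultant up to
sign, because the Sylvester matrix factors through a Toeplitz matrix of the c_k
(`IsFraction.resultant_eq`).

For arbitrary `A` no such fraction is at hand, but the minors of order q+1 still vanish
(`det_rows_c`). Over S[[z]] the matrix zA + diag(0,1) is conjugate to a block triangular one, by a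
z-adic contraction, so its characteristic function is a fraction and its minors vanish. As c_k is
homogeneous of degree k in the matrix entries, the top coefficient in z of such a minor is the
corresponding minor for `A`.

Cayley–Hamilton is the derivative of this vanishing. Adjoin θ with θ² = 0, of either parity. The
Hankel determinant also vanishes for A + Nθ, and multiplicativity of the Berezinian shows that
c_{r+1} varies by str((-1)^r H_r(A) N) (`c_perturb`). The chain rule yields str(P̃_A(A) N) = 0, and
matrix units N isolate each entry of P̃_A(A).

Multiplicativity of the Berezinian, which also gives invariance under similarity, rests on det(1+XY)
det(1+YX) = 1 for odd X, Y (`evenDet_one_add_mul`). Integrality comes from a formula for the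
Berezinian that makes sense over every ring and commutes with all ring homomorphisms
(`ncCharSeries`).

For minimality, the variation along N = A gives Newton's identities, hence str A^n = ∑ λ_i^n - ∑
μ_α^n. If f(A) = 0 with deg f < p+q, then str(f(A) A^n) = 0 for all n, and two Vandermonde systems
force f = 0. Division with remainder by the monic associate of P̃_A does the rest. -/

noncomputable section

set_option linter.unusedSectionVars false

namespace SuperCH

/-! ## Derivatives of determinants and the Taylor formula -/

section Hankel

variable {R : Type*} [CommRing R]

theorem derivation_prod {A : Type*} [CommRing A] [Algebra R A] (D : Derivation R A A)
    {ι : Type*} [DecidableEq ι] (s : Finset ι) (f : ι → A) :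
    D (∏ i ∈ s, f i) = ∑ i ∈ s, (∏ j ∈ s.erase i, f j) * D (f i) := by
  induction s using Finset.induction_on with
  | empty => simp
  | insert a s ha ih =>
    rw [Finset.prod_insert ha, D.leibniz, ih, Finset.sum_insert ha, Finset.erase_insert ha,
      smul_eq_mul, smul_eq_mul, Finset.mul_sum, add_comm]
    congr 1
    refine Finset.sum_congr rfl fun i hi => ?_
    have hia : i ≠ a := fun h => ha (h ▸ hi)
    rw [Finset.erase_insert_of_ne hia.symm, Finset.prod_insert (by simp [ha]), mul_assoc]

/-- Jacobi's formula: the Leibniz rule differentiates one column at a time, and each resulting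
determinant is a component of Cramer's vector. -/
theorem derivation_det {A : Type*} [CommRing A] [Algebra R A] (D : Derivation R A A)
    {n : Type*} [Fintype n] [DecidableEq n] (M : Matrix n n A) :
    D M.det = ∑ i, ∑ j, M.adjugate j i * D (M i j) := by
  have h1 : D M.det = ∑ j, (M.updateCol j fun i => D (M i j)).det := by
    simp_rw [Matrix.det_apply, map_sum]
    rw [Finset.sum_comm]
    refine Finset.sum_congr rfl fun σ _ => ?_
    rw [Units.smul_def, map_zsmul, derivation_prod, Finset.smul_sum]
    refine Finset.sum_congr rfl fun i _ => ?_
    rw [Units.smul_def]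
    congr 1
    rw [← Finset.prod_erase_mul _ _ (Finset.mem_univ i), Matrix.updateCol_self]
    congr 1
    refine Finset.prod_congr rfl fun j hj => ?_
    rw [Matrix.updateCol_ne (Finset.ne_of_mem_erase hj)]
  rw [h1, Finset.sum_comm]
  refine Finset.sum_congr rfl fun j _ => ?_
  rw [← Matrix.cramer_apply, Matrix.cramer_eq_adjugate_mulVec, Matrix.mulVec, dotProduct]

/-- The first-order Taylor formula is exact here because all products of two increments vanish. It
is what turns an identity between the c_k into its derivative. -/
theorem aeval_add_of_mul_eq_zero {σ : Type*} (x y : σ → R) (hy : ∀ i j, y i * y j = 0)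
    (s : Finset σ) (hs : ∀ i ∉ s, y i = 0) (f : MvPolynomial σ ℤ) :
    MvPolynomial.aeval (x + y) f =
      MvPolynomial.aeval x f + ∑ i ∈ s, y i * MvPolynomial.aeval x (MvPolynomial.pderiv i f) := by
  classical
  induction f using MvPolynomial.induction_on with
  | C a => simp
  | add f g hf hg =>
    simp only [map_add, hf, hg, mul_add, Finset.sum_add_distrib]
    ring
  | mul_X f j hf =>
    have h0 : (∑ i ∈ s, y i * MvPolynomial.aeval x (MvPolynomial.pderiv i f)) * y j = 0 := by
      rw [Finset.sum_mul]
      refine Finset.sum_eq_zero fun i _ => ?_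
      rw [mul_right_comm, hy, zero_mul]
    have h1 : ∑ i ∈ s, y i * MvPolynomial.aeval x (MvPolynomial.pderiv i (f * MvPolynomial.X j)) =
        (∑ i ∈ s, y i * MvPolynomial.aeval x (MvPolynomial.pderiv i f)) * x j +
          y j * MvPolynomial.aeval x f := by
      simp only [Derivation.leibniz, MvPolynomial.pderiv_X, smul_eq_mul, map_add, map_mul,
        MvPolynomial.aeval_X, mul_add, Finset.sum_add_distrib, Finset.sum_mul]
      rw [add_comm]
      congr 1
      · exact Finset.sum_congr rfl fun i _ => by ring
      · rw [Finset.sum_eq_single j]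
        · simp [mul_comm]
        · intro i _ hi
          simp [hi.symm]
        · intro hj
          simp [hs j hj]
    rw [h1, map_mul, map_mul, hf, MvPolynomial.aeval_X, MvPolynomial.aeval_X, Pi.add_apply]
    linear_combination h0

theorem map_hankelDet {S : Type*} [CommRing S] (f : R →+* S) (x : ℤ → R) (k : ℤ) (n : ℕ) :
    f (hankelDet x k n) = hankelDet (fun i => f (x i)) k n := by
  rw [hankelDet, hankelDet, RingHom.map_det]
  rfl

theorem hankelDet_congr {x y : ℤ → R} {k : ℤ} {n : ℕ}
    (h : ∀ i j : Fin n, x (k + i + j) = y (k + i + j)) : hankelDet x k n = hankelDet y k n := by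
  rw [hankelDet, hankelDet]
  congr 1
  ext i j
  exact h i j

theorem aeval_hankelDet (x : ℤ → R) (k : ℤ) (n : ℕ) :
    MvPolynomial.aeval x (hankelDet (MvPolynomial.X : ℤ → MvPolynomial ℤ ℤ) k n) =
      hankelDet x k n := by
  have := map_hankelDet (MvPolynomial.aeval (R := ℤ) x).toRingHom MvPolynomial.X k n
  simpa using this

/-- By Jacobi's formula F_r is a sum of cofactors over the antidiagonal of positions in which c_r
stands. -/
theorem aeval_hankelPartial (p q : ℕ) (x : ℤ → R) (r : ℤ) :
    MvPolynomial.aeval x (hankelPartial p q r) =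
      ∑ i : Fin (q + 1), ∑ j : Fin (q + 1),
        (Matrix.of fun i j : Fin (q + 1) => x ((p : ℤ) - q + 1 + i + j)).adjugate j i *
          if (p : ℤ) - q + 1 + i + j = r then 1 else 0 := by
  rw [hankelPartial, hankelDet, derivation_det, map_sum]
  refine Finset.sum_congr rfl fun i _ => ?_
  rw [map_sum]
  refine Finset.sum_congr rfl fun j _ => ?_
  rw [map_mul]
  congr 1
  · have := congrFun (congrFun ((MvPolynomial.aeval (R := ℤ) x).toRingHom.map_adjugate
      (Matrix.of fun i j : Fin (q + 1) => MvPolynomial.X ((p : ℤ) - q + 1 + i + j))) j) i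
    simp only [RingHom.mapMatrix_apply, Matrix.map_apply] at this
    refine this.trans (congrArg (fun N => Matrix.adjugate N j i) (Matrix.ext fun a b => ?_))
    simp
  · simp only [Matrix.of_apply, MvPolynomial.pderiv_X, Pi.single_apply]
    split_ifs <;> simp

end Hankel

/-! ## Hankel determinants of a rational power series -/

section Fraction

variable {R : Type*} [CommRing R]

/-- The generating series of the sequence `x` is the quotient of a polynomial `P` of degree at
most `p` by a polynomial `Q = 1 + ⋯` of degree at most `q`. -/
structure IsFraction (p q : ℕ) (x : ℤ → R) (P Q : R[X]) : Prop where
  neg : ∀ k < 0, x k = 0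
  coeff_zero_den : Q.coeff 0 = 1
  natDegree_num : P.natDegree ≤ p
  natDegree_den : Q.natDegree ≤ q
  mul_den : (PowerSeries.mk fun n : ℕ => x n) * (Q : PowerSeries R) = (P : PowerSeries R)

theorem sum_mul_coeff_stable {x : ℤ → R} (hx : ∀ k < 0, x k = 0) (Q : R[X]) {q : ℕ}
    (hQ : Q.natDegree ≤ q) (n : ℤ) {N N' : ℕ} (hN : q < N ∨ n < N) (hN' : q < N' ∨ n < N') :
    ∑ b ∈ Finset.range N, x (n - b) * Q.coeff b = ∑ b ∈ Finset.range N', x (n - b) * Q.coeff b := by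
  have key : ∀ {A B : ℕ}, A ≤ B → (q < A ∨ n < A) →
      ∑ b ∈ Finset.range A, x (n - b) * Q.coeff b =
        ∑ b ∈ Finset.range B, x (n - b) * Q.coeff b := by
    intro A B hAB hA
    refine Finset.sum_subset (Finset.range_mono hAB) fun b _ hb => ?_
    have hb' : A ≤ b := by simpa using hb
    rcases hA with hA | hA
    · rw [Q.coeff_eq_zero_of_natDegree_lt (by omega), mul_zero]
    · rw [hx _ (by omega), zero_mul]
  rcases le_total N N' with h | h
  · exact key h hN
  · exact (key h hN').symm

theorem coeff_mk_mul {x : ℤ → R} (hx : ∀ k < 0, x k = 0) (Q : R[X]) {q : ℕ}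
    (hQ : Q.natDegree ≤ q) (n : ℕ) {N : ℕ} (hN : q < N ∨ (n : ℤ) < N) :
    PowerSeries.coeff n ((PowerSeries.mk fun n : ℕ => x n) * (Q : PowerSeries R)) =
      ∑ b ∈ Finset.range N, x (n - b) * Q.coeff b := by
  rw [sum_mul_coeff_stable hx Q hQ n hN (N' := n + 1) (Or.inr (by simp)), PowerSeries.coeff_mul,
    ← Finset.Nat.sum_antidiagonal_swap, Finset.Nat.sum_antidiagonal_eq_sum_range_succ_mk]
  refine Finset.sum_congr rfl fun b hb => ?_
  have : b ≤ n := by simpa [Nat.lt_succ_iff] using hb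
  simp [Nat.cast_sub this]

namespace IsFraction

variable {p q : ℕ} {x : ℤ → R} {P Q : R[X]}

theorem sum_mul_coeff (h : IsFraction p q x P Q) (n : ℤ) {N : ℕ} (hN : q < N ∨ n < N) :
    ∑ b ∈ Finset.range N, x (n - b) * Q.coeff b = if 0 ≤ n then P.coeff n.toNat else 0 := by
  split_ifs with hn
  · obtain ⟨m, rfl⟩ := Int.eq_ofNat_of_zero_le hn
    rw [← coeff_mk_mul h.neg Q h.natDegree_den m hN, h.mul_den]
    simp
  · exact Finset.sum_eq_zero fun b _ => by rw [h.neg _ (by omega), zero_mul]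

/-- This is the coefficient of z^{p+1+n} in the product of the series with `Q`, which is zero
because `P` has degree at most p. The order of the coefficients of `Q` is reversed since column
indices increase while the convolution index decreases. -/
theorem row_mul_den (h : IsFraction p q x P Q) (n : ℕ) :
    ∑ j : Fin (q + 1), x ((p : ℤ) - q + 1 + n + j) * Q.coeff (q - j) = 0 := by
  have h1 := h.sum_mul_coeff (p + 1 + n) (N := q + 1) (Or.inl (by simp))
  rw [if_pos (by omega), P.coeff_eq_zero_of_natDegree_lt
    (by have := h.natDegree_num; omega)] at h1
  rw [← h1, Finset.sum_range, ← Equiv.sum_comp Fin.revPerm]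
  refine Finset.sum_congr rfl fun j _ => ?_
  have : (j : ℕ) ≤ q := Nat.lt_succ_iff.mp j.2
  rw [Fin.revPerm_apply, Fin.val_rev]
  congr 2
  · omega
  · omega

/-- Multiplying the kernel relation by the adjugate gives det · Q.coeff 0 = 0 in the last component.
The entry 1 of the kernel vector makes this work without any assumption on zero divisors. -/
theorem det_rows (h : IsFraction p q x P Q) (ρ : Fin (q + 1) → ℕ) :
    (Matrix.of fun i j : Fin (q + 1) => x ((p : ℤ) - q + 1 + ρ i + j)).det = 0 := by
  have h1 : (Matrix.of fun i j : Fin (q + 1) => x ((p : ℤ) - q + 1 + ρ i + j)).mulVec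
      (fun j => Q.coeff (q - j)) = 0 := funext fun i => h.row_mul_den (ρ i)
  have h2 := congrArg (Matrix.adjugate (Matrix.of fun i j : Fin (q + 1) =>
    x ((p : ℤ) - q + 1 + ρ i + j))).mulVec h1
  rw [Matrix.mulVec_mulVec, Matrix.adjugate_mul, Matrix.smul_mulVec, Matrix.one_mulVec] at h2
  simpa [h.coeff_zero_den] using congrFun h2 (Fin.last q)

end IsFraction

theorem adjugate_last_last {q : ℕ} (M : Matrix (Fin (q + 1)) (Fin (q + 1)) R) :
    M.adjugate (Fin.last q) (Fin.last q) = (M.submatrix Fin.castSucc Fin.castSucc).det := by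
  rw [Matrix.adjugate_fin_succ_eq_det_submatrix, Even.neg_one_pow (by simp), one_mul,
    Fin.succAbove_last]

/-- Let `V` be the unimodular matrix with last column `v` and the other columns those of the
identity. Then VᵀMV has zero last row and column, by symmetry, so its adjugate lives in the last
corner; pulling back by `V` spreads the corner entry into v vᵀ. -/
theorem adjugate_of_mulVec_eq_zero {q : ℕ} {M : Matrix (Fin (q + 1)) (Fin (q + 1)) R}
    (hM : M.IsSymm) {v : Fin (q + 1) → R} (hv : v (Fin.last q) = 1) (hMv : M.mulVec v = 0)
    (i j : Fin (q + 1)) :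
    M.adjugate i j = (M.submatrix Fin.castSucc Fin.castSucc).det * (v i * v j) := by
  set V : Matrix (Fin (q + 1)) (Fin (q + 1)) R :=
    (1 : Matrix (Fin (q + 1)) (Fin (q + 1)) R).updateCol (Fin.last q) v with hV
  have hVdet : V.det = 1 := by
    rw [hV, ← Matrix.cramer_apply, Matrix.cramer_one]
    simpa using hv
  have hVc : ∀ (A : Matrix (Fin (q + 1)) (Fin (q + 1)) R) i (j : Fin q),
      (A * V) i j.castSucc = A i j.castSucc := by
    intro A i j
    rw [Matrix.mul_apply, Finset.sum_eq_single j.castSucc]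
    · simp [hV, (Fin.castSucc_lt_last j).ne]
    · intro k _ hk
      simp [hV, (Fin.castSucc_lt_last j).ne, hk]
    · simp
  have hMV : ∀ i, (M * V) i (Fin.last q) = 0 := by
    intro i
    have := congrFun hMv i
    simpa [Matrix.mulVec, dotProduct, Matrix.mul_apply, hV] using this
  set N := V.transpose * (M * V) with hN
  have hNs : N.IsSymm := by
    rw [Matrix.IsSymm, hN, Matrix.transpose_mul, Matrix.transpose_mul, Matrix.transpose_transpose,
      hM.eq, Matrix.mul_assoc]
  have hNl : ∀ i, N i (Fin.last q) = 0 := by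
    intro i
    rw [hN, Matrix.mul_apply]
    exact Finset.sum_eq_zero fun k _ => by rw [hMV, mul_zero]
  have hNc : N.submatrix Fin.castSucc Fin.castSucc = M.submatrix Fin.castSucc Fin.castSucc := by
    have hN' : N = (M * V).transpose * V :=
      hNs.eq.symm.trans (by rw [hN, Matrix.transpose_mul, Matrix.transpose_transpose])
    ext i j
    rw [Matrix.submatrix_apply, Matrix.submatrix_apply, hN', hVc, Matrix.transpose_apply, hVc,
      hM.apply]
  have hNadj : ∀ i j, N.adjugate i j =
      if i = Fin.last q ∧ j = Fin.last q then (M.submatrix Fin.castSucc Fin.castSucc).det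
      else 0 := by
    intro i j
    split_ifs with hij
    · rw [hij.1, hij.2, adjugate_last_last, hNc]
    · rw [Matrix.adjugate_apply]
      by_cases hj : j = Fin.last q
      · refine Matrix.det_eq_zero_of_column_eq_zero (Fin.last q) fun k => ?_
        rw [Matrix.updateRow_apply]
        split_ifs with hk
        · simp [show Fin.last q ≠ i from fun h => hij ⟨h.symm, hj⟩]
        · exact hNl k
      · refine Matrix.det_eq_zero_of_row_eq_zero (Fin.last q) fun k => ?_
        rw [Matrix.updateRow_ne (Ne.symm hj), ← hNs.apply, hNl]
  have hadj : M.adjugate = V * N.adjugate * V.transpose := by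
    rw [hN, Matrix.adjugate_mul_distrib, Matrix.adjugate_mul_distrib]
    have h1 : V * V.adjugate = 1 := by rw [Matrix.mul_adjugate, hVdet, one_smul]
    have h2 : V.transpose.adjugate * V.transpose = 1 := by
      rw [Matrix.adjugate_mul, Matrix.det_transpose, hVdet, one_smul]
    calc M.adjugate = (V * V.adjugate) * M.adjugate * (V.transpose.adjugate * V.transpose) := by
          rw [h1, h2, one_mul, mul_one]
      _ = _ := by simp only [Matrix.mul_assoc]
  rw [hadj, Matrix.mul_apply, Finset.sum_eq_single (Fin.last q)]
  · rw [Matrix.mul_apply, Finset.sum_eq_single (Fin.last q)]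
    · rw [hNadj, if_pos ⟨rfl, rfl⟩, Matrix.transpose_apply, hV, Matrix.updateCol_self,
        Matrix.updateCol_self]
      ring
    · intro k _ hk
      rw [hNadj, if_neg (fun h => hk h.1), mul_zero]
    · simp
  · intro k _ hk
    rw [Matrix.mul_apply, Finset.sum_eq_zero, zero_mul]
    intro l _
    rw [hNadj, if_neg (fun h => hk h.2), mul_zero]
  · simp

theorem hankelDet_eq_submatrix (x : ℤ → R) (k : ℤ) (q : ℕ) :
    hankelDet x k q =
      ((Matrix.of fun i j : Fin (q + 1) => x (k + i + j)).submatrix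
        Fin.castSucc Fin.castSucc).det := rfl

theorem reflectNeg_succ (n : ℕ) (P : R[X]) :
    reflectNeg (n + 1) P = C (P.coeff (n + 1)) + (-X) * reflectNeg n P := by
  rw [reflectNeg, Finset.sum_range_succ, reflectNeg, Finset.mul_sum, add_comm]
  congr 1
  · simp
  · refine Finset.sum_congr rfl fun i hi => ?_
    have : i ≤ n := by simpa [Nat.lt_succ_iff] using hi
    rw [show n + 1 - i = (n - i) + 1 by omega, pow_succ]
    ring

theorem reflectNeg_add {n : ℕ} {P : R[X]} (hP : P.natDegree ≤ n) (k : ℕ) :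
    reflectNeg (n + k) P = (-X) ^ k * reflectNeg n P := by
  induction k with
  | zero => simp
  | succ k ih =>
    rw [← add_assoc, reflectNeg_succ, ih, P.coeff_eq_zero_of_natDegree_lt (by omega), pow_succ]
    simp
    ring

theorem reflectNeg_X_mul (n : ℕ) (P : R[X]) : reflectNeg (n + 1) (X * P) = reflectNeg n P := by
  rw [reflectNeg, Finset.sum_range_succ', reflectNeg]
  simp [coeff_X_mul]

theorem reflectNeg_mul_linear {n : ℕ} {P : R[X]} (hP : P.natDegree ≤ n) (l : R) :
    reflectNeg (n + 1) ((1 + C l * X) * P) = (C l - X) * reflectNeg n P := by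
  have h1 : reflectNeg (n + 1) ((1 + C l * X) * P) =
      reflectNeg (n + 1) P + C l * reflectNeg (n + 1) (X * P) := by
    simp only [reflectNeg, Finset.mul_sum, ← Finset.sum_add_distrib]
    refine Finset.sum_congr rfl fun i _ => ?_
    rw [add_mul, one_mul, mul_assoc, coeff_add, coeff_C_mul]
    simp only [map_add, map_mul]
    ring
  rw [h1, reflectNeg_X_mul, reflectNeg_add hP 1]
  ring

theorem natDegree_prod_linear_le {n : ℕ} (l : Fin n → R) :
    (∏ i, (1 + C (l i) * X)).natDegree ≤ n := by
  refine (natDegree_prod_le _ _).trans ((Finset.sum_le_card_nsmul _ _ 1 fun i _ => ?_).trans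
    (by simp))
  change (1 + C (l i) * X).natDegree ≤ 1
  compute_degree

theorem reflectNeg_prod_linear {n : ℕ} (l : Fin n → R) :
    reflectNeg n (∏ i, (1 + C (l i) * X)) = ∏ i, (C (l i) - X) := by
  induction n with
  | zero => simp [reflectNeg]
  | succ n ih =>
    rw [Fin.prod_univ_succ, Fin.prod_univ_succ, reflectNeg_mul_linear (natDegree_prod_linear_le _),
      ih fun i => l i.succ]

/-- `(-1)^r H_r(z) = ∑ x_i (-z)^{r-i}`. -/
def signedCHPoly (x : ℤ → R) (r : ℤ) : R[X] := C ((-1) ^ r.natAbs) * cayleyHamiltonPoly x r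

theorem signedCHPoly_of_neg (x : ℤ → R) {r : ℤ} (hr : r < 0) : signedCHPoly x r = 0 := by
  rw [signedCHPoly, cayleyHamiltonPoly, Finset.Icc_eq_empty (by omega)]
  simp

theorem signedCHPoly_eq (x : ℤ → R) (r : ℤ) :
    signedCHPoly x r = ∑ i ∈ Finset.Icc 0 r, C (x i) * (-X) ^ (r - i).toNat := by
  rw [signedCHPoly, cayleyHamiltonPoly, Finset.mul_sum]
  refine Finset.sum_congr rfl fun i hi => ?_
  rw [Finset.mem_Icc] at hi
  rw [neg_pow (X : R[X]), show r.natAbs = i.natAbs + (r - i).toNat by omega, pow_add]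
  simp only [map_mul, map_pow, map_neg, map_one]
  have : ((-1 : R[X]) ^ i.natAbs) * (-1) ^ i.natAbs = 1 := by
    rw [← mul_pow]; simp
  linear_combination ((-1) ^ (r - i).toNat * C (x i) * X ^ (r - i).toNat) * this

theorem signedCHPoly_add_one {x : ℤ → R} (hx : ∀ k < 0, x k = 0) (r : ℤ) :
    signedCHPoly x (r + 1) = C (x (r + 1)) + (-X) * signedCHPoly x r := by
  rcases lt_or_ge (r + 1) 0 with hr | hr
  · rw [signedCHPoly_of_neg x hr, signedCHPoly_of_neg x (by omega), hx _ hr]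
    simp
  · have : Finset.Icc 0 (r + 1) = insert (r + 1) (Finset.Icc 0 r) := by
      ext i
      simp only [Finset.mem_insert, Finset.mem_Icc]
      omega
    rw [signedCHPoly_eq, this, Finset.sum_insert (by simp), signedCHPoly_eq, Finset.mul_sum]
    congr 1
    · simp
    · refine Finset.sum_congr rfl fun i hi => ?_
      rw [Finset.mem_Icc] at hi
      rw [show (r + 1 - i).toNat = (r - i).toNat + 1 by omega, pow_succ]
      ring

namespace IsFraction

variable {p q : ℕ} {x : ℤ → R} {P Q : R[X]}

/-- In generating functions: ∑ (-1)^r H_r(z) t^r = x(t)/(1+zt), and multiplication by Q(t) gives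
P(t)/(1+zt), whose coefficient of t^n is the right-hand side. The induction is the corresponding
Horner recursion. -/
theorem sum_signedCHPoly (h : IsFraction p q x P Q) (n : ℕ) :
    ∑ b ∈ Finset.range (q + 1), C (Q.coeff b) * signedCHPoly x ((n : ℤ) - b) =
      reflectNeg n P := by
  have key : ∀ r : ℤ, ∑ b ∈ Finset.range (q + 1), C (Q.coeff b) * signedCHPoly x (r + 1 - b) =
      C (if 0 ≤ r + 1 then P.coeff (r + 1).toNat else 0) +
        (-X) * ∑ b ∈ Finset.range (q + 1), C (Q.coeff b) * signedCHPoly x (r - b) := by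
    intro r
    rw [← h.sum_mul_coeff (r + 1) (N := q + 1) (Or.inl (by simp)), map_sum, Finset.mul_sum,
      ← Finset.sum_add_distrib]
    refine Finset.sum_congr rfl fun b _ => ?_
    rw [show r + 1 - (b : ℤ) = r - b + 1 by ring, signedCHPoly_add_one h.neg, map_mul]
    ring
  induction n with
  | zero =>
    have h0 := key (-1)
    rw [Finset.sum_eq_zero (f := fun b : ℕ => C (Q.coeff b) * signedCHPoly x (-1 - b))
      (fun b _ => by rw [signedCHPoly_of_neg x (by omega), mul_zero])] at h0
    simpa [reflectNeg] using h0
  | succ n ih =>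
    have h0 := key n
    rw [ih, if_pos (by omega)] at h0
    rw [reflectNeg_succ]
    simpa using h0

theorem aeval_hankelPartial (h : IsFraction p q x P Q) (r : ℤ) :
    MvPolynomial.aeval x (hankelPartial p q r) =
      ∑ a ∈ Finset.range (q + 1), ∑ b ∈ Finset.range (q + 1),
        hankelDet x ((p : ℤ) - q + 1) q * (Q.coeff a * Q.coeff b) *
          if (p : ℤ) + q - a - b + 1 = r then 1 else 0 := by
  have hsymm : (Matrix.of fun i j : Fin (q + 1) => x ((p : ℤ) - q + 1 + i + j)).IsSymm :=
    Matrix.IsSymm.ext fun i j => by simp [add_right_comm]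
  have hv : (Matrix.of fun i j : Fin (q + 1) => x ((p : ℤ) - q + 1 + i + j)).mulVec
      (fun j => Q.coeff (q - j)) = 0 := funext fun i => h.row_mul_den i
  rw [SuperCH.aeval_hankelPartial, Finset.sum_range, ← Equiv.sum_comp Fin.revPerm]
  refine Finset.sum_congr rfl fun i _ => ?_
  rw [Finset.sum_range, ← Equiv.sum_comp Fin.revPerm]
  refine Finset.sum_congr rfl fun j _ => ?_
  rw [adjugate_of_mulVec_eq_zero hsymm (by simp [h.coeff_zero_den]) hv, hankelDet_eq_submatrix]
  simp only [Fin.revPerm_apply, Fin.val_rev]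
  rw [show q - (q + 1 - ((i : ℕ) + 1)) = i by omega, show q - (q + 1 - ((j : ℕ) + 1)) = j by omega]
  rw [mul_comm (Q.coeff j)]
  congr 1
  refine if_congr ?_ rfl rfl
  omega

/-- The rank-one adjugate turns the sum over r into a double sum over pairs of coefficients of `Q`.
Summation over b produces (-z)^{q-a} times the reflected `P`, by `sum_signedCHPoly`, and the
remaining sum over a is the reflected `Q`. -/
theorem modifiedPoly_eq (h : IsFraction p q x P Q) :
    modifiedPoly p q x =
      C (hankelDet x ((p : ℤ) - q + 1) q) * (reflectNeg p P * reflectNeg q Q) := by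
  have h1 : modifiedPoly p q x = ∑ a ∈ Finset.range (q + 1), ∑ b ∈ Finset.range (q + 1),
      C (hankelDet x ((p : ℤ) - q + 1) q) * (C (Q.coeff a) * C (Q.coeff b)) *
        signedCHPoly x ((p + q : ℤ) - a - b) := by
    rw [modifiedPoly]
    have h2 : ∀ r, C ((-1) ^ r.natAbs * MvPolynomial.aeval x (hankelPartial p q (r + 1))) *
        cayleyHamiltonPoly x r = ∑ a ∈ Finset.range (q + 1), ∑ b ∈ Finset.range (q + 1),
        if (p : ℤ) + q - a - b = r then
        C (hankelDet x ((p : ℤ) - q + 1) q) * (C (Q.coeff a) * C (Q.coeff b)) *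
        signedCHPoly x ((p + q : ℤ) - a - b) else 0 := by
      intro r
      rw [h.aeval_hankelPartial, Finset.mul_sum, map_sum, Finset.sum_mul]
      refine Finset.sum_congr rfl fun a _ => ?_
      rw [Finset.mul_sum, map_sum, Finset.sum_mul]
      refine Finset.sum_congr rfl fun b _ => ?_
      by_cases hr : (p : ℤ) + q - a - b = r
      · rw [if_pos hr, if_pos (by omega), hr, signedCHPoly]
        simp only [map_mul, mul_one]
        ring
      · rw [if_neg hr, if_neg (by omega)]
        simp
    rw [Finset.sum_congr rfl fun r _ => h2 r, Finset.sum_comm]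
    refine Finset.sum_congr rfl fun a ha => ?_
    rw [Finset.sum_comm]
    refine Finset.sum_congr rfl fun b hb => ?_
    rw [Finset.mem_range] at ha hb
    rw [Finset.sum_ite_eq, if_pos]
    rw [Finset.mem_Icc]
    omega
  have h3 : ∀ a ∈ Finset.range (q + 1), ∑ b ∈ Finset.range (q + 1),
      C (hankelDet x ((p : ℤ) - q + 1) q) * (C (Q.coeff a) * C (Q.coeff b)) *
        signedCHPoly x ((p + q : ℤ) - a - b) = C (hankelDet x ((p : ℤ) - q + 1) q) *
        (reflectNeg p P * (C (Q.coeff a) * (-X) ^ (q - a))) := by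
    intro a ha
    have ha' : a ≤ q := by simpa [Nat.lt_succ_iff] using ha
    have h4 := h.sum_signedCHPoly (p + (q - a))
    rw [reflectNeg_add h.natDegree_num] at h4
    rw [show C (hankelDet x ((p : ℤ) - q + 1) q) * (reflectNeg p P * (C (Q.coeff a) *
      (-X) ^ (q - a))) = C (hankelDet x ((p : ℤ) - q + 1) q) * C (Q.coeff a) *
        ((-X) ^ (q - a) * reflectNeg p P) by ring, ← h4, Finset.mul_sum]
    refine Finset.sum_congr rfl fun b _ => ?_
    rw [show ((p + (q - a) : ℕ) : ℤ) - b = (p : ℤ) + q - a - b by omega]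
    ring
  rw [h1, Finset.sum_congr rfl h3, ← Finset.mul_sum, ← Finset.mul_sum]
  rfl

end IsFraction

end Fraction

/-! ### Resultants as Toeplitz determinants; existence and uniqueness of the fraction. -/

section Resultant

variable {R : Type*} [CommRing R]

theorem sign_revPerm (n : ℕ) :
    Equiv.Perm.sign (Fin.revPerm : Equiv.Perm (Fin n)) = (-1) ^ (n * (n - 1) / 2) := by
  rw [Equiv.Perm.sign_eq_prod_prod_Ioi]
  have : ∀ i : Fin n, ∏ j ∈ Finset.Ioi i,
      (if Fin.revPerm i < Fin.revPerm j then (1 : ℤˣ) else -1) = (-1) ^ (n - 1 - i) := by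
    intro i
    rw [Finset.prod_congr rfl (g := fun _ => (-1 : ℤˣ)), Finset.prod_const, Fin.card_Ioi]
    intro j hj
    rw [Finset.mem_Ioi] at hj
    simp [hj.le]
  rw [Finset.prod_congr rfl fun i _ => this i, Finset.prod_pow_eq_pow_sum,
    ← Finset.sum_range fun i => n - 1 - i, Finset.sum_range_reflect (fun i => i),
    Finset.sum_range_id]

namespace IsFraction

variable {p q : ℕ} {x : ℤ → R} {P Q : R[X]}

/-- Since P = xQ as power series, the Sylvester matrix is `T * N`. Here `T` is the lower triangular
Toeplitz matrix of `Q`, with ones on the diagonal, and `N` has p unit columns followed by q shifted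
copies of the sequence `x`. `N` is block triangular with an identity block, which leaves the
Toeplitz determinant of order q. -/
theorem resultant_eq (h : IsFraction p q x P Q) :
    resultant P Q p q = (Matrix.of fun i j : Fin q => x ((p : ℤ) + i - j)).det := by
  set T : Matrix (Fin (p + q)) (Fin (p + q)) R :=
    Matrix.of fun i k => if k ≤ i then Q.coeff (i - k) else 0 with hT
  set N : Matrix (Fin (p + q)) (Fin (p + q)) R :=
    Matrix.of fun i j => j.addCases (fun j₁ : Fin p => if (i : ℕ) = j₁ then 1 else 0)
      (fun j₁ : Fin q => x ((i : ℤ) - j₁)) with hN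
  have hTN : sylvester P Q p q = T * N := by
    ext i j
    refine j.addCases (fun j₁ => ?_) (fun j₁ => ?_)
    · rw [sylvester, Matrix.of_apply, Fin.addCases_left, Matrix.mul_apply,
        Finset.sum_eq_single (Fin.castAdd q j₁)]
      · simp only [hT, hN, Matrix.of_apply, Fin.addCases_left, Fin.val_castAdd, if_true, mul_one,
          Set.mem_Icc, Fin.le_def]
        by_cases h1 : (j₁ : ℕ) ≤ i
        · rw [if_pos h1]
          split_ifs with h2
          · rfl
          · rw [Q.coeff_eq_zero_of_natDegree_lt]
            have := h.natDegree_den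
            omega
        · rw [if_neg h1, if_neg fun h2 => h1 h2.1]
      · intro k _ hk
        simp only [hN, Matrix.of_apply, Fin.addCases_left]
        rw [if_neg, mul_zero]
        intro h1
        exact hk (Fin.ext h1)
      · simp
    · rw [sylvester, Matrix.of_apply, Fin.addCases_right, Matrix.mul_apply]
      simp only [hT, hN, Matrix.of_apply, Fin.addCases_right, Fin.le_def]
      have h1 := h.sum_mul_coeff ((i : ℤ) - j₁) (N := i + 1) (Or.inr (by push_cast; omega))
      rw [← Finset.sum_range fun k => (if k ≤ (i : ℕ) then Q.coeff (i - k) else 0) *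
        x ((k : ℤ) - j₁), ← Finset.sum_subset (s₁ := Finset.range (i + 1))
          (Finset.range_mono i.2), ← Finset.sum_range_reflect]
      · rw [Finset.sum_congr rfl (g := fun b : ℕ => x ((i : ℤ) - j₁ - b) * Q.coeff b), h1]
        · simp only [Set.mem_Icc]
          by_cases h2 : (j₁ : ℕ) ≤ i
          · rw [if_pos (by omega : (0 : ℤ) ≤ (i : ℤ) - j₁),
              show ((i : ℤ) - j₁).toNat = i - j₁ by omega]
            split_ifs with h3
            · rfl
            · rw [P.coeff_eq_zero_of_natDegree_lt]
              have := h.natDegree_num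
              omega
          · rw [if_neg fun h3 => h2 h3.1, if_neg (by omega)]
        · intro b hb
          have hb' : b ≤ i := by simpa [Nat.lt_succ_iff] using hb
          rw [if_pos (by omega), mul_comm, show (i : ℕ) - (i + 1 - 1 - b) = b by omega]
          congr 2
          omega
      · intro k _ hk
        rw [if_neg (by simpa [Nat.lt_succ_iff] using hk), zero_mul]
  have hTdet : T.det = 1 := by
    rw [Matrix.det_of_isLowerTriangular]
    · exact Finset.prod_eq_one fun i _ => by simp [hT, h.coeff_zero_den]
    · intro i j hij
      have : i < j := by simpa using hij
      simp [hT, this]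
  have hNdet : N.det = (Matrix.of fun i j : Fin q => x ((p : ℤ) + i - j)).det := by
    rw [← Matrix.det_submatrix_equiv_self finSumFinEquiv]
    have : N.submatrix finSumFinEquiv finSumFinEquiv =
        Matrix.fromBlocks 1 (Matrix.of fun (i : Fin p) (j : Fin q) => x ((i : ℤ) - j)) 0
          (Matrix.of fun i j : Fin q => x ((p : ℤ) + i - j)) := by
      ext i j
      rcases i with i | i <;> rcases j with j | j
      · simp [hN, Matrix.one_apply, Fin.ext_iff]
      · simp [hN]
      · have := j.2
        simp [hN]
        omega
      · simp [hN]
    rw [this, Matrix.det_fromBlocks_zero₂₁, Matrix.det_one, one_mul]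
  rw [resultant, hTN, Matrix.det_mul, hTdet, hNdet, one_mul]

/-- Reversing the columns turns the Toeplitz matrix into the Hankel matrix; the sign is that of the
reversal permutation. -/
theorem hankelDet_eq (h : IsFraction p q x P Q) :
    hankelDet x ((p : ℤ) - q + 1) q = (-1) ^ (q * (q - 1) / 2) * resultant P Q p q := by
  rw [h.resultant_eq]
  have h1 := Matrix.det_permute' (Fin.revPerm : Equiv.Perm (Fin q))
    (Matrix.of fun i j : Fin q => x ((p : ℤ) + i - j))
  rw [sign_revPerm] at h1
  push_cast at h1
  rw [← h1, hankelDet]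
  congr 1
  ext i j
  rw [Matrix.of_apply, Matrix.submatrix_apply, Matrix.of_apply, Fin.revPerm_apply, Fin.val_rev]
  congr 1
  simp only [id]
  omega

/-- Both denominators have constant term 1, so the difference of their reversed coefficient vectors
lives in the first q coordinates and is killed by the invertible Hankel matrix of order q. -/
theorem ext_of_isUnit (h0 : IsUnit (hankelDet x ((p : ℤ) - q + 1) q)) {P' Q' : R[X]}
    (h : IsFraction p q x P Q) (h' : IsFraction p q x P' Q') : P = P' ∧ Q = Q' := by
  have hQ : Q = Q' := by
    have h1 : (Matrix.of fun i j : Fin q => x ((p : ℤ) - q + 1 + i + j)).mulVec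
        (fun j => Q.coeff (q - j) - Q'.coeff (q - j)) = 0 := by
      ext i
      have e1 := h.row_mul_den i
      have e2 := h'.row_mul_den i
      rw [Fin.sum_univ_castSucc] at e1 e2
      simp only [Fin.val_castSucc, Fin.val_last, Nat.sub_self, h.coeff_zero_den,
        h'.coeff_zero_den] at e1 e2
      simp only [Matrix.mulVec, dotProduct, Matrix.of_apply, mul_sub, Finset.sum_sub_distrib,
        Pi.zero_apply]
      linear_combination e1 - e2
    have h2 := congrArg (Matrix.mulVec
      (Matrix.of fun i j : Fin q => x ((p : ℤ) - q + 1 + i + j))⁻¹) h1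
    rw [Matrix.mulVec_mulVec, Matrix.nonsing_inv_mul _ h0, Matrix.one_mulVec,
      Matrix.mulVec_zero] at h2
    ext n
    rcases lt_or_ge q n with hn | hn
    · rw [Q.coeff_eq_zero_of_natDegree_lt (h.natDegree_den.trans_lt hn),
        Q'.coeff_eq_zero_of_natDegree_lt (h'.natDegree_den.trans_lt hn)]
    · rcases Nat.eq_zero_or_pos n with rfl | hn'
      · rw [h.coeff_zero_den, h'.coeff_zero_den]
      · have := congrFun h2 ⟨q - n, by omega⟩
        simp only [Pi.zero_apply] at this
        rw [show q - (q - n) = n by omega] at this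
        exact sub_eq_zero.mp this
  refine ⟨?_, hQ⟩
  have h1 := h.mul_den
  rw [hQ, h'.mul_den] at h1
  exact (Polynomial.coe_inj.mp h1).symm

end IsFraction

/-- The invertible Hankel matrix of order q determines a denominator satisfying the first q
recurrence equations; the vanishing minors of order q+1 propagate the recurrence to all later rows.
-/
theorem exists_isFraction {p q : ℕ} {x : ℤ → R} (hx : ∀ k < 0, x k = 0)
    (hdet : ∀ ρ : Fin (q + 1) → ℕ,
      (Matrix.of fun i j : Fin (q + 1) => x ((p : ℤ) - q + 1 + ρ i + j)).det = 0)
    (h0 : IsUnit (hankelDet x ((p : ℤ) - q + 1) q)) :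
    ∃ P Q : R[X], IsFraction p q x P Q := by
  set M : Matrix (Fin q) (Fin q) R := Matrix.of fun i j => x ((p : ℤ) - q + 1 + i + j)
  set w : Fin q → R := M⁻¹.mulVec fun i => -x ((p : ℤ) + 1 + i) with hw
  have hMw : M.mulVec w = fun i : Fin q => -x ((p : ℤ) + 1 + i) := by
    rw [hw, Matrix.mulVec_mulVec, Matrix.mul_nonsing_inv _ h0, Matrix.one_mulVec]
  set v : Fin (q + 1) → R := Fin.snoc w 1 with hv
  have hvl : v (Fin.last q) = 1 := by simp [hv]
  have hvc : ∀ j : Fin q, v j.castSucc = w j := fun j => by simp [hv]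
  have hrow : ∀ n : ℕ, ∑ j : Fin (q + 1), x ((p : ℤ) - q + 1 + n + j) * v j = 0 := by
    intro n
    -- Rows 0, …, q-1 together with row n. Since `v` already satisfies the first q equations, the
    -- last row of adj(A)·A·v = 0 reads (last corner of the adjugate) · (equation n) = 0, and that
    -- corner is the invertible Hankel determinant.
    set ρ : Fin (q + 1) → ℕ := Fin.snoc (fun i : Fin q => (i : ℕ)) n with hρ
    set A : Matrix (Fin (q + 1)) (Fin (q + 1)) R :=
      Matrix.of fun i j => x ((p : ℤ) - q + 1 + ρ i + j) with hA
    have h1 : A.adjugate.mulVec (A.mulVec v) = 0 := by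
      rw [Matrix.mulVec_mulVec, Matrix.adjugate_mul, hdet ρ, zero_smul, Matrix.zero_mulVec]
    have h2 : ∀ i : Fin q, A.mulVec v i.castSucc = 0 := by
      intro i
      have := congrFun hMw i
      simp only [Matrix.mulVec, dotProduct] at this ⊢
      rw [Fin.sum_univ_castSucc]
      simp only [hvl, hvc, hA, hρ, Matrix.of_apply, Fin.snoc_castSucc, Fin.val_castSucc,
        Fin.val_last, mul_one]
      refine (congrArg₂ (· + ·) this (congrArg x ?_)).trans (neg_add_cancel (x ((p : ℤ) + 1 + i)))
      ring
    have h3 := congrFun h1 (Fin.last q)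
    rw [Matrix.mulVec, dotProduct, Fin.sum_univ_castSucc] at h3
    simp only [h2, mul_zero, Finset.sum_const_zero, zero_add, Pi.zero_apply] at h3
    rw [adjugate_last_last] at h3
    have h4 : (A.submatrix Fin.castSucc Fin.castSucc).det =
        hankelDet x ((p : ℤ) - q + 1) q := by
      rw [hankelDet]
      congr 1
      ext i j
      simp [hA, hρ]
    rw [h4] at h3
    have h5 := (h0.mul_right_eq_zero).mp h3
    simpa [Matrix.mulVec, dotProduct, hA, hρ] using h5
  set Q : R[X] := ∑ j ∈ Finset.range (q + 1), C (v (Fin.ofNat (q + 1) (q - j))) * X ^ j with hQ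
  have hQc : ∀ n, Q.coeff n = if n ≤ q then v (Fin.ofNat (q + 1) (q - n)) else 0 := by
    intro n
    rw [hQ, finsetSum_coeff]
    simp [coeff_C_mul, coeff_X_pow]
  have hQd : Q.natDegree ≤ q := by
    rw [natDegree_le_iff_coeff_eq_zero]
    intro n hn
    rw [hQc, if_neg (by omega)]
  set f := (PowerSeries.mk fun n : ℕ => x n) * (Q : PowerSeries R) with hf
  have hfc : ∀ n, p < n → PowerSeries.coeff n f = 0 := by
    intro n hn
    obtain ⟨k, rfl⟩ := Nat.exists_eq_add_of_lt hn
    rw [hf, coeff_mk_mul hx Q hQd _ (N := q + 1) (Or.inl (by simp)), ← hrow k,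
      Finset.sum_range, ← Equiv.sum_comp Fin.revPerm]
    refine Finset.sum_congr rfl fun j _ => ?_
    have hj : (j : ℕ) ≤ q := Nat.lt_succ_iff.mp j.2
    rw [Fin.revPerm_apply, Fin.val_rev, hQc, if_pos (by omega)]
    congr 2
    · omega
    · ext
      simp only [Fin.ofNat, show q - (q + 1 - ((j : ℕ) + 1)) = j by omega]
      exact Nat.mod_eq_of_lt j.2
  -- Truncation loses nothing, because the coefficients of `f` beyond degree p vanish.
  refine ⟨PowerSeries.trunc (p + 1) f, Q, hx, ?_, ?_, hQd, ?_⟩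
  · rw [hQc, if_pos (Nat.zero_le _), ← hvl]
    congr 1
    ext
    simp [Fin.ofNat]
  · rw [natDegree_le_iff_coeff_eq_zero]
    intro n hn
    rw [PowerSeries.coeff_trunc, if_neg (by omega)]
  · ext n
    rw [Polynomial.coeff_coe, PowerSeries.coeff_trunc]
    split_ifs with hn
    · rfl
    · exact hfc n (by omega)

theorem resultant_linear (a b : R) :
    resultant (1 + C a * X) (1 + C b * X) 1 1 = a - b := by
  rw [resultant]
  have : sylvester (1 + C a * X) (1 + C b * X) 1 1 = !![1, 1; b, a] := by
    ext i j
    fin_cases i <;> fin_cases j <;>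
      simp [sylvester, Fin.addCases, coeff_one]
  rw [this]
  change Matrix.det (n := Fin 2) _ = _
  rw [Matrix.det_fin_two_of]
  ring

/-- Nonzero parameters in a domain make every linear factor, and hence every product, of full
degree, as multiplicativity of the resultant in formal degrees requires. -/
theorem resultant_prod_linear_of_ne_zero {U : Type*} [CommRing U] [IsDomain U] {p q : ℕ}
    (L : Fin p → U) (M : Fin q → U) (hL : ∀ i, L i ≠ 0) (hM : ∀ α, M α ≠ 0) :
    resultant (∏ i, (1 + C (L i) * X)) (∏ α, (1 + C (M α) * X)) p q =
      ∏ i, ∏ α, (L i - M α) := by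
  have hd : ∀ a : U, a ≠ 0 → (1 + C a * X).natDegree = 1 := fun a ha => by
    rw [add_comm]; exact natDegree_linear (b := 1) ha
  have hl : ∀ a : U, a ≠ 0 → (1 + C a * X).leadingCoeff = a := fun a ha => by
    rw [add_comm]; exact leadingCoeff_linear (b := 1) ha
  have hd' : ∀ {n : ℕ} (a : Fin n → U), (∀ i, a i ≠ 0) →
      (∏ i, (1 + C (a i) * X)).natDegree = n := fun {n} a ha => by
    rw [natDegree_prod']
    · simp [hd _ (ha _)]
    · simpa only [hl _ (ha _)] using Finset.prod_ne_zero_iff.mpr fun i _ => ha i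
  have e := resultant_prod_left Finset.univ (fun i => 1 + C (L i) * X)
    (∏ α, (1 + C (M α) * X)) q 
    (by simpa only [hl _ (hL _)] using Finset.prod_ne_zero_iff.mpr fun i _ => hL i)
    (hd' M hM).le
  rw [hd' L hL] at e
  rw [e]
  refine Finset.prod_congr rfl fun i _ => ?_
  have e' := resultant_prod_right Finset.univ (1 + C (L i) * X) (fun α => 1 + C (M α) * X) 1
    (hd _ (hL i)).le 
    (by simpa only [hl _ (hM _)] using Finset.prod_ne_zero_iff.mpr fun i _ => hM i)
  rw [hd' M hM] at e'
  rw [hd _ (hL i), e']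
  refine Finset.prod_congr rfl fun α _ => ?_
  rw [hd _ (hM α), resultant_linear]

/-- A specialization of the same identity in ℤ[L, M], where the variables are nonzero elements of a
domain. -/
theorem resultant_prod_linear {p q : ℕ} (l : Fin p → R) (m : Fin q → R) :
    resultant (∏ i, (1 + C (l i) * X)) (∏ α, (1 + C (m α) * X)) p q =
      ∏ i, ∏ α, (l i - m α) := by
  let f : MvPolynomial (Fin p ⊕ Fin q) ℤ →+* R :=
    MvPolynomial.eval₂Hom (Int.castRingHom R) (Sum.elim l m)
  have hf : ∀ i, f (MvPolynomial.X i) = Sum.elim l m i := MvPolynomial.eval₂Hom_X' _ _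
  have hmap : ∀ i, (1 + C (MvPolynomial.X i) * X).map f = 1 + C (Sum.elim l m i) * X := by
    intro i
    rw [Polynomial.map_add, Polynomial.map_mul, Polynomial.map_one, map_X, map_C, hf]
  have h := congrArg f (resultant_prod_linear_of_ne_zero
    (fun i : Fin p => (MvPolynomial.X (Sum.inl i) : MvPolynomial (Fin p ⊕ Fin q) ℤ))
    (fun α : Fin q => MvPolynomial.X (Sum.inr α)) (fun i => MvPolynomial.X_ne_zero _)
    fun α => MvPolynomial.X_ne_zero _)
  rw [← resultant_map_map, Polynomial.map_prod, Polynomial.map_prod,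
    Finset.prod_congr rfl fun i _ => hmap (Sum.inl i),
    Finset.prod_congr rfl fun i _ => hmap (Sum.inr i)] at h
  simpa [hf] using h

end Resultant

/-! ## Matrices over supercommutative rings -/

section Super

variable {S : Type*} [Ring S] (𝒮 : ZMod 2 → AddSubgroup S) [GradedRing 𝒮]

theorem coe_evenProj {x : S} (hx : x ∈ 𝒮 0) : (evenProj 𝒮 x : S) = x :=
  DirectSum.decompose_of_mem_same 𝒮 hx

@[simp]
theorem evenProj_coe (x : EvenPart 𝒮) : evenProj 𝒮 (x : S) = x :=
  Subtype.ext (coe_evenProj 𝒮 x.2)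

/-- All entries of the matrix are of degree `i`. -/
def IsHomogeneousMatrix (i : ZMod 2) {m n : Type*} (M : Matrix m n S) : Prop :=
  ∀ a b, M a b ∈ 𝒮 i

variable {𝒮} {l m n : Type*} {i j : ZMod 2}

namespace IsHomogeneousMatrix

theorem mul [Fintype m] {M : Matrix l m S} {N : Matrix m n S} (hM : IsHomogeneousMatrix 𝒮 i M)
    (hN : IsHomogeneousMatrix 𝒮 j N) : IsHomogeneousMatrix 𝒮 (i + j) (M * N) := fun a b => by
  rw [Matrix.mul_apply]
  exact sum_mem fun k _ => SetLike.GradedMul.mul_mem (hM a k) (hN k b)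

theorem mul_odd [Fintype m] {M : Matrix l m S} {N : Matrix m n S}
    (hM : IsHomogeneousMatrix 𝒮 1 M) (hN : IsHomogeneousMatrix 𝒮 1 N) :
    IsHomogeneousMatrix 𝒮 0 (M * N) := hM.mul hN

theorem mul_even [Fintype m] {M : Matrix l m S} {N : Matrix m n S}
    (hM : IsHomogeneousMatrix 𝒮 i M) (hN : IsHomogeneousMatrix 𝒮 0 N) :
    IsHomogeneousMatrix 𝒮 i (M * N) := by simpa using hM.mul hN

theorem even_mul [Fintype m] {M : Matrix l m S} {N : Matrix m n S}
    (hM : IsHomogeneousMatrix 𝒮 0 M) (hN : IsHomogeneousMatrix 𝒮 i N) :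
    IsHomogeneousMatrix 𝒮 i (M * N) := by simpa using hM.mul hN

theorem add {M N : Matrix m n S} (hM : IsHomogeneousMatrix 𝒮 i M)
    (hN : IsHomogeneousMatrix 𝒮 i N) : IsHomogeneousMatrix 𝒮 i (M + N) :=
  fun a b => add_mem (hM a b) (hN a b)

theorem sub {M N : Matrix m n S} (hM : IsHomogeneousMatrix 𝒮 i M)
    (hN : IsHomogeneousMatrix 𝒮 i N) : IsHomogeneousMatrix 𝒮 i (M - N) :=
  fun a b => sub_mem (hM a b) (hN a b)

theorem neg {M : Matrix m n S} (hM : IsHomogeneousMatrix 𝒮 i M) :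
    IsHomogeneousMatrix 𝒮 i (-M) := fun a b => neg_mem (hM a b)

theorem one [DecidableEq n] : IsHomogeneousMatrix 𝒮 0 (1 : Matrix n n S) := fun a b => by
  rw [Matrix.one_apply]
  split_ifs
  · exact SetLike.GradedOne.one_mem
  · exact zero_mem _

theorem map_coe (M : Matrix m n (EvenPart 𝒮)) :
    IsHomogeneousMatrix 𝒮 0 (M.map Subtype.val) := fun a b => (M a b).2

theorem map_evenProj {M : Matrix m n S} (hM : IsHomogeneousMatrix 𝒮 0 M) :
    (M.map (evenProj 𝒮)).map Subtype.val = M := by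
  ext a b
  exact coe_evenProj 𝒮 (hM a b)

end IsHomogeneousMatrix

@[simp]
theorem map_coe_map_evenProj (M : Matrix m n (EvenPart 𝒮)) :
    (M.map Subtype.val).map (evenProj 𝒮) = M := by
  ext a b
  simp

variable [IsSupercommutative 𝒮]

theorem map_coe_mul [Fintype m] (M : Matrix l m (EvenPart 𝒮)) (N : Matrix m n (EvenPart 𝒮)) :
    (M * N).map Subtype.val = M.map Subtype.val * N.map (Subtype.val : _ → S) :=
  Matrix.map_mul (f := (EvenPart 𝒮).subtype)

theorem map_coe_one [DecidableEq n] :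
    (1 : Matrix n n (EvenPart 𝒮)).map Subtype.val = (1 : Matrix n n S) :=
  Matrix.map_one _ rfl rfl

theorem map_coe_mul_inv [Fintype n] [DecidableEq n] {d : Matrix n n (EvenPart 𝒮)}
    (hd : IsUnit d.det) : d.map Subtype.val * d⁻¹.map Subtype.val = (1 : Matrix n n S) := by
  rw [← map_coe_mul, Matrix.mul_nonsing_inv _ hd, map_coe_one]

theorem map_coe_inv_mul [Fintype n] [DecidableEq n] {d : Matrix n n (EvenPart 𝒮)}
    (hd : IsUnit d.det) : d⁻¹.map Subtype.val * d.map Subtype.val = (1 : Matrix n n S) := by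
  rw [← map_coe_mul, Matrix.nonsing_inv_mul _ hd, map_coe_one]

theorem odd_anticomm {x y : S} (hx : x ∈ 𝒮 1) (hy : y ∈ 𝒮 1) : y * x = -(x * y) := by
  have := IsSupercommutative.mul_comm' hy hx
  simpa [show (1 : ZMod 2).val = 1 from rfl] using this

/-- The 1 × 1 case of `evenDet_one_add_mul`: the linear terms cancel by anticommutation, and the
quadratic one contains y². -/
theorem one_add_mul_one_add_of_odd {x y : S} (hx : x ∈ 𝒮 1) (hy : y ∈ 𝒮 1) :
    (1 + x * y) * (1 + y * x) = 1 := by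
  have h1 : x * y * (y * x) = 0 := by
    rw [mul_assoc, ← mul_assoc y, IsSupercommutative.odd_mul_self hy]
    simp
  rw [mul_add, add_mul, add_mul, h1, odd_anticomm hx hy]
  simp

variable (𝒮) in
/-- The determinant of a square matrix with even entries. -/
def evenDet [Fintype n] [DecidableEq n] (M : Matrix n n S) : EvenPart 𝒮 := (M.map (evenProj 𝒮)).det

@[simp]
theorem evenDet_map_coe [Fintype n] [DecidableEq n] (M : Matrix n n (EvenPart 𝒮)) :
    evenDet 𝒮 (M.map Subtype.val) = M.det := by
  rw [evenDet, map_coe_map_evenProj]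

theorem evenDet_mul [Fintype n] [DecidableEq n] {M N : Matrix n n S}
    (hM : IsHomogeneousMatrix 𝒮 0 M) (hN : IsHomogeneousMatrix 𝒮 0 N) :
    evenDet 𝒮 (M * N) = evenDet 𝒮 M * evenDet 𝒮 N := by
  conv_lhs => rw [← hM.map_evenProj, ← hN.map_evenProj, ← map_coe_mul, evenDet_map_coe]
  rw [Matrix.det_mul, evenDet, evenDet]

@[simp]
theorem evenDet_one [Fintype n] [DecidableEq n] : evenDet 𝒮 (1 : Matrix n n S) = 1 := by
  rw [← map_coe_one (𝒮 := 𝒮), evenDet_map_coe, Matrix.det_one]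

/-- Changing one entry of `X` by an odd x alters both matrices by rank one. With K = 1+XY, L = 1+YX
and the odd element t = (YK⁻¹)_{ba} = (L⁻¹Y)_{ba}, the matrix determinant lemma contributes the
factors 1 + xt and 1 + tx, whose product is 1. -/
theorem evenDet_one_add_mul_step [Fintype m] [Fintype n] [DecidableEq m] [DecidableEq n]
    {X : Matrix m n S} {Y : Matrix n m S} (hX : IsHomogeneousMatrix 𝒮 1 X)
    (hY : IsHomogeneousMatrix 𝒮 1 Y) (h : evenDet 𝒮 (1 + X * Y) * evenDet 𝒮 (1 + Y * X) = 1)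
    (a : m) (b : n) {x : S} (hx : x ∈ 𝒮 1) :
    evenDet 𝒮 (1 + (X + Matrix.single a b x) * Y) *
      evenDet 𝒮 (1 + Y * (X + Matrix.single a b x)) = 1 := by
  obtain ⟨K, hK⟩ : ∃ K : Matrix m m (EvenPart 𝒮), K.map Subtype.val = 1 + X * Y :=
    ⟨_, (IsHomogeneousMatrix.one.add (hX.mul_odd hY)).map_evenProj⟩
  obtain ⟨L, hL⟩ : ∃ L : Matrix n n (EvenPart 𝒮), L.map Subtype.val = 1 + Y * X :=
    ⟨_, (IsHomogeneousMatrix.one.add (hY.mul_odd hX)).map_evenProj⟩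
  rw [← hK, ← hL, evenDet_map_coe, evenDet_map_coe] at h
  have hKu : IsUnit K.det := IsUnit.of_mul_eq_one _ h
  have hLu : IsUnit L.det := IsUnit.of_mul_eq_one _ (by rw [mul_comm]; exact h)
  set r : m → EvenPart 𝒮 := fun j => ⟨x * Y b j, SetLike.GradedMul.mul_mem hx (hY b j)⟩ with hr
  set w : n → EvenPart 𝒮 := fun i => ⟨Y i a * x, SetLike.GradedMul.mul_mem (hY i a) hx⟩ with hw
  have hK' : 1 + (X + Matrix.single a b x) * Y =
      (K + Matrix.replicateCol Unit (Pi.single a (1 : EvenPart 𝒮)) * Matrix.replicateRow Unit r).map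
        Subtype.val := by
    rw [Matrix.add_mul, ← add_assoc, ← hK]
    ext i j
    simp only [Matrix.add_apply, Matrix.map_apply, Matrix.mul_apply, Matrix.single,
      Matrix.of_apply, Subring.coe_add, Matrix.replicateCol_apply, Matrix.replicateRow_apply,
      Finset.univ_unique, Finset.sum_singleton, Subring.coe_mul, hr, Pi.single_apply]
    congr 1
    by_cases hi : i = a
    · subst hi
      simp
    · simp [hi, Ne.symm hi]
  have hL' : 1 + Y * (X + Matrix.single a b x) =
      (L + Matrix.replicateCol Unit w * Matrix.replicateRow Unit (Pi.single b (1 : EvenPart 𝒮))).map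
        Subtype.val := by
    rw [Matrix.mul_add, ← add_assoc, ← hL]
    ext i j
    simp only [Matrix.add_apply, Matrix.map_apply, Matrix.mul_apply, Matrix.single,
      Matrix.of_apply, Subring.coe_add, Matrix.replicateCol_apply, Matrix.replicateRow_apply,
      Finset.univ_unique, Finset.sum_singleton, Subring.coe_mul, hw, Pi.single_apply]
    congr 1
    by_cases hj : j = b
    · subst hj
      simp
    · simp [hj, Ne.symm hj]
  have hYK : Y * K⁻¹.map Subtype.val = L⁻¹.map Subtype.val * Y := by
    have h1 : L.map Subtype.val * Y = Y * K.map Subtype.val := by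
      rw [hK, hL, Matrix.add_mul, Matrix.mul_add, Matrix.one_mul, Matrix.mul_one, Matrix.mul_assoc]
    calc Y * K⁻¹.map Subtype.val
        = (L⁻¹.map Subtype.val * L.map Subtype.val) * Y * K⁻¹.map Subtype.val := by
          rw [map_coe_inv_mul hLu, Matrix.one_mul]
      _ = L⁻¹.map Subtype.val * Y * (K.map Subtype.val * K⁻¹.map Subtype.val) := by
          rw [Matrix.mul_assoc _ _ Y, h1]
          simp only [Matrix.mul_assoc]
      _ = _ := by rw [map_coe_mul_inv hKu, Matrix.mul_one]
  have hy : (Y * K⁻¹.map Subtype.val) b a ∈ 𝒮 1 :=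
    hY.mul_even (IsHomogeneousMatrix.map_coe _) b a
  rw [hK', hL', evenDet_map_coe, evenDet_map_coe,
    Matrix.det_add_replicateCol_mul_replicateRow hKu,
    Matrix.det_add_replicateCol_mul_replicateRow hLu]
  have e1 : (((1 + Matrix.replicateRow Unit r * K⁻¹ *
      Matrix.replicateCol Unit (Pi.single a (1 : EvenPart 𝒮))).det : EvenPart 𝒮) : S) =
      1 + x * (Y * K⁻¹.map Subtype.val) b a := by
    simp [Matrix.mul_apply, hr, Finset.mul_sum, mul_assoc, Pi.single_apply]
  have e2 : (((1 + Matrix.replicateRow Unit (Pi.single b (1 : EvenPart 𝒮)) * L⁻¹ *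
      Matrix.replicateCol Unit w).det : EvenPart 𝒮) : S) =
      1 + (Y * K⁻¹.map Subtype.val) b a * x := by
    rw [hYK]
    simp [Matrix.mul_apply, hw, Finset.sum_mul, mul_assoc, Pi.single_apply]
  have e3 := one_add_mul_one_add_of_odd hx hy
  rw [← e1, ← e2, ← Subring.coe_mul] at e3
  have e4 := Subtype.ext (a2 := (1 : EvenPart 𝒮)) e3
  rw [mul_mul_mul_comm, e4, h, one_mul]

/-- The odd counterpart of det(1+XY) = det(1+YX), with an inverse appearing because entries
anticommute. `X` is built up from zero one entry at a time. -/
theorem evenDet_one_add_mul [Fintype m] [Fintype n] [DecidableEq m] [DecidableEq n]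
    {X : Matrix m n S} {Y : Matrix n m S} (hX : IsHomogeneousMatrix 𝒮 1 X)
    (hY : IsHomogeneousMatrix 𝒮 1 Y) :
    evenDet 𝒮 (1 + X * Y) * evenDet 𝒮 (1 + Y * X) = 1 := by
  have key : ∀ s : Finset (m × n), IsHomogeneousMatrix 𝒮 1 (∑ k ∈ s, Matrix.single k.1 k.2
      (X k.1 k.2)) ∧ evenDet 𝒮 (1 + (∑ k ∈ s, Matrix.single k.1 k.2 (X k.1 k.2)) * Y) *
      evenDet 𝒮 (1 + Y * (∑ k ∈ s, Matrix.single k.1 k.2 (X k.1 k.2))) = 1 := by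
    intro s
    induction s using Finset.induction_on with
    | empty => exact ⟨fun _ _ => zero_mem _, by simp⟩
    | insert k s hk ih =>
      rw [Finset.sum_insert hk, add_comm]
      refine ⟨ih.1.add fun a b => ?_, evenDet_one_add_mul_step ih.1 hY ih.2 _ _ (hX _ _)⟩
      rw [Matrix.single_apply]
      split_ifs
      · exact hX _ _
      · exact zero_mem _
  have hsum : X = ∑ k : m × n, Matrix.single k.1 k.2 (X k.1 k.2) := by
    rw [Fintype.sum_prod_type]
    exact Matrix.matrix_eq_sum_single X
  rw [hsum]
  exact (key Finset.univ).2

theorem isUnit_evenDet_one_add_mul [Fintype m] [Fintype n] [DecidableEq m] [DecidableEq n]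
    {X : Matrix m n S} {Y : Matrix n m S} (hX : IsHomogeneousMatrix 𝒮 1 X)
    (hY : IsHomogeneousMatrix 𝒮 1 Y) : IsUnit (evenDet 𝒮 (1 + X * Y)) :=
  IsUnit.of_mul_eq_one _ (evenDet_one_add_mul hX hY)

end Super

/-! ### Blocks of even supermatrices and properties of the Berezinian. -/

section Berezinian

variable {S : Type*} [Ring S] {𝒮 : ZMod 2 → AddSubgroup S} [GradedRing 𝒮] {p q : ℕ}

namespace IsEvenMatrix

theorem toBlocks₁₁ {M : Matrix (Fin p ⊕ Fin q) (Fin p ⊕ Fin q) S} (hM : IsEvenMatrix 𝒮 M) :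
    IsHomogeneousMatrix 𝒮 0 M.toBlocks₁₁ := fun a b => hM (Sum.inl a) (Sum.inl b)

theorem toBlocks₁₂ {M : Matrix (Fin p ⊕ Fin q) (Fin p ⊕ Fin q) S} (hM : IsEvenMatrix 𝒮 M) :
    IsHomogeneousMatrix 𝒮 1 M.toBlocks₁₂ := fun a b => hM (Sum.inl a) (Sum.inr b)

theorem toBlocks₂₁ {M : Matrix (Fin p ⊕ Fin q) (Fin p ⊕ Fin q) S} (hM : IsEvenMatrix 𝒮 M) :
    IsHomogeneousMatrix 𝒮 1 M.toBlocks₂₁ := fun a b => hM (Sum.inr a) (Sum.inl b)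

theorem toBlocks₂₂ {M : Matrix (Fin p ⊕ Fin q) (Fin p ⊕ Fin q) S} (hM : IsEvenMatrix 𝒮 M) :
    IsHomogeneousMatrix 𝒮 0 M.toBlocks₂₂ := fun a b => hM (Sum.inr a) (Sum.inr b)

theorem fromBlocks {a : Matrix (Fin p) (Fin p) S} {b : Matrix (Fin p) (Fin q) S}
    {c : Matrix (Fin q) (Fin p) S} {d : Matrix (Fin q) (Fin q) S}
    (ha : IsHomogeneousMatrix 𝒮 0 a) (hb : IsHomogeneousMatrix 𝒮 1 b)
    (hc : IsHomogeneousMatrix 𝒮 1 c) (hd : IsHomogeneousMatrix 𝒮 0 d) :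
    IsEvenMatrix 𝒮 (Matrix.fromBlocks a b c d) := by
  rintro (i | i) (j | j)
  exacts [ha i j, hb i j, hc i j, hd i j]

theorem mul {M N : Matrix (Fin p ⊕ Fin q) (Fin p ⊕ Fin q) S} (hM : IsEvenMatrix 𝒮 M)
    (hN : IsEvenMatrix 𝒮 N) : IsEvenMatrix 𝒮 (M * N) := fun i j => by
  rw [Matrix.mul_apply]
  refine sum_mem fun k _ => ?_
  have := SetLike.GradedMul.mul_mem (hM i k) (hN k j)
  rwa [add_assoc, ← add_assoc (parity k), CharTwo.add_self_eq_zero, zero_add] at this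

theorem add {M N : Matrix (Fin p ⊕ Fin q) (Fin p ⊕ Fin q) S} (hM : IsEvenMatrix 𝒮 M)
    (hN : IsEvenMatrix 𝒮 N) : IsEvenMatrix 𝒮 (M + N) := fun i j => add_mem (hM i j) (hN i j)

theorem one : IsEvenMatrix 𝒮 (1 : Matrix (Fin p ⊕ Fin q) (Fin p ⊕ Fin q) S) := fun i j => by
  rw [Matrix.one_apply]
  split_ifs with h
  · rw [h, CharTwo.add_self_eq_zero]
    exact SetLike.GradedOne.one_mem
  · exact zero_mem _

theorem pow {M : Matrix (Fin p ⊕ Fin q) (Fin p ⊕ Fin q) S} (hM : IsEvenMatrix 𝒮 M) (n : ℕ) :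
    IsEvenMatrix 𝒮 (M ^ n) := by
  induction n with
  | zero => simpa using one
  | succ n ih => rw [pow_succ]; exact ih.mul hM

/-- Keeping in each entry of `N` only the component of the prescribed parity gives another right
inverse of `M`, since `M` and 1 are even; it agrees with the left inverse `N`. -/
theorem of_mul_eq_one {M N : Matrix (Fin p ⊕ Fin q) (Fin p ⊕ Fin q) S} (hM : IsEvenMatrix 𝒮 M)
    (hMN : M * N = 1) (hNM : N * M = 1) : IsEvenMatrix 𝒮 N := by
  set N' : Matrix (Fin p ⊕ Fin q) (Fin p ⊕ Fin q) S :=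
    Matrix.of fun i j => (DirectSum.decompose 𝒮 (N i j) (parity i + parity j) : S) with hN'
  have h1 : M * N' = 1 := by
    ext i j
    have h2 : ((DirectSum.decompose 𝒮 ((M * N) i j) (parity i + parity j) : 𝒮 _) : S) =
        (M * N') i j := by
      rw [Matrix.mul_apply, Matrix.mul_apply, DirectSum.decompose_sum, DFinsupp.finsetSum_apply,
        AddSubgroup.val_finsetSum]
      refine Finset.sum_congr rfl fun k _ => ?_
      rw [hN', Matrix.of_apply,
        ← DirectSum.coe_decompose_mul_add_of_left_mem 𝒮 (hM i k)]
      rw [add_assoc, ← add_assoc (parity k), CharTwo.add_self_eq_zero, zero_add]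
    rw [← h2, hMN, DirectSum.decompose_of_mem_same 𝒮 (one i j)]
  have h2 : N = N' := by
    rw [← mul_one N, ← h1, ← mul_assoc, hNM, one_mul]
  rw [h2]
  exact fun i j => SetLike.coe_mem _

end IsEvenMatrix

variable [IsSupercommutative 𝒮]

/-! ## Multiplicativity of the Berezinian -/

/-- The block matrix `[1 X; 0 1] * diag(a, d) * [1 0; Y 1]`. -/
def blockLDU (a : Matrix (Fin p) (Fin p) (EvenPart 𝒮)) (d : Matrix (Fin q) (Fin q) (EvenPart 𝒮))
    (X : Matrix (Fin p) (Fin q) S) (Y : Matrix (Fin q) (Fin p) S) :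
    Matrix (Fin p ⊕ Fin q) (Fin p ⊕ Fin q) S :=
  Matrix.fromBlocks (a.map Subtype.val + X * d.map Subtype.val * Y) (X * d.map Subtype.val)
    (d.map Subtype.val * Y) (d.map Subtype.val)

theorem berezinian_blockLDU (a : Matrix (Fin p) (Fin p) (EvenPart 𝒮))
    {d : Matrix (Fin q) (Fin q) (EvenPart 𝒮)} (hd : IsUnit d.det)
    (X : Matrix (Fin p) (Fin q) S) (Y : Matrix (Fin q) (Fin p) S) :
    berezinian 𝒮 (blockLDU a d X Y) = a.det * Ring.inverse d.det := by
  have h : X * d.map Subtype.val * d⁻¹.map Subtype.val * (d.map Subtype.val * Y) =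
      X * d.map Subtype.val * Y := by
    rw [Matrix.mul_assoc X, map_coe_mul_inv hd, Matrix.mul_one, Matrix.mul_assoc]
  simp only [berezinian, blockLDU, Matrix.toBlocks_fromBlocks₁₁, Matrix.toBlocks_fromBlocks₁₂,
    Matrix.toBlocks_fromBlocks₂₁, Matrix.toBlocks_fromBlocks₂₂, map_coe_map_evenProj]
  rw [h, add_sub_cancel_right, map_coe_map_evenProj]

theorem blockLDU_eq (a : Matrix (Fin p) (Fin p) (EvenPart 𝒮))
    (d : Matrix (Fin q) (Fin q) (EvenPart 𝒮))
    (X : Matrix (Fin p) (Fin q) S) (Y : Matrix (Fin q) (Fin p) S) :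
    blockLDU a d X Y = Matrix.fromBlocks 1 X 0 1 *
      Matrix.fromBlocks (a.map Subtype.val) 0 0 (d.map Subtype.val) *
        Matrix.fromBlocks 1 0 Y 1 := by
  simp [blockLDU, Matrix.fromBlocks_multiply]

theorem exists_eq_blockLDU {M : Matrix (Fin p ⊕ Fin q) (Fin p ⊕ Fin q) S}
    (hM : IsEvenMatrix 𝒮 M) (hu : IsUnit (evenDet 𝒮 M.toBlocks₂₂)) :
    ∃ (a : Matrix (Fin p) (Fin p) (EvenPart 𝒮)) (d : Matrix (Fin q) (Fin q) (EvenPart 𝒮))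
      (X : Matrix (Fin p) (Fin q) S) (Y : Matrix (Fin q) (Fin p) S), IsUnit d.det ∧
      IsHomogeneousMatrix 𝒮 1 X ∧ IsHomogeneousMatrix 𝒮 1 Y ∧ M = blockLDU a d X Y := by
  obtain ⟨d, hd⟩ : ∃ d : Matrix (Fin q) (Fin q) (EvenPart 𝒮), d.map Subtype.val = M.toBlocks₂₂ :=
    ⟨_, hM.toBlocks₂₂.map_evenProj⟩
  rw [← hd, evenDet_map_coe] at hu
  have hX := hM.toBlocks₁₂.mul_even (IsHomogeneousMatrix.map_coe d⁻¹)
  have hY := (IsHomogeneousMatrix.map_coe d⁻¹).even_mul hM.toBlocks₂₁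
  obtain ⟨a, ha⟩ : ∃ a : Matrix (Fin p) (Fin p) (EvenPart 𝒮), a.map Subtype.val =
      M.toBlocks₁₁ - M.toBlocks₁₂ * (d⁻¹.map Subtype.val * M.toBlocks₂₁) :=
    ⟨_, (hM.toBlocks₁₁.sub (hM.toBlocks₁₂.mul_odd hY)).map_evenProj⟩
  refine ⟨a, d, _, _, hu, hX, hY, ?_⟩
  conv_lhs => rw [← Matrix.fromBlocks_toBlocks M]
  rw [blockLDU, ha, ← hd, Matrix.mul_assoc M.toBlocks₁₂, map_coe_inv_mul hu, Matrix.mul_one,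
    sub_add_cancel, ← Matrix.mul_assoc, map_coe_mul_inv hu, Matrix.one_mul]

/-- Exchanging the unipotent factors is the only nontrivial step in multiplying two block
factorizations. The diagonal part has w = 1+YX and u = (1+XY)⁻¹, so det u = det w is
`evenDet_one_add_mul`: the product has Berezinian 1. -/
theorem lower_mul_upper {X : Matrix (Fin p) (Fin q) S} {Y : Matrix (Fin q) (Fin p) S}
    (hX : IsHomogeneousMatrix 𝒮 1 X) (hY : IsHomogeneousMatrix 𝒮 1 Y) :
    ∃ u w X' Y', IsUnit (Matrix.det w) ∧ Matrix.det u = Matrix.det w ∧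
      (Matrix.fromBlocks 1 0 Y 1 : Matrix (Fin p ⊕ Fin q) (Fin p ⊕ Fin q) S) *
        Matrix.fromBlocks 1 X 0 1 = blockLDU (𝒮 := 𝒮) u w X' Y' := by
  obtain ⟨w, hw⟩ : ∃ w : Matrix (Fin q) (Fin q) (EvenPart 𝒮), w.map Subtype.val = 1 + Y * X :=
    ⟨_, (IsHomogeneousMatrix.one.add (hY.mul_odd hX)).map_evenProj⟩
  obtain ⟨k, hk⟩ : ∃ k : Matrix (Fin p) (Fin p) (EvenPart 𝒮), k.map Subtype.val = 1 + X * Y :=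
    ⟨_, (IsHomogeneousMatrix.one.add (hX.mul_odd hY)).map_evenProj⟩
  have h := evenDet_one_add_mul hX hY
  rw [← hw, ← hk, evenDet_map_coe, evenDet_map_coe] at h
  have hwu : IsUnit w.det := IsUnit.of_mul_eq_one _ (by rw [mul_comm]; exact h)
  obtain ⟨u, hu⟩ : ∃ u : Matrix (Fin p) (Fin p) (EvenPart 𝒮), u.map Subtype.val =
      1 - X * (w⁻¹.map Subtype.val * Y) :=
    ⟨_, (IsHomogeneousMatrix.one.sub (hX.mul_odd
      ((IsHomogeneousMatrix.map_coe _).even_mul hY))).map_evenProj⟩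
  have huk : u * k = 1 := by
    have h1 : (u * k).map Subtype.val = (1 : Matrix (Fin p) (Fin p) S) := by
      have h2 : Y * (1 + X * Y) = w.map Subtype.val * Y := by
        rw [hw, Matrix.add_mul, Matrix.mul_add, Matrix.one_mul, Matrix.mul_one, Matrix.mul_assoc]
      rw [map_coe_mul, hu, hk, sub_mul, one_mul, Matrix.mul_assoc X, Matrix.mul_assoc, h2,
        ← Matrix.mul_assoc _ _ Y, map_coe_inv_mul hwu, Matrix.one_mul, add_sub_cancel_right]
    rw [← map_coe_map_evenProj (u * k), h1, ← map_coe_one (𝒮 := 𝒮), map_coe_map_evenProj]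
  refine ⟨u, w, X * w⁻¹.map Subtype.val, w⁻¹.map Subtype.val * Y, hwu, ?_, ?_⟩
  · have h3 := congrArg Matrix.det huk
    rw [Matrix.det_mul, Matrix.det_one] at h3
    calc u.det = u.det * (k.det * w.det) := by rw [h, mul_one]
      _ = w.det := by rw [← mul_assoc, h3, one_mul]
  · rw [blockLDU, hu, Matrix.mul_assoc X, map_coe_inv_mul hwu, Matrix.mul_one, sub_add_cancel,
      ← Matrix.mul_assoc, map_coe_mul_inv hwu, Matrix.one_mul, hw]
    simp [Matrix.fromBlocks_multiply, add_comm]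

theorem diag_mul_upper (a : Matrix (Fin p) (Fin p) (EvenPart 𝒮))
    {d : Matrix (Fin q) (Fin q) (EvenPart 𝒮)} (hd : IsUnit d.det) (X : Matrix (Fin p) (Fin q) S) :
    (Matrix.fromBlocks (a.map Subtype.val) 0 0 (d.map Subtype.val) *
      Matrix.fromBlocks 1 X 0 1 : Matrix (Fin p ⊕ Fin q) (Fin p ⊕ Fin q) S) =
      Matrix.fromBlocks 1 (a.map Subtype.val * X * d⁻¹.map Subtype.val) 0 1 *
        Matrix.fromBlocks (a.map Subtype.val) 0 0 (d.map Subtype.val) := by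
  simp only [Matrix.fromBlocks_multiply, Matrix.mul_one, Matrix.mul_zero, Matrix.zero_mul,
    Matrix.one_mul, add_zero, zero_add]
  rw [Matrix.mul_assoc, map_coe_inv_mul hd, Matrix.mul_one]

theorem lower_mul_diag (a : Matrix (Fin p) (Fin p) (EvenPart 𝒮))
    {d : Matrix (Fin q) (Fin q) (EvenPart 𝒮)} (hd : IsUnit d.det) (Y : Matrix (Fin q) (Fin p) S) :
    (Matrix.fromBlocks 1 0 Y 1 * Matrix.fromBlocks (a.map Subtype.val) 0 0 (d.map Subtype.val) :
      Matrix (Fin p ⊕ Fin q) (Fin p ⊕ Fin q) S) =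
      Matrix.fromBlocks (a.map Subtype.val) 0 0 (d.map Subtype.val) *
        Matrix.fromBlocks 1 0 (d⁻¹.map Subtype.val * (Y * a.map Subtype.val)) 1 := by
  simp only [Matrix.fromBlocks_multiply, Matrix.mul_one, Matrix.mul_zero, Matrix.zero_mul,
    Matrix.one_mul, add_zero, zero_add]
  rw [← Matrix.mul_assoc, map_coe_mul_inv hd, Matrix.one_mul]

theorem diag_mul_diag (a a' : Matrix (Fin p) (Fin p) (EvenPart 𝒮))
    (d d' : Matrix (Fin q) (Fin q) (EvenPart 𝒮)) :
    (Matrix.fromBlocks (a.map Subtype.val) 0 0 (d.map Subtype.val) *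
      Matrix.fromBlocks (a'.map Subtype.val) 0 0 (d'.map Subtype.val) :
      Matrix (Fin p ⊕ Fin q) (Fin p ⊕ Fin q) S) =
      Matrix.fromBlocks ((a * a').map Subtype.val) 0 0 ((d * d').map Subtype.val) := by
  simp [Matrix.fromBlocks_multiply, map_coe_mul]

theorem upper_mul_upper (X X' : Matrix (Fin p) (Fin q) S) :
    (Matrix.fromBlocks 1 X 0 1 * Matrix.fromBlocks 1 X' 0 1 :
      Matrix (Fin p ⊕ Fin q) (Fin p ⊕ Fin q) S) = Matrix.fromBlocks 1 (X' + X) 0 1 := by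
  simp [Matrix.fromBlocks_multiply]

theorem lower_mul_lower (Y Y' : Matrix (Fin q) (Fin p) S) :
    (Matrix.fromBlocks 1 0 Y 1 * Matrix.fromBlocks 1 0 Y' 1 :
      Matrix (Fin p ⊕ Fin q) (Fin p ⊕ Fin q) S) = Matrix.fromBlocks 1 0 (Y + Y') 1 := by
  simp [Matrix.fromBlocks_multiply]

/-- In upper · diagonal · lower form the Berezinian depends only on the diagonal part. The inner
lower · upper product is refactored by `lower_mul_upper`, and the outer unipotent factors are moved
past the diagonal ones without changing the latter. -/
theorem berezinian_mul {M N : Matrix (Fin p ⊕ Fin q) (Fin p ⊕ Fin q) S}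
    (hM : IsEvenMatrix 𝒮 M) (hMu : IsUnit (evenDet 𝒮 M.toBlocks₂₂))
    (hN : IsEvenMatrix 𝒮 N) (hNu : IsUnit (evenDet 𝒮 N.toBlocks₂₂)) :
    berezinian 𝒮 (M * N) = berezinian 𝒮 M * berezinian 𝒮 N := by
  obtain ⟨a, d, X, Y, hd, -, hY, rfl⟩ := exists_eq_blockLDU hM hMu
  obtain ⟨a', d', X', Y', hd', hX', -, rfl⟩ := exists_eq_blockLDU hN hNu
  -- Only the d-blocks need inverses in the commutations below; the a-blocks may be singular.
  obtain ⟨u, w, X₁, Y₁, hw, huw, h⟩ := lower_mul_upper hX' hY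
  have key : blockLDU a d X Y * blockLDU a' d' X' Y' = blockLDU (a * u * a') (d * w * d')
      (a.map Subtype.val * X₁ * d⁻¹.map Subtype.val + X)
      (d'⁻¹.map Subtype.val * (Y₁ * a'.map Subtype.val) + Y') := by
    set D := (Matrix.fromBlocks (a.map Subtype.val) 0 0 (d.map Subtype.val) :
      Matrix (Fin p ⊕ Fin q) (Fin p ⊕ Fin q) S) with hD
    set D' := (Matrix.fromBlocks (a'.map Subtype.val) 0 0 (d'.map Subtype.val) :
      Matrix (Fin p ⊕ Fin q) (Fin p ⊕ Fin q) S) with hD'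
    rw [blockLDU_eq a d, blockLDU_eq a' d', ← hD, ← hD']
    calc _ = Matrix.fromBlocks 1 X 0 1 * D * (Matrix.fromBlocks 1 0 Y 1 *
          Matrix.fromBlocks 1 X' 0 1) * D' * Matrix.fromBlocks 1 0 Y' 1 := by
          simp only [mul_assoc]
      _ = Matrix.fromBlocks 1 X 0 1 * (D * Matrix.fromBlocks 1 X₁ 0 1) *
          Matrix.fromBlocks (u.map Subtype.val) 0 0 (w.map Subtype.val) *
          (Matrix.fromBlocks 1 0 Y₁ 1 * D') * Matrix.fromBlocks 1 0 Y' 1 := by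
          rw [h, blockLDU_eq]
          simp only [mul_assoc]
      _ = (Matrix.fromBlocks 1 X 0 1 *
          Matrix.fromBlocks 1 (a.map Subtype.val * X₁ * d⁻¹.map Subtype.val) 0 1) *
          (D * Matrix.fromBlocks (u.map Subtype.val) 0 0 (w.map Subtype.val) * D') *
          (Matrix.fromBlocks 1 0 (d'⁻¹.map Subtype.val * (Y₁ * a'.map Subtype.val)) 1 *
            Matrix.fromBlocks 1 0 Y' 1) := by
          rw [hD, hD', diag_mul_upper a hd, lower_mul_diag a' hd']
          simp only [mul_assoc]
      _ = _ := by
          rw [upper_mul_upper, lower_mul_lower, hD, hD', diag_mul_diag, diag_mul_diag,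
            ← blockLDU_eq]
  have hdet : IsUnit (d * w * d').det := by
    rw [Matrix.det_mul, Matrix.det_mul]
    exact (hd.mul hw).mul hd'
  rw [key, berezinian_blockLDU _ hdet, berezinian_blockLDU _ hd, berezinian_blockLDU _ hd']
  simp only [Matrix.det_mul]
  rw [Ring.mul_inverse_rev, Ring.mul_inverse_rev, huw]
  have := Ring.mul_inverse_cancel _ hw
  linear_combination (a.det * a'.det * Ring.inverse d.det * Ring.inverse d'.det) * this

/-- The lower right block of MN = 1 says that M₂₂N₂₂ differs from 1 by a product of two odd blocks,
and such a matrix has invertible determinant. -/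
theorem isUnit_evenDet_toBlocks₂₂ {M N : Matrix (Fin p ⊕ Fin q) (Fin p ⊕ Fin q) S}
    (hM : IsEvenMatrix 𝒮 M) (hN : IsEvenMatrix 𝒮 N) (hMN : M * N = 1) :
    IsUnit (evenDet 𝒮 M.toBlocks₂₂) := by
  have h : M.toBlocks₂₂ * N.toBlocks₂₂ = 1 + M.toBlocks₂₁ * (-N.toBlocks₁₂) := by
    rw [← Matrix.fromBlocks_toBlocks M, ← Matrix.fromBlocks_toBlocks N,
      Matrix.fromBlocks_multiply] at hMN
    have h1 := congrArg Matrix.toBlocks₂₂ hMN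
    rw [Matrix.toBlocks_fromBlocks₂₂, ← Matrix.fromBlocks_one, Matrix.toBlocks_fromBlocks₂₂] at h1
    rw [← h1, Matrix.mul_neg]
    abel
  have h2 := congrArg (evenDet 𝒮) h
  rw [evenDet_mul hM.toBlocks₂₂ hN.toBlocks₂₂] at h2
  exact isUnit_of_mul_isUnit_left
    (h2 ▸ isUnit_evenDet_one_add_mul hM.toBlocks₂₁ hN.toBlocks₁₂.neg)

theorem berezinian_one :
    berezinian 𝒮 (1 : Matrix (Fin p ⊕ Fin q) (Fin p ⊕ Fin q) S) = 1 := by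
  have h := berezinian_blockLDU (𝒮 := 𝒮) (1 : Matrix (Fin p) (Fin p) (EvenPart 𝒮))
    (d := (1 : Matrix (Fin q) (Fin q) (EvenPart 𝒮))) (by simp) 0 0
  rw [Matrix.det_one, Matrix.det_one, Ring.inverse_one, mul_one] at h
  rw [← h, blockLDU, map_coe_one, map_coe_one]
  simp

theorem berezinian_conj {B C M : Matrix (Fin p ⊕ Fin q) (Fin p ⊕ Fin q) S}
    (hB : IsEvenMatrix 𝒮 B) (hBC : B * C = 1) (hCB : C * B = 1)
    (hM : IsEvenMatrix 𝒮 M) (hMu : IsUnit (evenDet 𝒮 M.toBlocks₂₂))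
    (hu : IsUnit (evenDet 𝒮 (C * M * B).toBlocks₂₂)) :
    berezinian 𝒮 (C * M * B) = berezinian 𝒮 M := by
  have hC := hB.of_mul_eq_one hBC hCB
  have hBu := isUnit_evenDet_toBlocks₂₂ hB hC hBC
  have hCu := isUnit_evenDet_toBlocks₂₂ hC hB hCB
  have h1 : berezinian 𝒮 B * berezinian 𝒮 C = 1 := by
    rw [← berezinian_mul hB hBu hC hCu, hBC, berezinian_one]
  have h2 : berezinian 𝒮 B * berezinian 𝒮 (C * M * B) = berezinian 𝒮 M * berezinian 𝒮 B := by
    rw [← berezinian_mul hB hBu ((hC.mul hM).mul hB) hu, ← berezinian_mul hM hMu hB hBu,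
      mul_assoc, ← mul_assoc B C, hBC, one_mul]
  calc berezinian 𝒮 (C * M * B)
      = (berezinian 𝒮 B * berezinian 𝒮 C) * berezinian 𝒮 (C * M * B) := by rw [h1, one_mul]
    _ = (berezinian 𝒮 B * berezinian 𝒮 (C * M * B)) * berezinian 𝒮 C := by ring
    _ = berezinian 𝒮 M * (berezinian 𝒮 B * berezinian 𝒮 C) := by rw [h2]; ring
    _ = berezinian 𝒮 M := by rw [h1, mul_one]

end Berezinian

/-! ## Power series with even coefficients -/

section CharFun

variable {S : Type*} [Ring S] {𝒮 : ZMod 2 → AddSubgroup S} [GradedRing 𝒮]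

variable (𝒮) in
/-- The even power series are the power series over the even part. -/
def psEquiv : PowerSeries (EvenPart 𝒮) ≃+* EvenPart (psGrading 𝒮) where
  toFun f := ⟨PowerSeries.map (EvenPart 𝒮).subtype f, fun n => by
    rw [PowerSeries.coeff_map]; exact (PowerSeries.coeff n f).2⟩
  invFun g := PowerSeries.mk fun n => ⟨PowerSeries.coeff n (g : PowerSeries S), g.2 n⟩
  left_inv f := by
    ext n
    simp
  right_inv g := by
    refine Subtype.ext ?_
    ext n
    simp
  map_mul' f g := Subtype.ext (map_mul _ f g)
  map_add' f g := Subtype.ext (map_add _ f g)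

theorem coe_psEquiv (f : PowerSeries (EvenPart 𝒮)) :
    (psEquiv 𝒮 f : PowerSeries S) = PowerSeries.map (EvenPart 𝒮).subtype f := rfl

theorem coeff_psEquiv_symm (g : EvenPart (psGrading 𝒮)) (n : ℕ) :
    ((PowerSeries.coeff n ((psEquiv 𝒮).symm g) : EvenPart 𝒮) : S) = PowerSeries.coeff n (g : PowerSeries S) := by
  simp [psEquiv]

theorem X_mem_psGrading : (PowerSeries.X : PowerSeries S) ∈ psGrading 𝒮 0 := fun n => by
  rw [PowerSeries.coeff_X]
  split_ifs
  · exact SetLike.GradedOne.one_mem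
  · exact zero_mem _

theorem C_mem_psGrading {i : ZMod 2} {a : S} (ha : a ∈ 𝒮 i) :
    (PowerSeries.C a : PowerSeries S) ∈ psGrading 𝒮 i := fun n => by
  rw [PowerSeries.coeff_C]
  split_ifs
  · exact ha
  · exact zero_mem _

variable {p q : ℕ}

/-- The matrix `z A` over the ring of power series in `z`. -/
def scaleX {m n : Type*} (A : Matrix m n S) : Matrix m n (PowerSeries S) :=
  A.map fun a => PowerSeries.X * PowerSeries.C a

theorem IsHomogeneousMatrix.scaleX {m n : Type*} {i : ZMod 2} {A : Matrix m n S}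
    (hA : IsHomogeneousMatrix 𝒮 i A) : IsHomogeneousMatrix (psGrading 𝒮) i (scaleX A) :=
  fun a b => by
    have := SetLike.GradedMul.mul_mem (X_mem_psGrading (𝒮 := 𝒮)) (C_mem_psGrading (hA a b))
    rwa [zero_add] at this

theorem IsEvenMatrix.scaleX {A : Matrix (Fin p ⊕ Fin q) (Fin p ⊕ Fin q) S}
    (hA : IsEvenMatrix 𝒮 A) : IsEvenMatrix (psGrading 𝒮) (scaleX A) := fun a b => by
  have := SetLike.GradedMul.mul_mem (X_mem_psGrading (𝒮 := 𝒮)) (C_mem_psGrading (hA a b))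
  rwa [zero_add] at this

theorem IsEvenMatrix.map_C {A : Matrix (Fin p ⊕ Fin q) (Fin p ⊕ Fin q) S}
    (hA : IsEvenMatrix 𝒮 A) : IsEvenMatrix (psGrading 𝒮) (A.map (PowerSeries.C (R := S))) :=
  fun a b => C_mem_psGrading (hA a b)

theorem IsEvenMatrix.one_add_scaleX {A : Matrix (Fin p ⊕ Fin q) (Fin p ⊕ Fin q) S}
    (hA : IsEvenMatrix 𝒮 A) : IsEvenMatrix (psGrading 𝒮) (1 + SuperCH.scaleX A) :=
  IsEvenMatrix.one.add hA.scaleX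

theorem map_C_mul_scaleX {l m n : Type*} [Fintype m] (M : Matrix l m S) (N : Matrix m n S) :
    M.map (PowerSeries.C (R := S)) * scaleX N = scaleX (M * N) := by
  ext1 i j
  simp only [Matrix.mul_apply, scaleX, Matrix.map_apply, map_sum, Finset.mul_sum, map_mul]
  refine Finset.sum_congr rfl fun k _ => ?_
  rw [← mul_assoc, ← mul_assoc, PowerSeries.X_mul]

theorem scaleX_mul_map_C {l m n : Type*} [Fintype m] (M : Matrix l m S) (N : Matrix m n S) :
    scaleX M * N.map (PowerSeries.C (R := S)) = scaleX (M * N) := by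
  ext1 i j
  simp only [Matrix.mul_apply, scaleX, Matrix.map_apply, map_sum, Finset.mul_sum, map_mul,
    mul_assoc]

theorem toBlocks₂₂_one_add_scaleX (A : Matrix (Fin p ⊕ Fin q) (Fin p ⊕ Fin q) S) :
    (1 + scaleX A).toBlocks₂₂ = 1 + scaleX A.toBlocks₂₂ := by
  ext1 i j
  simp [Matrix.toBlocks₂₂, scaleX, Matrix.one_apply]

variable [IsSupercommutative 𝒮]

theorem isUnit_evenPart_psGrading {g : EvenPart (psGrading 𝒮)}
    (hg : PowerSeries.constantCoeff (g : PowerSeries S) = 1) : IsUnit g := by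
  rw [← MulEquiv.isUnit_map (psEquiv 𝒮).symm, PowerSeries.isUnit_iff_constantCoeff]
  have : PowerSeries.constantCoeff ((psEquiv 𝒮).symm g) = 1 := by
    refine Subtype.ext ?_
    rw [← PowerSeries.coeff_zero_eq_constantCoeff_apply, coeff_psEquiv_symm,
      PowerSeries.coeff_zero_eq_constantCoeff_apply, hg]
    rfl
  rw [this]
  exact isUnit_one

theorem isUnit_evenDet_one_add_scaleX {n : Type*} [Fintype n] [DecidableEq n]
    {A : Matrix n n S} (hA : IsHomogeneousMatrix 𝒮 0 A) :
    IsUnit (evenDet (psGrading 𝒮) (1 + scaleX A)) := by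
  set ψ : EvenPart (psGrading 𝒮) →+* EvenPart 𝒮 :=
    (PowerSeries.constantCoeff).comp (psEquiv 𝒮).symm.toRingHom with hψ
  have hψc : ∀ g, (ψ g : S) = PowerSeries.constantCoeff (g : PowerSeries S) := fun g => by
    change ((PowerSeries.constantCoeff ((psEquiv 𝒮).symm g) : EvenPart 𝒮) : S) = _
    rw [← PowerSeries.coeff_zero_eq_constantCoeff_apply, coeff_psEquiv_symm,
      PowerSeries.coeff_zero_eq_constantCoeff_apply]
  refine isUnit_evenPart_psGrading ?_
  rw [← hψc, evenDet, RingHom.map_det]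
  have : ψ.mapMatrix ((1 + scaleX A).map (evenProj (psGrading 𝒮))) = 1 := by
    ext i j
    rw [RingHom.mapMatrix_apply, Matrix.map_apply, hψc, Matrix.map_apply,
      coe_evenProj _ ((IsHomogeneousMatrix.one.add hA.scaleX) i j)]
    simp only [Matrix.add_apply, scaleX, Matrix.map_apply, map_add, map_mul,
      PowerSeries.constantCoeff_X, zero_mul, add_zero, Matrix.one_apply]
    split_ifs <;> simp
  rw [this, Matrix.det_one]
  rfl

theorem IsEvenMatrix.isUnit_one_add_scaleX {A : Matrix (Fin p ⊕ Fin q) (Fin p ⊕ Fin q) S}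
    (hA : IsEvenMatrix 𝒮 A) :
    IsUnit (evenDet (psGrading 𝒮) (1 + SuperCH.scaleX A).toBlocks₂₂) := by
  rw [toBlocks₂₂_one_add_scaleX]
  exact isUnit_evenDet_one_add_scaleX hA.toBlocks₂₂

theorem charFun_eq (A : Matrix (Fin p ⊕ Fin q) (Fin p ⊕ Fin q) S) :
    charFun 𝒮 A = berezinian (psGrading 𝒮) (1 + scaleX A) := rfl

theorem charFun_conj {A B B' : Matrix (Fin p ⊕ Fin q) (Fin p ⊕ Fin q) S}
    (hA : IsEvenMatrix 𝒮 A) (hB : IsEvenMatrix 𝒮 B) (hBB' : B * B' = 1) (hB'B : B' * B = 1) :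
    charFun 𝒮 (B' * A * B) = charFun 𝒮 A := by
  have hB' := hB.of_mul_eq_one hBB' hB'B
  have e1 : B.map (PowerSeries.C (R := S)) * B'.map (PowerSeries.C (R := S)) = 1 := by
    rw [← Matrix.map_mul, hBB', Matrix.map_one _ (map_zero _) (map_one _)]
  have e2 : B'.map (PowerSeries.C (R := S)) * B.map (PowerSeries.C (R := S)) = 1 := by
    rw [← Matrix.map_mul, hB'B, Matrix.map_one _ (map_zero _) (map_one _)]
  have h : 1 + scaleX (B' * A * B) =
      B'.map (PowerSeries.C (R := S)) * (1 + scaleX A) * B.map (PowerSeries.C (R := S)) := by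
    rw [mul_add, add_mul, mul_one, e2, map_C_mul_scaleX, scaleX_mul_map_C]
  rw [charFun_eq, charFun_eq, h, berezinian_conj hB.map_C e1 e2 hA.one_add_scaleX
    hA.isUnit_one_add_scaleX]
  rw [← h]
  exact ((hB'.mul hA).mul hB).isUnit_one_add_scaleX

theorem c_conj {A B B' : Matrix (Fin p ⊕ Fin q) (Fin p ⊕ Fin q) S}
    (hA : IsEvenMatrix 𝒮 A) (hB : IsEvenMatrix 𝒮 B) (hBB' : B * B' = 1) (hB'B : B' * B = 1) :
    c 𝒮 (B' * A * B) = c 𝒮 A := by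
  ext k
  simp only [c, charFun_conj hA hB hBB' hB'B]

theorem charSeries_eq (A : Matrix (Fin p ⊕ Fin q) (Fin p ⊕ Fin q) S) :
    charSeries 𝒮 A = (psEquiv 𝒮).symm (charFun 𝒮 A) := by
  ext n
  rw [coeff_psEquiv_symm, charSeries, PowerSeries.coeff_mk, c, if_pos (Int.natCast_nonneg n)]
  rfl

theorem c_of_neg (A : Matrix (Fin p ⊕ Fin q) (Fin p ⊕ Fin q) S) {k : ℤ} (hk : k < 0) :
    c 𝒮 A k = 0 := if_neg (by omega)

theorem coe_c_natCast (A : Matrix (Fin p ⊕ Fin q) (Fin p ⊕ Fin q) S) (n : ℕ) :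
    (c 𝒮 A n : S) = PowerSeries.coeff n (charFun 𝒮 A : PowerSeries S) := by
  rw [c, if_pos (Int.natCast_nonneg n)]
  rfl

theorem IsCharFraction.isFraction {A : Matrix (Fin p ⊕ Fin q) (Fin p ⊕ Fin q) S}
    {P Q : (EvenPart 𝒮)[X]} (h : IsCharFraction 𝒮 A P Q) : IsFraction p q (c 𝒮 A) P Q :=
  ⟨fun _ => c_of_neg A, h.coeff_zero_den, h.natDegree_num, h.natDegree_den, h.mul_den⟩

theorem natDegree_charpolyRev_le {R : Type*} [CommRing R] {n : ℕ} (M : Matrix (Fin n) (Fin n) R) :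
    M.charpolyRev.natDegree ≤ n := by
  nontriviality R
  rw [← Matrix.reverse_charpoly]
  exact (reverse_natDegree_le _).trans (by simp [Matrix.charpoly_natDegree_eq_dim])

/-- With a zero lower left block the Schur complement is the upper left block itself, so R =
det(1+zK)/det(1+zD). Reversed characteristic polynomials of the negated blocks are these
determinants, with the degree bounds p and q. -/
theorem isCharFraction_upper (K : Matrix (Fin p) (Fin p) (EvenPart 𝒮))
    (D : Matrix (Fin q) (Fin q) (EvenPart 𝒮)) (b : Matrix (Fin p) (Fin q) S) :
    IsCharFraction 𝒮 (Matrix.fromBlocks (K.map Subtype.val) b 0 (D.map Subtype.val))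
      (-K).charpolyRev (-D).charpolyRev := by
  refine ⟨?_, ?_, natDegree_charpolyRev_le _, natDegree_charpolyRev_le _, ?_⟩
  · rw [coeff_zero_eq_eval_zero, Matrix.eval_charpolyRev]
  · rw [coeff_zero_eq_eval_zero, Matrix.eval_charpolyRev]
  set θ : (EvenPart 𝒮)[X] →+* EvenPart (psGrading 𝒮) :=
    (psEquiv 𝒮).toRingHom.comp Polynomial.coeToPowerSeries.ringHom with hθ
  have hθc : ∀ {n : ℕ} (N : Matrix (Fin n) (Fin n) (EvenPart 𝒮)),
      ((1 - (X : (EvenPart 𝒮)[X]) • (-N).map C).map θ).map Subtype.val =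
        1 + scaleX (N.map (Subtype.val : _ → S)) := by
    intro n N
    ext1 i j
    have h1 : ((θ X : EvenPart (psGrading 𝒮)) : PowerSeries S) = PowerSeries.X := by
      simp [hθ, coe_psEquiv]
    have h2 : ∀ a, ((θ (C a) : EvenPart (psGrading 𝒮)) : PowerSeries S) =
        PowerSeries.C (a : S) := fun a => by
      simp [hθ, coe_psEquiv]
    simp only [Matrix.map_apply, Matrix.sub_apply, Matrix.add_apply, Matrix.smul_apply,
      Matrix.neg_apply, scaleX, smul_eq_mul, map_mul, map_neg, mul_neg, sub_neg_eq_add,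
      map_add, Subring.coe_add, Subring.coe_mul, h1, h2, Matrix.one_apply]
    congr 1
    split_ifs <;> simp
  have hθdet : ∀ {n : ℕ} (N : Matrix (Fin n) (Fin n) (EvenPart 𝒮)),
      ((1 - (X : (EvenPart 𝒮)[X]) • (-N).map C).map θ).det = θ (-N).charpolyRev := by
    intro n N
    rw [Matrix.charpolyRev, RingHom.map_det]
    rfl
  set d := (1 - (X : (EvenPart 𝒮)[X]) • (-D).map C).map θ with hd
  have hdu : IsUnit d.det := by
    have := isUnit_evenDet_one_add_scaleX (IsHomogeneousMatrix.map_coe D)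
    rwa [← hθc D, evenDet_map_coe] at this
  have h1 : 1 + scaleX (Matrix.fromBlocks (K.map Subtype.val) b 0 (D.map Subtype.val)) =
      blockLDU ((1 - (X : (EvenPart 𝒮)[X]) • (-K).map C).map θ) d
        (scaleX b * d⁻¹.map Subtype.val) 0 := by
    rw [blockLDU, Matrix.mul_zero, Matrix.mul_zero, add_zero, Matrix.mul_assoc,
      map_coe_inv_mul hdu, Matrix.mul_one, hθc, hd, hθc, ← Matrix.fromBlocks_one, scaleX,
      Matrix.fromBlocks_map, Matrix.fromBlocks_add]
    simp [scaleX]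
  have h2 : charFun 𝒮 (Matrix.fromBlocks (K.map Subtype.val) b 0 (D.map Subtype.val)) *
      θ (-D).charpolyRev = θ (-K).charpolyRev := by
    rw [charFun_eq, h1, berezinian_blockLDU _ hdu, ← hθdet, ← hθdet, mul_assoc, ← hd,
      Ring.inverse_mul_cancel _ hdu, mul_one]
  have h3 := congrArg (psEquiv 𝒮).symm h2
  rw [map_mul, ← charSeries_eq] at h3
  simpa [hθ] using h3

theorem IsDiagonalizedTo.isEigenvalueSystem {A : Matrix (Fin p ⊕ Fin q) (Fin p ⊕ Fin q) S}
    {l : Fin p → EvenPart 𝒮} {m : Fin q → EvenPart 𝒮} (h : IsDiagonalizedTo 𝒮 A l m) :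
    IsEigenvalueSystem 𝒮 A l m := by
  obtain ⟨B, hB, rfl⟩ := h
  have h0 : Matrix.diagonal (Sum.elim (fun i => (l i : S)) (fun α => (m α : S))) =
      Matrix.fromBlocks ((Matrix.diagonal l).map Subtype.val) 0 0
        ((Matrix.diagonal m).map Subtype.val) := by
    rw [Matrix.diagonal_map rfl, Matrix.diagonal_map rfl, Matrix.fromBlocks_diagonal]
  have h1 := isCharFraction_upper (Matrix.diagonal l) (Matrix.diagonal m) 0
  have hdiag : ∀ {n : ℕ} (a : Fin n → EvenPart 𝒮),
      (-Matrix.diagonal a).charpolyRev = ∏ i, (1 + C (a i) * X) := by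
    intro n a
    rw [Matrix.charpolyRev, ← Matrix.det_diagonal]
    congr 1
    ext1 i j
    rcases eq_or_ne i j with rfl | hij
    · simp only [Matrix.sub_apply, Matrix.smul_apply, Matrix.map_apply, Matrix.neg_apply,
        Matrix.diagonal_apply_eq, Matrix.one_apply_eq, smul_eq_mul, map_neg]
      ring
    · simp only [Matrix.sub_apply, Matrix.smul_apply, Matrix.map_apply, Matrix.neg_apply,
        Matrix.diagonal_apply_ne _ hij, Matrix.one_apply_ne hij, smul_eq_mul, map_neg, map_zero]
      ring
  rw [hdiag, hdiag, ← h0] at h1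
  have he : IsEvenMatrix 𝒮 (Matrix.diagonal
      (Sum.elim (fun i => (l i : S)) (fun α => (m α : S)))) := by
    rw [h0]
    exact IsEvenMatrix.fromBlocks (IsHomogeneousMatrix.map_coe _) (fun _ _ => zero_mem _)
      (fun _ _ => zero_mem _) (IsHomogeneousMatrix.map_coe _)
  have hc : c 𝒮 (B.val * Matrix.diagonal (Sum.elim (fun i => (l i : S)) (fun α => (m α : S))) *
      B.inv) = c 𝒮 (Matrix.diagonal (Sum.elim (fun i => (l i : S)) (fun α => (m α : S)))) :=
    c_conj he (hB.of_mul_eq_one B.val_inv B.inv_val) B.inv_val B.val_inv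
  refine ⟨h1.coeff_zero_num, h1.coeff_zero_den, h1.natDegree_num, h1.natDegree_den, ?_⟩
  rw [charSeries, hc]
  exact h1.mul_den

end CharFun

/-! ## The characteristic function as a noncommutative expression -/

section NoncommDet

variable {R R' : Type*} [Ring R] [Ring R'] {n : ℕ}

/-- The column-ordered determinant over a noncommutative ring. -/
def ncDet (M : Matrix (Fin n) (Fin n) R) : R :=
  ∑ σ : Equiv.Perm (Fin n), (Equiv.Perm.sign σ : ℤ) • (List.ofFn fun i => M (σ i) i).prod

theorem map_ncDet (f : R →+* R') (M : Matrix (Fin n) (Fin n) R) :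
    f (ncDet M) = ncDet (M.map f) := by
  simp only [ncDet, map_sum, map_zsmul, map_list_prod, List.map_ofFn]
  rfl

theorem ncDet_eq_det {R : Type*} [CommRing R] (M : Matrix (Fin n) (Fin n) R) :
    ncDet M = M.det := by
  simp only [ncDet, Matrix.det_apply, List.prod_ofFn, Units.smul_def]

theorem ncDet_mem (T : Subring R) {M : Matrix (Fin n) (Fin n) R} (hM : ∀ i j, M i j ∈ T) :
    ncDet M ∈ T := by
  refine sum_mem fun σ _ => zsmul_mem (list_prod_mem fun x hx => ?_) _
  obtain ⟨i, rfl⟩ := (List.mem_ofFn' _ _).mp hx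
  exact hM _ _

theorem ncDet_one : ncDet (1 : Matrix (Fin n) (Fin n) R) = 1 := by
  have h := map_ncDet (Int.castRingHom R) (1 : Matrix (Fin n) (Fin n) ℤ)
  rw [ncDet_eq_det, Matrix.det_one, map_one, Matrix.map_one _ (map_zero _) (map_one _)] at h
  exact h.symm

/-- The matrix `(1 + z D)⁻¹` of geometric series. -/
def geomMatrix {ι : Type*} [Fintype ι] [DecidableEq ι] (D : Matrix ι ι R) :
    Matrix ι ι (PowerSeries R) :=
  Matrix.of fun i j => PowerSeries.mk fun k => ((-D) ^ k) i j

theorem one_add_scaleX_mul_geomMatrix {ι : Type*} [Fintype ι] [DecidableEq ι]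
    (D : Matrix ι ι R) :
    (1 + scaleX D) * geomMatrix D = 1 := by
  rw [add_mul, one_mul]
  ext i j k
  cases k with
  | zero =>
    simp [scaleX, geomMatrix, Matrix.mul_apply, mul_assoc, Matrix.one_apply]
  | succ k =>
    simp only [scaleX, geomMatrix, Matrix.add_apply, Matrix.mul_apply, Matrix.map_apply,
      Matrix.of_apply, map_add, map_sum, mul_assoc, PowerSeries.coeff_succ_X_mul,
      PowerSeries.coeff_C_mul, PowerSeries.coeff_mk]
    rw [pow_succ', Matrix.mul_apply]
    simp only [Matrix.neg_apply, neg_mul, Finset.sum_neg_distrib, neg_add_cancel,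
      Matrix.one_apply]
    split_ifs <;> simp [PowerSeries.coeff_one]

variable {p q : ℕ}

/-- The expansion of the Berezinian of `1 + z A` by a formula that makes sense over every ring. -/
def ncCharSeries (A : Matrix (Fin p ⊕ Fin q) (Fin p ⊕ Fin q) R) : PowerSeries R :=
  ncDet (1 + scaleX A.toBlocks₁₁ -
    scaleX A.toBlocks₁₂ * geomMatrix A.toBlocks₂₂ * scaleX A.toBlocks₂₁) *
      PowerSeries.invOfUnit (ncDet (1 + scaleX A.toBlocks₂₂)) 1

theorem constantCoeff_ncDet_one_add_scaleX (D : Matrix (Fin n) (Fin n) R) :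
    PowerSeries.constantCoeff (ncDet (1 + scaleX D)) = 1 := by
  rw [map_ncDet]
  refine (congrArg ncDet (Matrix.ext fun i j => ?_)).trans ncDet_one
  simp only [Matrix.map_apply, Matrix.add_apply, scaleX, map_add, map_mul,
    PowerSeries.constantCoeff_X, zero_mul, add_zero, Matrix.one_apply]
  split_ifs <;> simp

theorem map_scaleX (f : R →+* R') {m n : Type*} (A : Matrix m n R) :
    (scaleX A).map (PowerSeries.map f) = scaleX (A.map f) := by
  ext1 i j
  simp [scaleX]

theorem map_geomMatrix (f : R →+* R') {ι : Type*} [Fintype ι] [DecidableEq ι]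
    (D : Matrix ι ι R) :
    (geomMatrix D).map (PowerSeries.map f) = geomMatrix (D.map f) := by
  ext i j k
  have : (-D.map f) ^ k = f.mapMatrix ((-D) ^ k) := by
    rw [map_pow, map_neg]
    rfl
  simp only [geomMatrix, Matrix.map_apply, Matrix.of_apply, PowerSeries.coeff_map,
    PowerSeries.coeff_mk, this, RingHom.mapMatrix_apply]

/-- The reason for a formula free of gradings and commutativity: it is natural in every ring
homomorphism, in particular in the evaluation of free generators at the entries of a matrix. -/
theorem map_ncCharSeries (f : R →+* R') (A : Matrix (Fin p ⊕ Fin q) (Fin p ⊕ Fin q) R) :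
    PowerSeries.map f (ncCharSeries A) = ncCharSeries (A.map f) := by
  have h1 : ∀ {n : ℕ} (D : Matrix (Fin n) (Fin n) R),
      (1 + scaleX D).map (PowerSeries.map f) = 1 + scaleX (D.map f) := by
    intro n D
    rw [Matrix.map_add _ (map_add _), Matrix.map_one _ (map_zero _) (map_one _), map_scaleX]
  have h2 : PowerSeries.map f (PowerSeries.invOfUnit (ncDet (1 + scaleX A.toBlocks₂₂)) 1) =
      PowerSeries.invOfUnit (ncDet (1 + scaleX (A.map f).toBlocks₂₂)) 1 := by
    refine left_inv_eq_right_inv (a := ncDet (1 + scaleX (A.map f).toBlocks₂₂)) ?_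
      (PowerSeries.mul_invOfUnit _ _ (constantCoeff_ncDet_one_add_scaleX _))
    have h3 := congrArg (PowerSeries.map f) (PowerSeries.invOfUnit_mul
      (ncDet (1 + scaleX A.toBlocks₂₂)) 1 (constantCoeff_ncDet_one_add_scaleX _))
    rw [map_mul, map_one, map_ncDet, h1] at h3
    exact h3
  rw [ncCharSeries, map_mul, h2, map_ncDet, Matrix.map_sub _ (map_sub _), h1, Matrix.map_mul,
    Matrix.map_mul, map_scaleX, map_scaleX, map_geomMatrix]
  rfl

end NoncommDet

/-! ### The c_k as homogeneous integral forms in the matrix entries. -/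

section Universality

variable {S : Type*} [Ring S] {𝒮 : ZMod 2 → AddSubgroup S} [GradedRing 𝒮]
  [IsSupercommutative 𝒮] {p q : ℕ}

theorem coe_evenDet {n : ℕ} {M : Matrix (Fin n) (Fin n) S} (hM : IsHomogeneousMatrix 𝒮 0 M) :
    (evenDet 𝒮 M : S) = ncDet M := by
  rw [evenDet, ← ncDet_eq_det]
  refine (map_ncDet (EvenPart 𝒮).subtype _).trans (congrArg ncDet ?_)
  exact hM.map_evenProj

/-- The ordered determinants have even, hence commuting, entries here, and the geometric series are
the inverses occurring in the Berezinian by uniqueness of inverses. -/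
theorem coe_charFun {A : Matrix (Fin p ⊕ Fin q) (Fin p ⊕ Fin q) S} (hA : IsEvenMatrix 𝒮 A) :
    (charFun 𝒮 A : PowerSeries S) = ncCharSeries A := by
  have h22 : IsHomogeneousMatrix (psGrading 𝒮) 0 (1 + scaleX A.toBlocks₂₂) :=
    IsHomogeneousMatrix.one.add hA.toBlocks₂₂.scaleX
  obtain ⟨d, hd⟩ : ∃ d : Matrix (Fin q) (Fin q) (EvenPart (psGrading 𝒮)),
      d.map Subtype.val = 1 + scaleX A.toBlocks₂₂ := ⟨_, h22.map_evenProj⟩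
  have hdu : IsUnit d.det := by
    have := isUnit_evenDet_one_add_scaleX hA.toBlocks₂₂
    rwa [← hd, evenDet_map_coe] at this
  have hinv : d⁻¹.map Subtype.val = geomMatrix A.toBlocks₂₂ :=
    left_inv_eq_right_inv (map_coe_inv_mul hdu) (hd ▸ one_add_scaleX_mul_geomMatrix _)
  have h11 : (1 + scaleX A).toBlocks₁₁ = 1 + scaleX A.toBlocks₁₁ := by
    ext1 i j
    simp [Matrix.toBlocks₁₁, scaleX, Matrix.one_apply]
  have h12 : (1 + scaleX A).toBlocks₁₂ = scaleX A.toBlocks₁₂ := by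
    ext1 i j
    simp [Matrix.toBlocks₁₂, scaleX]
  have h21 : (1 + scaleX A).toBlocks₂₁ = scaleX A.toBlocks₂₁ := by
    ext1 i j
    simp [Matrix.toBlocks₂₁, scaleX]
  have hd' : (1 + scaleX A).toBlocks₂₂.map (evenProj (psGrading 𝒮)) = d := by
    rw [toBlocks₂₂_one_add_scaleX, ← hd, map_coe_map_evenProj]
  have hs : IsHomogeneousMatrix (psGrading 𝒮) 0 (1 + scaleX A.toBlocks₁₁ -
      scaleX A.toBlocks₁₂ * geomMatrix A.toBlocks₂₂ * scaleX A.toBlocks₂₁) := by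
    rw [← hinv]
    exact (IsHomogeneousMatrix.one.add hA.toBlocks₁₁.scaleX).sub
      ((hA.toBlocks₁₂.scaleX.mul_even (IsHomogeneousMatrix.map_coe _)).mul_odd
        hA.toBlocks₂₁.scaleX)
  have h1 : charFun 𝒮 A = evenDet (psGrading 𝒮) (1 + scaleX A.toBlocks₁₁ -
      scaleX A.toBlocks₁₂ * geomMatrix A.toBlocks₂₂ * scaleX A.toBlocks₂₁) *
        Ring.inverse d.det := by
    rw [charFun_eq, berezinian, hd', hinv, h11, h12, h21]
    rfl
  have h2 : ((Ring.inverse d.det : EvenPart (psGrading 𝒮)) : PowerSeries S) =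
      PowerSeries.invOfUnit (ncDet (1 + scaleX A.toBlocks₂₂)) 1 := by
    refine left_inv_eq_right_inv (a := ncDet (1 + scaleX A.toBlocks₂₂)) ?_
      (PowerSeries.mul_invOfUnit _ _ (constantCoeff_ncDet_one_add_scaleX _))
    rw [← coe_evenDet h22, ← hd, evenDet_map_coe, ← Subring.coe_mul,
      Ring.inverse_mul_cancel _ hdu, Subring.coe_one]
  rw [h1, Subring.coe_mul, h2, coe_evenDet hs, ncCharSeries]

theorem coe_c {A : Matrix (Fin p ⊕ Fin q) (Fin p ⊕ Fin q) S} (hA : IsEvenMatrix 𝒮 A) (n : ℕ) :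
    (c 𝒮 A n : S) = PowerSeries.coeff n (ncCharSeries A) := by
  rw [coe_c_natCast, coe_charFun hA]

theorem c_zero {A : Matrix (Fin p ⊕ Fin q) (Fin p ⊕ Fin q) S} (hA : IsEvenMatrix 𝒮 A) :
    c 𝒮 A 0 = 1 := by
  refine Subtype.ext ((coe_c hA 0).trans ?_)
  have h : PowerSeries.constantCoeff (ncDet (1 + scaleX A.toBlocks₁₁ -
      scaleX A.toBlocks₁₂ * geomMatrix A.toBlocks₂₂ * scaleX A.toBlocks₂₁)) = 1 := by
    rw [map_ncDet, Matrix.map_sub _ (map_sub _), Matrix.map_mul]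
    refine (congrArg ncDet (Matrix.ext fun i j => ?_)).trans ncDet_one
    simp only [Matrix.map_apply, Matrix.add_apply, scaleX, map_add, map_mul, Matrix.sub_apply,
      PowerSeries.constantCoeff_X, zero_mul, add_zero, Matrix.one_apply, Matrix.mul_apply,
      mul_zero, Finset.sum_const_zero, sub_zero]
    split_ifs <;> simp
  rw [ncCharSeries, PowerSeries.coeff_zero_eq_constantCoeff_apply, map_mul, h,
    PowerSeries.constantCoeff_invOfUnit]
  simp

theorem c_map {T : Type*} [Ring T] {𝒯 : ZMod 2 → AddSubgroup T} [GradedRing 𝒯]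
    [IsSupercommutative 𝒯] (f : S →+* T) {A : Matrix (Fin p ⊕ Fin q) (Fin p ⊕ Fin q) S}
    (hA : IsEvenMatrix 𝒮 A) (hfA : IsEvenMatrix 𝒯 (A.map f)) (k : ℤ) :
    (c 𝒯 (A.map f) k : T) = f (c 𝒮 A k : S) := by
  rcases lt_or_ge k 0 with hk | hk
  · rw [c_of_neg _ hk, c_of_neg _ hk]
    simp
  · obtain ⟨n, rfl⟩ := Int.eq_ofNat_of_zero_le hk
    rw [coe_c hA, coe_c hfA, ← map_ncCharSeries, PowerSeries.coeff_map]

/-- Evaluation of noncommutative polynomials at the entries of a matrix. -/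
def liftEntries {R I : Type*} [Ring R] (A : Matrix I I R) : FreeAlgebra ℤ (I × I) →+* R :=
  (FreeAlgebra.lift ℤ (fun ij : I × I => A ij.1 ij.2) : FreeAlgebra ℤ (I × I) →ₐ[ℤ] R)

/-- The matrix of the generators of the free algebra. -/
def genericMatrix (I : Type*) : Matrix I I (FreeAlgebra ℤ (I × I)) :=
  Matrix.of fun i j => FreeAlgebra.ι ℤ (i, j)

theorem map_genericMatrix {R I : Type*} [Ring R] (A : Matrix I I R) :
    (genericMatrix I).map (liftEntries A) = A := by
  ext i j
  simp [genericMatrix, liftEntries]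

theorem coe_c_eq_liftEntries {A : Matrix (Fin p ⊕ Fin q) (Fin p ⊕ Fin q) S}
    (hA : IsEvenMatrix 𝒮 A) (n : ℕ) :
    (c 𝒮 A n : S) =
      liftEntries A (PowerSeries.coeff n (ncCharSeries (genericMatrix (Fin p ⊕ Fin q)))) := by
  rw [coe_c hA, ← PowerSeries.coeff_map, map_ncCharSeries, map_genericMatrix]

/-- The noncommutative polynomials that are homogeneous of degree `n`. -/
def homogeneousForms (I : Type*) (n : ℕ) : AddSubgroup (FreeAlgebra ℤ I) :=
  AddSubgroup.closure {x | ∃ l : List I, l.length = n ∧ (l.map (FreeAlgebra.ι ℤ)).prod = x}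

theorem one_mem_homogeneousForms (I : Type*) : 1 ∈ homogeneousForms I 0 :=
  AddSubgroup.subset_closure ⟨[], rfl, rfl⟩

theorem ι_mem_homogeneousForms {I : Type*} (i : I) :
    FreeAlgebra.ι ℤ i ∈ homogeneousForms I 1 :=
  AddSubgroup.subset_closure ⟨[i], rfl, by simp⟩

theorem mul_mem_homogeneousForms {I : Type*} {m n : ℕ} {x y : FreeAlgebra ℤ I}
    (hx : x ∈ homogeneousForms I m) (hy : y ∈ homogeneousForms I n) :
    x * y ∈ homogeneousForms I (m + n) := by
  induction hx using AddSubgroup.closure_induction with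
  | mem x hx =>
    obtain ⟨l, rfl, rfl⟩ := hx
    induction hy using AddSubgroup.closure_induction with
    | mem y hy =>
      obtain ⟨l', rfl, rfl⟩ := hy
      exact AddSubgroup.subset_closure ⟨l ++ l', by simp, by simp⟩
    | zero => simp
    | add y y' _ _ h h' => rw [mul_add]; exact add_mem h h'
    | neg y _ h => rw [mul_neg]; exact neg_mem h
  | zero => simp
  | add x x' _ _ h h' => rw [add_mul]; exact add_mem h h'
  | neg x _ h => rw [neg_mul]; exact neg_mem h

/-- Power series whose `k`-th coefficient is homogeneous of degree `k`. -/
def isobaricSeries (I : Type*) : Subring (PowerSeries (FreeAlgebra ℤ I)) where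
  carrier := {f | ∀ k, PowerSeries.coeff k f ∈ homogeneousForms I k}
  mul_mem' {f g} hf hg k := by
    rw [PowerSeries.coeff_mul]
    refine sum_mem fun x hx => ?_
    rw [← Finset.HasAntidiagonal.mem_antidiagonal.mp hx]
    exact mul_mem_homogeneousForms (hf _) (hg _)
  one_mem' k := by
    rw [PowerSeries.coeff_one]
    split_ifs with hk
    · rw [hk]
      exact one_mem_homogeneousForms I
    · exact zero_mem _
  add_mem' hf hg k := by
    rw [map_add]
    exact add_mem (hf k) (hg k)
  zero_mem' k := by simp
  neg_mem' hf k := by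
    rw [map_neg]
    exact neg_mem (hf k)

/-- The coefficients of the inverse are obtained recursively, and every step of the recursion
preserves the weight. -/
theorem mem_isobaricSeries_of_mul_eq_one {I : Type*} {f g : PowerSeries (FreeAlgebra ℤ I)}
    (hf : f ∈ isobaricSeries I) (h0 : PowerSeries.constantCoeff f = 1) (h : f * g = 1) :
    g ∈ isobaricSeries I := by
  intro k
  induction k using Nat.strong_induction_on with
  | _ k ih =>
    have h1 := congrArg (PowerSeries.coeff k) h
    rw [PowerSeries.coeff_mul, Finset.Nat.sum_antidiagonal_eq_sum_range_succ_mk,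
      Finset.sum_range_succ', PowerSeries.coeff_zero_eq_constantCoeff_apply, h0, one_mul] at h1
    rw [show PowerSeries.coeff k g = PowerSeries.coeff k 1 - _ from eq_sub_of_add_eq' h1]
    refine sub_mem ((isobaricSeries I).one_mem k) (sum_mem fun i hi => ?_)
    have hi' : i < k := Finset.mem_range.mp hi
    have := mul_mem_homogeneousForms (hf (i + 1)) (ih (k - (i + 1)) (by omega))
    rwa [show i + 1 + (k - (i + 1)) = k by omega] at this

/-- Each factor z is accompanied by exactly one matrix entry. This homogeneity is used twice: for
the top coefficient in z of minors of zA + D, and for the scaling law c_n(uA) = u^n c_n(A). -/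
theorem ncCharSeries_genericMatrix_mem :
    ncCharSeries (genericMatrix (Fin p ⊕ Fin q)) ∈
      isobaricSeries ((Fin p ⊕ Fin q) × (Fin p ⊕ Fin q)) := by
  set Γ := genericMatrix (Fin p ⊕ Fin q)
  have hlin : ∀ i j, Γ i j ∈ homogeneousForms ((Fin p ⊕ Fin q) × (Fin p ⊕ Fin q)) 1 :=
    fun i j => ι_mem_homogeneousForms _
  have hz : ∀ i j, (PowerSeries.X * PowerSeries.C (Γ i j)) ∈
      isobaricSeries ((Fin p ⊕ Fin q) × (Fin p ⊕ Fin q)) := by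
    intro i j k
    cases k with
    | zero => simp
    | succ k =>
      rw [PowerSeries.coeff_succ_X_mul, PowerSeries.coeff_C]
      split_ifs with hk
      · rw [hk]
        exact hlin i j
      · exact zero_mem _
  have hone : ∀ {n : ℕ} (i j : Fin n),
      (1 : Matrix (Fin n) (Fin n) (PowerSeries _)) i j ∈
        isobaricSeries ((Fin p ⊕ Fin q) × (Fin p ⊕ Fin q)) := by
    intro n i j
    rw [Matrix.one_apply]
    split_ifs
    · exact one_mem _
    · exact zero_mem _
  have hgeom : ∀ i j, geomMatrix Γ.toBlocks₂₂ i j ∈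
      isobaricSeries ((Fin p ⊕ Fin q) × (Fin p ⊕ Fin q)) := by
    intro i j k
    rw [geomMatrix, Matrix.of_apply, PowerSeries.coeff_mk]
    induction k generalizing i j with
    | zero =>
      rw [pow_zero, Matrix.one_apply]
      split_ifs
      · exact one_mem_homogeneousForms _
      · exact zero_mem _
    | succ k ih =>
      rw [pow_succ, Matrix.mul_apply]
      exact sum_mem fun l _ => mul_mem_homogeneousForms (ih i l) (neg_mem (hlin _ _))
  refine mul_mem (ncDet_mem _ fun i j => sub_mem (add_mem (hone i j) (hz _ _)) ?_)
    (mem_isobaricSeries_of_mul_eq_one (f := ncDet (1 + scaleX Γ.toBlocks₂₂))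
      (ncDet_mem _ fun i j => add_mem (hone i j) (hz _ _))
      (constantCoeff_ncDet_one_add_scaleX _)
      (PowerSeries.mul_invOfUnit _ _ (constantCoeff_ncDet_one_add_scaleX _)))
  rw [Matrix.mul_apply]
  refine sum_mem fun l _ => mul_mem ?_ (hz _ _)
  rw [Matrix.mul_apply]
  exact sum_mem fun l' _ => mul_mem (hz _ _) (hgeom _ _)

theorem liftEntries_smul {R I : Type*} [Ring R] (A : Matrix I I R) {u : R}
    (hu : ∀ r, Commute u r) {n : ℕ} {g : FreeAlgebra ℤ (I × I)} (hg : g ∈ homogeneousForms _ n) :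
    liftEntries (u • A) g = u ^ n * liftEntries A g := by
  induction hg using AddSubgroup.closure_induction with
  | mem x hx =>
    obtain ⟨l, rfl, rfl⟩ := hx
    induction l with
    | nil => simp
    | cons ij l ih =>
      rw [List.map_cons, List.prod_cons, map_mul, map_mul, ih, List.length_cons, pow_succ']
      have h1 : liftEntries (u • A) (FreeAlgebra.ι ℤ ij) =
          u * liftEntries A (FreeAlgebra.ι ℤ ij) := by simp [liftEntries]
      rw [h1, mul_assoc, mul_assoc, ← mul_assoc _ (u ^ l.length),
        ← ((hu _).pow_left l.length).eq, mul_assoc]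
  | zero => simp
  | add x y _ _ hx hy => rw [map_add, map_add, hx, hy, mul_add]
  | neg x _ hx => rw [map_neg, map_neg, hx, mul_neg]

theorem c_smul {A : Matrix (Fin p ⊕ Fin q) (Fin p ⊕ Fin q) S} (hA : IsEvenMatrix 𝒮 A)
    (u : EvenPart 𝒮) (n : ℕ) : c 𝒮 ((u : S) • A) n = u ^ n * c 𝒮 A n := by
  have huA : IsEvenMatrix 𝒮 ((u : S) • A) := fun i j => by
    have := SetLike.GradedMul.mul_mem (A := 𝒮) (i := 0) u.2 (hA i j)
    rwa [zero_add] at this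
  refine Subtype.ext ?_
  rw [coe_c_eq_liftEntries huA, Subring.coe_mul, Subring.coe_pow, coe_c_eq_liftEntries hA,
    liftEntries_smul A (fun r => even_comm 𝒮 u.2 r) (ncCharSeries_genericMatrix_mem n)]

theorem map_modifiedPoly {R R' : Type*} [CommRing R] [CommRing R'] (f : R →+* R') (p q : ℕ)
    (x : ℤ → R) : (modifiedPoly p q x).map f = modifiedPoly p q fun k => f (x k) := by
  have h : ∀ g : MvPolynomial ℤ ℤ, f (MvPolynomial.aeval x g) =
      MvPolynomial.aeval (fun k => f (x k)) g := fun g => by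
    rw [MvPolynomial.aeval_def, MvPolynomial.aeval_def, MvPolynomial.hom_eval₂]
    congr 1
    exact RingHom.ext_int _ _
  rw [modifiedPoly, Polynomial.map_sum, modifiedPoly]
  refine Finset.sum_congr rfl fun r _ => ?_
  rw [Polynomial.map_mul, map_C, map_mul, h, cayleyHamiltonPoly, Polynomial.map_sum]
  simp [cayleyHamiltonPoly]

theorem exists_liftEntries_eq_aeval (p q : ℕ) (h : MvPolynomial ℤ ℤ) :
    ∃ g : FreeAlgebra ℤ ((Fin p ⊕ Fin q) × (Fin p ⊕ Fin q)),
      ∀ (S : Type u) [Ring S] (𝒮 : ZMod 2 → AddSubgroup S) [GradedRing 𝒮]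
        [IsSupercommutative 𝒮] (A : Matrix (Fin p ⊕ Fin q) (Fin p ⊕ Fin q) S),
        IsEvenMatrix 𝒮 A → (MvPolynomial.aeval (c 𝒮 A) h : S) = liftEntries A g := by
  induction h using MvPolynomial.induction_on with
  | C a => exact ⟨a, fun S _ 𝒮 _ _ A hA => by simp⟩
  | add f g hf hg =>
    obtain ⟨f', hf'⟩ := hf
    obtain ⟨g', hg'⟩ := hg
    exact ⟨f' + g', fun S _ 𝒮 _ _ A hA => by simp [hf' S 𝒮 A hA, hg' S 𝒮 A hA]⟩
  | mul_X f k hf =>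
    obtain ⟨f', hf'⟩ := hf
    rcases lt_or_ge k 0 with hk | hk
    · exact ⟨0, fun S _ 𝒮 _ _ A hA => by simp [c_of_neg A hk]⟩
    · obtain ⟨n, rfl⟩ := Int.eq_ofNat_of_zero_le hk
      exact ⟨f' * PowerSeries.coeff n (ncCharSeries (genericMatrix _)),
        fun S _ 𝒮 _ _ A hA => by
          rw [map_mul, map_mul, ← hf' S 𝒮 A hA, ← coe_c_eq_liftEntries hA, MvPolynomial.aeval_X,
            Subring.coe_mul]⟩

theorem exists_lift_eq_coeff_modifiedCharPoly (p q : ℕ) (n : ℕ) :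
    ∃ g : FreeAlgebra ℤ ((Fin p ⊕ Fin q) × (Fin p ⊕ Fin q)),
      ∀ (S : Type u) [Ring S] (𝒮 : ZMod 2 → AddSubgroup S) [GradedRing 𝒮]
        [IsSupercommutative 𝒮] (A : Matrix (Fin p ⊕ Fin q) (Fin p ⊕ Fin q) S),
        IsEvenMatrix 𝒮 A → ((modifiedCharPoly 𝒮 A).coeff n : S) = liftEntries A g := by
  obtain ⟨g, hg⟩ := exists_liftEntries_eq_aeval p q
    ((modifiedPoly p q (MvPolynomial.X : ℤ → MvPolynomial ℤ ℤ)).coeff n)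
  refine ⟨g, fun S _ 𝒮 _ _ A hA => ?_⟩
  rw [← hg S 𝒮 A hA]
  have h := map_modifiedPoly (MvPolynomial.aeval (R := ℤ) (c 𝒮 A)).toRingHom p q MvPolynomial.X
  have h2 := congrArg (fun f => coeff f n) h
  simp only [coeff_map] at h2
  refine congrArg Subtype.val (Eq.trans ?_ h2.symm)
  simp [modifiedCharPoly]

end Universality

/-! ## Vanishing of the Hankel determinants of order `q + 1` -/

section LowOrder

variable {S : Type*} [Ring S]

variable (S) in
/-- The power series of order at least `n`. -/
def lowOrder (n : ℕ) : AddSubgroup (PowerSeries S) where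
  carrier := {f | ∀ k < n, PowerSeries.coeff k f = 0}
  zero_mem' k _ := by simp
  add_mem' hf hg k hk := by rw [map_add, hf k hk, hg k hk, add_zero]
  neg_mem' hf k hk := by rw [map_neg, hf k hk, neg_zero]

theorem mul_mem_lowOrder {m n : ℕ} {f g : PowerSeries S} (hf : f ∈ lowOrder S m)
    (hg : g ∈ lowOrder S n) : f * g ∈ lowOrder S (m + n) := fun k hk => by
  rw [PowerSeries.coeff_mul]
  refine Finset.sum_eq_zero fun x hx => ?_
  have := Finset.HasAntidiagonal.mem_antidiagonal.mp hx
  rcases lt_or_ge x.1 m with h | h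
  · rw [hf _ h, zero_mul]
  · rw [hg _ (by omega), mul_zero]

theorem lowOrder_antitone {m n : ℕ} (h : m ≤ n) : lowOrder S n ≤ lowOrder S m :=
  fun _ hf k hk => hf k (hk.trans_le h)

theorem matrix_mul_mem_lowOrder {l m n : Type*} [Fintype m] {a b : ℕ}
    {M : Matrix l m (PowerSeries S)} {N : Matrix m n (PowerSeries S)}
    (hM : ∀ i j, M i j ∈ lowOrder S a) (hN : ∀ i j, N i j ∈ lowOrder S b) (i : l) (j : n) :
    (M * N) i j ∈ lowOrder S (a + b) := by
  rw [Matrix.mul_apply]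
  exact sum_mem fun k _ => mul_mem_lowOrder (hM i k) (hN k j)

theorem scaleX_mem_lowOrder {m n : Type*} (A : Matrix m n S) (i : m) (j : n) :
    scaleX A i j ∈ lowOrder S 1 := fun k hk => by
  rw [Nat.lt_one_iff.mp hk]
  simp [scaleX]

theorem mem_lowOrder_zero (f : PowerSeries S) : f ∈ lowOrder S 0 :=
  fun _ hk => absurd hk (Nat.not_lt_zero _)

theorem eq_zero_of_forall_mem_lowOrder {f : PowerSeries S} (h : ∀ n, f ∈ lowOrder S n) :
    f = 0 := by
  ext k
  exact h (k + 1) k (Nat.lt_succ_self k)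

end LowOrder

/-! ### Block triangularization of zA + diag(0,1) over power series. -/

section Riccati

variable {S : Type*} [Ring S] {𝒮 : ZMod 2 → AddSubgroup S} [GradedRing 𝒮] {p q : ℕ}

/-- The right-hand side of the fixed point equation for the off-diagonal block of a
block triangularization. -/
def riccatiMap (A : Matrix (Fin p ⊕ Fin q) (Fin p ⊕ Fin q) S)
    (Y : Matrix (Fin q) (Fin p) (PowerSeries S)) : Matrix (Fin q) (Fin p) (PowerSeries S) :=
  Y * (scaleX A.toBlocks₁₁ + scaleX A.toBlocks₁₂ * Y) - scaleX A.toBlocks₂₁ -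
    scaleX A.toBlocks₂₂ * Y

/-- A z-adic contraction: after subtraction every term contains `Y - Y'` and a block of zA. -/
theorem riccatiMap_sub_mem (A : Matrix (Fin p ⊕ Fin q) (Fin p ⊕ Fin q) S) {n : ℕ}
    {Y Y' : Matrix (Fin q) (Fin p) (PowerSeries S)}
    (h : ∀ i j, (Y - Y') i j ∈ lowOrder S n) (i : Fin q) (j : Fin p) :
    (riccatiMap A Y - riccatiMap A Y') i j ∈ lowOrder S (n + 1) := by
  have h1 : riccatiMap A Y - riccatiMap A Y' =
      (Y - Y') * scaleX A.toBlocks₁₁ + (Y - Y') * scaleX A.toBlocks₁₂ * Y +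
        Y' * scaleX A.toBlocks₁₂ * (Y - Y') - scaleX A.toBlocks₂₂ * (Y - Y') := by
    simp only [riccatiMap, Matrix.mul_add, Matrix.sub_mul, Matrix.mul_sub, Matrix.mul_assoc]
    abel
  rw [h1]
  refine sub_mem (add_mem (add_mem ?_ ?_) ?_) ?_
  · exact matrix_mul_mem_lowOrder h (scaleX_mem_lowOrder _) i j
  · exact matrix_mul_mem_lowOrder (matrix_mul_mem_lowOrder h (scaleX_mem_lowOrder _))
      (fun _ _ => mem_lowOrder_zero _) i j
  · have := matrix_mul_mem_lowOrder (matrix_mul_mem_lowOrder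
      (fun i j => mem_lowOrder_zero (Y' i j)) (scaleX_mem_lowOrder A.toBlocks₁₂)) h i j
    rwa [zero_add, add_comm] at this
  · have := matrix_mul_mem_lowOrder (scaleX_mem_lowOrder A.toBlocks₂₂) h i j
    rwa [add_comm] at this

/-- The fixed point is the z-adic limit of the iterates starting at 0. All iterates are odd, and the
coefficient of z^k no longer changes after k+1 steps. -/
theorem exists_riccatiMap_eq {A : Matrix (Fin p ⊕ Fin q) (Fin p ⊕ Fin q) S}
    (hA : IsEvenMatrix 𝒮 A) : ∃ Y : Matrix (Fin q) (Fin p) (PowerSeries S),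
      IsHomogeneousMatrix (psGrading 𝒮) 1 Y ∧ riccatiMap A Y = Y := by
  set y : ℕ → Matrix (Fin q) (Fin p) (PowerSeries S) := fun n => (riccatiMap A)^[n] 0 with hy
  have hys : ∀ n, y (n + 1) = riccatiMap A (y n) := fun n =>
    Function.iterate_succ_apply' _ _ _
  have hodd : ∀ n, IsHomogeneousMatrix (psGrading 𝒮) 1 (y n) := by
    intro n
    induction n with
    | zero => exact fun _ _ => zero_mem _
    | succ n ih =>
      rw [hys]
      exact ((ih.mul_even (hA.toBlocks₁₁.scaleX.add
        (hA.toBlocks₁₂.scaleX.mul_odd ih))).sub hA.toBlocks₂₁.scaleX).sub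
          (hA.toBlocks₂₂.scaleX.even_mul ih)
  have hstep : ∀ n i j, (y (n + 1) - y n) i j ∈ lowOrder S n := by
    intro n
    induction n with
    | zero => exact fun _ _ => mem_lowOrder_zero _
    | succ n ih =>
      intro i j
      have := riccatiMap_sub_mem A ih i j
      rwa [← hys, ← hys] at this
  have hcauchy : ∀ n k i j, (y (n + k) - y n) i j ∈ lowOrder S n := by
    intro n k
    induction k with
    | zero => intro i j; simp [zero_mem]
    | succ k ih =>
      intro i j
      have := add_mem (lowOrder_antitone (Nat.le_add_right n k) (hstep (n + k) i j)) (ih i j)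
      simpa [add_assoc] using this
  set Y : Matrix (Fin q) (Fin p) (PowerSeries S) :=
    Matrix.of fun i j => PowerSeries.mk fun k => PowerSeries.coeff k (y (k + 1) i j) with hY
  have hlim : ∀ n i j, (Y - y n) i j ∈ lowOrder S n := by
    intro n i j k hk
    obtain ⟨l, rfl⟩ := Nat.exists_eq_add_of_le (Nat.succ_le_of_lt hk)
    have := hcauchy (k + 1) l i j k (Nat.lt_succ_self k)
    rw [Matrix.sub_apply, map_sub, sub_eq_zero] at this ⊢
    rw [hY, Matrix.of_apply, PowerSeries.coeff_mk]
    exact this.symm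
  refine ⟨Y, fun i j k => ?_, ?_⟩
  · rw [hY, Matrix.of_apply, PowerSeries.coeff_mk]
    exact hodd _ i j k
  · rw [← sub_eq_zero]
    ext1 i j
    refine eq_zero_of_forall_mem_lowOrder fun n => ?_
    have h1 := riccatiMap_sub_mem A (hlim n) i j
    rw [← hys] at h1
    have h2 := sub_mem h1 (hlim (n + 1) i j)
    have h3 := lowOrder_antitone (Nat.le_succ n) h2
    simpa using h3

variable [IsSupercommutative 𝒮]

/-- The added diag(0,1) separates the two diagonal blocks at z = 0. The equation for an invariant
complement [1; Y] then has linear part `Y` plus terms divisible by z, so it is solved by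
`exists_riccatiMap_eq`. Conjugation by the unipotent matrix of `Y` reduces to
`isCharFraction_upper`. -/
theorem exists_isFraction_scaleX_add {A : Matrix (Fin p ⊕ Fin q) (Fin p ⊕ Fin q) S}
    (hA : IsEvenMatrix 𝒮 A) : ∃ P Q : (EvenPart (psGrading 𝒮))[X],
      IsFraction p q (c (psGrading 𝒮)
        (scaleX A + (Matrix.fromBlocks 0 0 0 1).map (PowerSeries.C (R := S)))) P Q := by
  obtain ⟨Y, hY, hfix⟩ := exists_riccatiMap_eq hA
  have hKe : IsHomogeneousMatrix (psGrading 𝒮) 0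
      (scaleX A.toBlocks₁₁ + scaleX A.toBlocks₁₂ * Y) :=
    hA.toBlocks₁₁.scaleX.add (hA.toBlocks₁₂.scaleX.mul_odd hY)
  have hDe : IsHomogeneousMatrix (psGrading 𝒮) 0
      (scaleX A.toBlocks₂₂ + 1 - Y * scaleX A.toBlocks₁₂) :=
    (hA.toBlocks₂₂.scaleX.add IsHomogeneousMatrix.one).sub (hY.mul_odd hA.toBlocks₁₂.scaleX)
  obtain ⟨K, hK⟩ : ∃ K : Matrix (Fin p) (Fin p) (EvenPart (psGrading 𝒮)),
      K.map Subtype.val = scaleX A.toBlocks₁₁ + scaleX A.toBlocks₁₂ * Y := ⟨_, hKe.map_evenProj⟩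
  obtain ⟨D, hD⟩ : ∃ D : Matrix (Fin q) (Fin q) (EvenPart (psGrading 𝒮)),
      D.map Subtype.val = scaleX A.toBlocks₂₂ + 1 - Y * scaleX A.toBlocks₁₂ :=
    ⟨_, hDe.map_evenProj⟩
  set T : Matrix (Fin p ⊕ Fin q) (Fin p ⊕ Fin q) (PowerSeries S) :=
    Matrix.fromBlocks (K.map Subtype.val) (scaleX A.toBlocks₁₂) 0 (D.map Subtype.val) with hT
  set B : Matrix (Fin p ⊕ Fin q) (Fin p ⊕ Fin q) (PowerSeries S) :=
    Matrix.fromBlocks 1 0 Y 1 with hB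
  set B' : Matrix (Fin p ⊕ Fin q) (Fin p ⊕ Fin q) (PowerSeries S) :=
    Matrix.fromBlocks 1 0 (-Y) 1 with hB'
  have hBB' : B * B' = 1 := by
    rw [hB, hB', lower_mul_lower, add_neg_cancel, Matrix.fromBlocks_one]
  have hB'B : B' * B = 1 := by
    rw [hB, hB', lower_mul_lower, neg_add_cancel, Matrix.fromBlocks_one]
  have hTe : IsEvenMatrix (psGrading 𝒮) T :=
    IsEvenMatrix.fromBlocks (IsHomogeneousMatrix.map_coe _) hA.toBlocks₁₂.scaleX
      (fun _ _ => zero_mem _) (IsHomogeneousMatrix.map_coe _)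
  have hB'e : IsEvenMatrix (psGrading 𝒮) B' :=
    IsEvenMatrix.fromBlocks IsHomogeneousMatrix.one (fun _ _ => zero_mem _) hY.neg
      IsHomogeneousMatrix.one
  have hAB : scaleX A + (Matrix.fromBlocks 0 0 0 1).map (PowerSeries.C (R := S)) =
      B * T * B' := by
    have h1 : (scaleX A + (Matrix.fromBlocks 0 0 0 1).map (PowerSeries.C (R := S))) * B =
        B * T := by
      have h2 : scaleX A + (Matrix.fromBlocks 0 0 0 1).map (PowerSeries.C (R := S)) =
          Matrix.fromBlocks (scaleX A.toBlocks₁₁) (scaleX A.toBlocks₁₂) (scaleX A.toBlocks₂₁)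
            (scaleX A.toBlocks₂₂ + 1) := by
        conv_lhs => rw [← Matrix.fromBlocks_toBlocks A]
        rw [scaleX, Matrix.fromBlocks_map, Matrix.fromBlocks_map, Matrix.fromBlocks_add,
          Matrix.map_one _ (map_zero _) (map_one _), Matrix.map_zero _ (map_zero _),
          Matrix.map_zero _ (map_zero _), Matrix.map_zero _ (map_zero _), add_zero, add_zero,
          add_zero]
        rfl
      -- The lower left block of (zA + D)B = BT is the fixed point equation.
      have h3 : scaleX A.toBlocks₂₁ + (scaleX A.toBlocks₂₂ + 1) * Y =
          Y * (scaleX A.toBlocks₁₁ + scaleX A.toBlocks₁₂ * Y) := by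
        rw [Matrix.add_mul, Matrix.one_mul]
        conv_lhs => enter [2, 2]; rw [← hfix]
        rw [riccatiMap]
        abel
      rw [h2, hB, hT, hK, hD, Matrix.fromBlocks_multiply, Matrix.fromBlocks_multiply]
      simp only [Matrix.mul_one, Matrix.one_mul, Matrix.mul_zero, Matrix.zero_mul, add_zero,
        zero_add, h3]
      congr 1
      abel
    rw [← h1, mul_assoc, hBB', mul_one]
  rw [hAB, c_conj hTe hB'e hB'B hBB']
  exact ⟨_, _, (isCharFraction_upper K D (scaleX A.toBlocks₁₂)).isFraction⟩

end Riccati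

/-! ### Top coefficients of weighted power series. -/

section HasTop

variable {R : Type*} [Ring R]

/-- The power series `f` is a polynomial of degree at most `n` with coefficient `a` at `X ^ n`;
both vanish if `n` is negative. -/
def HasTop (n : ℤ) (f : PowerSeries R) (a : R) : Prop :=
  (∀ k : ℕ, n < k → PowerSeries.coeff k f = 0) ∧ (n < 0 → a = 0) ∧
    ∀ k : ℕ, n = k → PowerSeries.coeff k f = a

namespace HasTop

variable {m n : ℤ} {f g : PowerSeries R} {a b : R}

theorem zero (n : ℤ) : HasTop n (0 : PowerSeries R) 0 :=
  ⟨fun _ _ => by simp, fun _ => rfl, fun _ _ => by simp⟩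

theorem eq_zero (h : HasTop n f a) (hn : n < 0) : f = 0 ∧ a = 0 :=
  ⟨PowerSeries.ext fun k => by rw [h.1 k (by omega), map_zero], h.2.1 hn⟩

theorem top_eq_zero (h : HasTop n (0 : PowerSeries R) a) : a = 0 := by
  rcases lt_or_ge n 0 with hn | hn
  · exact h.2.1 hn
  · obtain ⟨k, rfl⟩ := Int.eq_ofNat_of_zero_le hn
    rw [← h.2.2 k rfl, map_zero]

theorem one : HasTop 0 (1 : PowerSeries R) 1 := by
  refine ⟨fun k hk => ?_, fun h => absurd h (lt_irrefl _), fun k hk => ?_⟩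
  · rw [PowerSeries.coeff_one, if_neg (by omega)]
  · rw [PowerSeries.coeff_one, if_pos (by omega)]

theorem add (hf : HasTop n f a) (hg : HasTop n g b) : HasTop n (f + g) (a + b) :=
  ⟨fun k hk => by rw [map_add, hf.1 k hk, hg.1 k hk, add_zero],
    fun hn => by rw [hf.2.1 hn, hg.2.1 hn, add_zero],
    fun k hk => by rw [map_add, hf.2.2 k hk, hg.2.2 k hk]⟩

theorem neg (hf : HasTop n f a) : HasTop n (-f) (-a) :=
  ⟨fun k hk => by rw [map_neg, hf.1 k hk, neg_zero],
    fun hn => by rw [hf.2.1 hn, neg_zero],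
    fun k hk => by rw [map_neg, hf.2.2 k hk]⟩

/-- A factor of negative weight is zero together with its top, so the weights may be added even when
one is negative. This matters for c_k with k < 0. -/
theorem mul (hf : HasTop m f a) (hg : HasTop n g b) : HasTop (m + n) (f * g) (a * b) := by
  rcases lt_or_ge m 0 with hm | hm
  · rw [(hf.eq_zero hm).1, (hf.eq_zero hm).2, zero_mul, zero_mul]
    exact zero _
  rcases lt_or_ge n 0 with hn | hn
  · rw [(hg.eq_zero hn).1, (hg.eq_zero hn).2, mul_zero, mul_zero]
    exact zero _
  obtain ⟨m, rfl⟩ := Int.eq_ofNat_of_zero_le hm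
  obtain ⟨n, rfl⟩ := Int.eq_ofNat_of_zero_le hn
  refine ⟨fun k hk => ?_, fun h => by omega, fun k hk => ?_⟩
  · rw [PowerSeries.coeff_mul]
    refine Finset.sum_eq_zero fun x hx => ?_
    have := Finset.HasAntidiagonal.mem_antidiagonal.mp hx
    rcases lt_or_ge m x.1 with h | h
    · rw [hf.1 _ (by omega), zero_mul]
    · rw [hg.1 _ (by omega), mul_zero]
  · rw [PowerSeries.coeff_mul, Finset.sum_eq_single (m, n), hf.2.2 m rfl, hg.2.2 n rfl]
    · intro x hx hne
      have := Finset.HasAntidiagonal.mem_antidiagonal.mp hx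
      rcases lt_trichotomy m x.1 with h | h | h
      · rw [hf.1 _ (by omega), zero_mul]
      · exact absurd (Prod.ext h.symm (by simp only; omega)) hne
      · rw [hg.1 _ (by omega), mul_zero]
    · intro h
      exact absurd (Finset.HasAntidiagonal.mem_antidiagonal.mpr (by simp only; omega)) h

theorem sum {ι : Type*} (s : Finset ι) {F : ι → PowerSeries R} {α : ι → R}
    (h : ∀ i ∈ s, HasTop n (F i) (α i)) : HasTop n (∑ i ∈ s, F i) (∑ i ∈ s, α i) := by
  classical
  induction s using Finset.induction_on with
  | empty => exact zero _
  | insert i s hi ih =>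
    rw [Finset.sum_insert hi, Finset.sum_insert hi]
    exact (h i (Finset.mem_insert_self _ _)).add
      (ih fun j hj => h j (Finset.mem_insert_of_mem hj))

theorem prod {R : Type*} [CommRing R] {ι : Type*} (s : Finset ι) {w : ι → ℤ}
    {F : ι → PowerSeries R} {α : ι → R} (h : ∀ i ∈ s, HasTop (w i) (F i) (α i)) :
    HasTop (∑ i ∈ s, w i) (∏ i ∈ s, F i) (∏ i ∈ s, α i) := by
  classical
  induction s using Finset.induction_on with
  | empty => exact one
  | insert i s hi ih =>
    rw [Finset.sum_insert hi, Finset.prod_insert hi, Finset.prod_insert hi]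
    exact (h i (Finset.mem_insert_self _ _)).mul
      (ih fun j hj => h j (Finset.mem_insert_of_mem hj))

/-- With entry weights of the form r_i + s_j, all terms of the Leibniz expansion have the same total
weight. -/
theorem det {R : Type*} [CommRing R] {ι : Type*} [Fintype ι] [DecidableEq ι] {r s : ι → ℤ}
    {F : Matrix ι ι (PowerSeries R)} {α : Matrix ι ι R}
    (h : ∀ i j, HasTop (r i + s j) (F i j) (α i j)) :
    HasTop (∑ i, (r i + s i)) F.det α.det := by
  rw [Matrix.det_apply, Matrix.det_apply]
  refine sum _ fun σ _ => ?_
  have h1 := prod Finset.univ fun i _ => h (σ i) i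
  rw [Finset.sum_add_distrib, Equiv.sum_comp σ r, ← Finset.sum_add_distrib] at h1
  rcases Int.units_eq_one_or (Equiv.Perm.sign σ) with hσ | hσ <;> rw [hσ]
  · simpa using h1
  · simpa using h1.neg

end HasTop

/-- Every letter of a monomial contributes zA + D, so only the product of the zA parts reaches z^n.
-/
theorem hasTop_liftEntries {I : Type*} (A D : Matrix I I R) {n : ℕ}
    {g : FreeAlgebra ℤ (I × I)} (hg : g ∈ homogeneousForms _ n) :
    HasTop n (liftEntries (scaleX A + D.map (PowerSeries.C (R := R))) g) (liftEntries A g) := by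
  induction hg using AddSubgroup.closure_induction with
  | mem x hx =>
    obtain ⟨l, rfl, rfl⟩ := hx
    induction l with
    | nil => simpa using HasTop.one
    | cons ij l ih =>
      rw [List.map_cons, List.prod_cons, map_mul, map_mul, List.length_cons]
      have h1 : HasTop 1 (liftEntries (scaleX A + D.map (PowerSeries.C (R := R)))
          (FreeAlgebra.ι ℤ ij)) (liftEntries A (FreeAlgebra.ι ℤ ij)) := by
        have h2 : liftEntries (scaleX A + D.map (PowerSeries.C (R := R)))
            (FreeAlgebra.ι ℤ ij) = PowerSeries.X * PowerSeries.C (A ij.1 ij.2) +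
              PowerSeries.C (D ij.1 ij.2) := by simp [liftEntries, scaleX]
        have h3 : liftEntries A (FreeAlgebra.ι ℤ ij) = A ij.1 ij.2 := by simp [liftEntries]
        rw [h2, h3]
        refine ⟨fun k hk => ?_, fun h => absurd h (by norm_num), fun k hk => ?_⟩
        · obtain ⟨k, rfl⟩ := Nat.exists_eq_add_of_lt (show 1 < k by omega)
          rw [map_add, show 1 + k + 1 = (k + 1) + 1 by ring, PowerSeries.coeff_succ_X_mul,
            PowerSeries.coeff_C, PowerSeries.coeff_C, if_neg (by omega), if_neg (by omega),
            add_zero]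
        · rw [show k = 0 + 1 by omega, map_add, PowerSeries.coeff_succ_X_mul,
            PowerSeries.coeff_C, PowerSeries.coeff_C, if_pos rfl, if_neg (by omega), add_zero]
      have h4 := h1.mul ih
      rw [add_comm] at h4
      exact_mod_cast h4
  | zero => simpa using HasTop.zero (n : ℤ)
  | add x y _ _ hx hy => rw [map_add, map_add]; exact hx.add hy
  | neg x _ hx => rw [map_neg, map_neg]; exact hx.neg

end HasTop

/-! ### Descent of the vanishing minors to an arbitrary even supermatrix. -/

section Vanishing

variable {S : Type*} [Ring S] {𝒮 : ZMod 2 → AddSubgroup S} [GradedRing 𝒮]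
  [IsSupercommutative 𝒮] {p q : ℕ}

theorem hasTop_c {A D : Matrix (Fin p ⊕ Fin q) (Fin p ⊕ Fin q) S}
    (hA : IsEvenMatrix 𝒮 A) (hD : IsEvenMatrix 𝒮 D) (k : ℤ) :
    HasTop k ((psEquiv 𝒮).symm
      (c (psGrading 𝒮) (scaleX A + D.map (PowerSeries.C (R := S))) k)) (c 𝒮 A k) := by
  rcases lt_or_ge k 0 with hk | hk
  · rw [c_of_neg _ hk, c_of_neg _ hk, map_zero]
    exact HasTop.zero k
  · obtain ⟨n, rfl⟩ := Int.eq_ofNat_of_zero_le hk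
    have h := hasTop_liftEntries A D (ncCharSeries_genericMatrix_mem (p := p) (q := q) n)
    rw [← coe_c_eq_liftEntries hA, ← coe_c_eq_liftEntries (hA.scaleX.add hD.map_C)] at h
    refine ⟨fun k hk => Subtype.ext ?_, fun h => by omega, fun k hk => Subtype.ext ?_⟩
    · rw [coeff_psEquiv_symm]
      exact h.1 k hk
    · rw [coeff_psEquiv_symm]
      exact h.2.2 k hk

/-- The minors of order `q + 1` of the infinite Hankel matrix of the expansion coefficients of
the characteristic function vanish. -/
theorem det_rows_c {A : Matrix (Fin p ⊕ Fin q) (Fin p ⊕ Fin q) S} (hA : IsEvenMatrix 𝒮 A)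
    (ρ : Fin (q + 1) → ℕ) :
    (Matrix.of fun i j : Fin (q + 1) => c 𝒮 A ((p : ℤ) - q + 1 + ρ i + j)).det = 0 := by
  have hD : IsEvenMatrix 𝒮 (Matrix.fromBlocks 0 0 0 1 :
      Matrix (Fin p ⊕ Fin q) (Fin p ⊕ Fin q) S) :=
    IsEvenMatrix.fromBlocks (fun _ _ => zero_mem _) (fun _ _ => zero_mem _)
      (fun _ _ => zero_mem _) IsHomogeneousMatrix.one
  obtain ⟨P, Q, h⟩ := exists_isFraction_scaleX_add hA
  have h1 := congrArg (psEquiv 𝒮).symm.toRingHom (h.det_rows ρ)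
  rw [RingHom.map_det, map_zero] at h1
  -- The index p-q+1+ρ_i+j of an entry is also its weight, and it splits into a row part and a
  -- column part. The minor for `A` is thus the top of a minor that is zero.
  have h2 := HasTop.det (r := fun i => (p : ℤ) - q + 1 + ρ i) (s := fun j : Fin (q + 1) => (j : ℤ))
    (F := (psEquiv 𝒮).symm.toRingHom.mapMatrix (Matrix.of fun i j : Fin (q + 1) =>
      c (psGrading 𝒮) (scaleX A + (Matrix.fromBlocks 0 0 0 1).map (PowerSeries.C (R := S)))
        ((p : ℤ) - q + 1 + ρ i + j)))
    (α := Matrix.of fun i j : Fin (q + 1) => c 𝒮 A ((p : ℤ) - q + 1 + ρ i + j))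
    fun i j => hasTop_c hA hD ((p : ℤ) - q + 1 + ρ i + j)
  rw [h1] at h2
  exact h2.top_eq_zero

theorem hankelDet_c_eq_zero {A : Matrix (Fin p ⊕ Fin q) (Fin p ⊕ Fin q) S}
    (hA : IsEvenMatrix 𝒮 A) : hankelDet (c 𝒮 A) ((p : ℤ) - q + 1) (q + 1) = 0 :=
  det_rows_c hA fun i => i

theorem existsUnique_isCharFraction {A : Matrix (Fin p ⊕ Fin q) (Fin p ⊕ Fin q) S}
    (hA : IsEvenMatrix 𝒮 A) (h : IsUnit (hankelDet (c 𝒮 A) ((p : ℤ) - q + 1) q)) :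
    ∃! PQ : (EvenPart 𝒮)[X] × (EvenPart 𝒮)[X], IsCharFraction 𝒮 A PQ.1 PQ.2 := by
  obtain ⟨P, Q, hPQ⟩ := exists_isFraction (fun _ => c_of_neg A) (det_rows_c hA) h
  refine ⟨(P, Q), ⟨?_, hPQ.coeff_zero_den, hPQ.natDegree_num, hPQ.natDegree_den, hPQ.mul_den⟩,
    fun PQ h' => ?_⟩
  · have := hPQ.sum_mul_coeff 0 (N := 1) (Or.inr (by simp))
    simpa [c_zero hA, hPQ.coeff_zero_den] using this.symm
  · obtain ⟨h1, h2⟩ := IsFraction.ext_of_isUnit h h'.isFraction hPQ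
    exact Prod.ext h1 h2

end Vanishing

theorem zmod_two_cases (i : ZMod 2) : i = 0 ∨ i = 1 := by
  revert i
  decide

/-! ## Adjoining a generator with square zero -/

section ParityInvolution

variable {S : Type*} [Ring S] (𝒮 : ZMod 2 → AddSubgroup S) [GradedRing 𝒮]

/-- The map `x₀ + x₁ ↦ x₀ - x₁`, additively. -/
def parityInvolutionAux : S →+ S where
  toFun x := DirectSum.decompose 𝒮 x 0 - DirectSum.decompose 𝒮 x 1
  map_zero' := by simp
  map_add' x y := by
    simp only [DirectSum.decompose_add, DirectSum.add_apply, AddSubgroup.coe_add]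
    abel

variable {𝒮} in
theorem parityInvolutionAux_apply {i : ZMod 2} {x : S} (hx : x ∈ 𝒮 i) :
    parityInvolutionAux 𝒮 x = (-1) ^ i.val * x := by
  have h : ∀ j, j ≠ i → (DirectSum.decompose 𝒮 x j : S) = 0 := fun j hj =>
    DirectSum.decompose_of_mem_ne 𝒮 hx hj.symm
  have h' : (DirectSum.decompose 𝒮 x i : S) = x := DirectSum.decompose_of_mem_same 𝒮 hx
  change (DirectSum.decompose 𝒮 x 0 - DirectSum.decompose 𝒮 x 1 : S) = _
  rcases zmod_two_cases i with rfl | rfl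
  · rw [h', h 1 (by decide)]
    simp
  · rw [h', h 0 (by decide)]
    simp [show ZMod.val (1 : ZMod 2) = 1 from rfl]

/-- The parity involution `x₀ + x₁ ↦ x₀ - x₁`. -/
def parityInvolution : S →+* S :=
  { parityInvolutionAux 𝒮 with
    map_one' := by
      have := parityInvolutionAux_apply (𝒮 := 𝒮) SetLike.GradedOne.one_mem
      simpa using this
    map_mul' := fun x y => by
      change parityInvolutionAux 𝒮 (x * y) = parityInvolutionAux 𝒮 x * parityInvolutionAux 𝒮 y
      induction x using DirectSum.Decomposition.inductionOn 𝒮 with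
      | zero => simp
      | add x x' hx hx' => rw [add_mul, map_add, map_add, hx, hx', add_mul]
      | @homogeneous i x =>
        induction y using DirectSum.Decomposition.inductionOn 𝒮 with
        | zero => simp
        | add y y' hy hy' => rw [mul_add, map_add, map_add, hy, hy', mul_add]
        | @homogeneous j y =>
          rw [parityInvolutionAux_apply x.2, parityInvolutionAux_apply y.2,
            parityInvolutionAux_apply (SetLike.GradedMul.mul_mem x.2 y.2)]
          rcases zmod_two_cases i with rfl | rfl <;> rcases zmod_two_cases j with rfl | rfl <;>
            simp [show ZMod.val (1 : ZMod 2) = 1 from rfl, show (1 + 1 : ZMod 2) = 0 from rfl] }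

/-- Power `e` of the parity involution. -/
def twist (e : ZMod 2) : S →+* S := if e = 0 then RingHom.id S else parityInvolution 𝒮

theorem twist_zero : twist 𝒮 0 = RingHom.id S := if_pos rfl

variable {𝒮} in
theorem twist_apply {e i : ZMod 2} {x : S} (hx : x ∈ 𝒮 i) :
    twist 𝒮 e x = (-1) ^ (e.val * i.val) * x := by
  rw [twist]
  split_ifs with he
  · simp [he]
  · have : e = 1 := by revert e; decide
    rw [this, show ZMod.val (1 : ZMod 2) = 1 from rfl, one_mul]
    exact parityInvolutionAux_apply hx

end ParityInvolution

/-- The ring `S ⊕ S θ`, where `θ` is a new generator of parity `e` with `θ² = 0`. -/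
@[ext]
structure DualExt {S : Type*} [Ring S] (𝒮 : ZMod 2 → AddSubgroup S) (e : ZMod 2) where
  /-- the coefficient of `1` -/
  re : S
  /-- the coefficient of `θ` -/
  im : S

namespace DualExt

variable {S : Type*} [Ring S] {𝒮 : ZMod 2 → AddSubgroup S} [GradedRing 𝒮] {e : ZMod 2}

instance : Zero (DualExt 𝒮 e) := ⟨⟨0, 0⟩⟩
instance : One (DualExt 𝒮 e) := ⟨⟨1, 0⟩⟩
instance : Add (DualExt 𝒮 e) := ⟨fun x y => ⟨x.re + y.re, x.im + y.im⟩⟩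
instance : Neg (DualExt 𝒮 e) := ⟨fun x => ⟨-x.re, -x.im⟩⟩
-- Elements are written a + bθ with θ on the right; moving θ past the homogeneous parts of c costs
-- the sign recorded by `twist`, and θ² = 0 removes the last term.
instance : Mul (DualExt 𝒮 e) :=
  ⟨fun x y => ⟨x.re * y.re, x.re * y.im + x.im * twist 𝒮 e y.re⟩⟩

@[simp] theorem zero_re : (0 : DualExt 𝒮 e).re = 0 := rfl
@[simp] theorem zero_im : (0 : DualExt 𝒮 e).im = 0 := rfl
@[simp] theorem one_re : (1 : DualExt 𝒮 e).re = 1 := rfl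
@[simp] theorem one_im : (1 : DualExt 𝒮 e).im = 0 := rfl
@[simp] theorem add_re (x y : DualExt 𝒮 e) : (x + y).re = x.re + y.re := rfl
@[simp] theorem add_im (x y : DualExt 𝒮 e) : (x + y).im = x.im + y.im := rfl
@[simp] theorem neg_re (x : DualExt 𝒮 e) : (-x).re = -x.re := rfl
@[simp] theorem neg_im (x : DualExt 𝒮 e) : (-x).im = -x.im := rfl
@[simp] theorem mul_re (x y : DualExt 𝒮 e) : (x * y).re = x.re * y.re := rfl
@[simp] theorem mul_im (x y : DualExt 𝒮 e) :
    (x * y).im = x.re * y.im + x.im * twist 𝒮 e y.re := rfl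

instance : Ring (DualExt 𝒮 e) where
  add_assoc x y z := by ext <;> simp [add_assoc]
  zero_add x := by ext <;> simp
  add_zero x := by ext <;> simp
  nsmul := nsmulRec
  zsmul := zsmulRec
  add_comm x y := by ext <;> simp [add_comm]
  neg_add_cancel x := by ext <;> simp
  mul_assoc x y z := by ext <;> simp [mul_assoc, mul_add, add_mul, add_assoc]
  one_mul x := by ext <;> simp
  mul_one x := by ext <;> simp
  zero_mul x := by ext <;> simp
  mul_zero x := by ext <;> simp
  left_distrib x y z := by
    ext
    · simp [mul_add]
    · simp only [add_re, add_im, mul_im, map_add, mul_add]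
      abel
  right_distrib x y z := by
    ext
    · simp [add_mul]
    · simp only [add_re, add_im, mul_im, add_mul]
      abel

variable (𝒮 e) in
/-- The projection to `S`. -/
def reHom : DualExt 𝒮 e →+* S where
  toFun := re
  map_zero' := rfl
  map_one' := rfl
  map_add' _ _ := rfl
  map_mul' _ _ := rfl

variable (𝒮 e) in
/-- The coefficient of `θ` as an additive map. -/
def imHom : DualExt 𝒮 e →+ S where
  toFun := im
  map_zero' := rfl
  map_add' _ _ := rfl

variable (𝒮 e) in
/-- The inclusion of `S`. -/
def inlHom : S →+* DualExt 𝒮 e where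
  toFun a := ⟨a, 0⟩
  map_zero' := rfl
  map_one' := rfl
  map_add' _ _ := by ext <;> simp
  map_mul' _ _ := by ext <;> simp

variable (𝒮 e) in
/-- The inclusion of `S θ`. -/
def inrHom : S →+ DualExt 𝒮 e where
  toFun a := ⟨0, a⟩
  map_zero' := rfl
  map_add' _ _ := by ext <;> simp

@[simp] theorem reHom_apply (x : DualExt 𝒮 e) : reHom 𝒮 e x = x.re := rfl
@[simp] theorem imHom_apply (x : DualExt 𝒮 e) : imHom 𝒮 e x = x.im := rfl
@[simp] theorem inlHom_re (a : S) : (inlHom 𝒮 e a).re = a := rfl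
@[simp] theorem inlHom_im (a : S) : (inlHom 𝒮 e a).im = 0 := rfl
@[simp] theorem inrHom_re (a : S) : (inrHom 𝒮 e a).re = 0 := rfl
@[simp] theorem inrHom_im (a : S) : (inrHom 𝒮 e a).im = a := rfl

theorem inlHom_mul_inrHom (a b : S) : inlHom 𝒮 e a * inrHom 𝒮 e b = inrHom 𝒮 e (a * b) := by
  ext <;> simp

theorem mul_eq_zero_of_re_eq_zero {x y : DualExt 𝒮 e} (hx : x.re = 0) (hy : y.re = 0) :
    x * y = 0 := by
  ext <;> simp [hx, hy]

variable (𝒮 e) in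
/-- The grading of `S ⊕ S θ`. -/
def grading (i : ZMod 2) : AddSubgroup (DualExt 𝒮 e) where
  carrier := {x | x.re ∈ 𝒮 i ∧ x.im ∈ 𝒮 (i + e)}
  zero_mem' := ⟨zero_mem _, zero_mem _⟩
  add_mem' hx hy := ⟨add_mem hx.1 hy.1, add_mem hx.2 hy.2⟩
  neg_mem' hx := ⟨neg_mem hx.1, neg_mem hx.2⟩

theorem neg_one_pow_mul_mem {i : ZMod 2} (n : ℕ) {x : S} (hx : x ∈ 𝒮 i) :
    (-1) ^ n * x ∈ 𝒮 i := by
  rcases neg_one_pow_eq_or S n with h | h <;> rw [h]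
  · rwa [one_mul]
  · rw [neg_one_mul]
    exact neg_mem hx

instance : SetLike.GradedMonoid (grading 𝒮 e) where
  one_mem := ⟨SetLike.GradedOne.one_mem, zero_mem _⟩
  mul_mem i j x y hx hy := by
    refine ⟨SetLike.GradedMul.mul_mem hx.1 hy.1, add_mem ?_ ?_⟩
    · rw [add_assoc]
      exact SetLike.GradedMul.mul_mem hx.1 hy.2
    · rw [twist_apply hy.1, add_right_comm]
      exact SetLike.GradedMul.mul_mem hx.2 (neg_one_pow_mul_mem _ hy.1)

/-- The homogeneous components of an element of `S ⊕ S θ`. -/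
def component (i : ZMod 2) : DualExt 𝒮 e →+ grading 𝒮 e i where
  toFun x := ⟨⟨DirectSum.decompose 𝒮 x.re i, DirectSum.decompose 𝒮 x.im (i + e)⟩,
    SetLike.coe_mem _, SetLike.coe_mem _⟩
  map_zero' := by ext <;> simp
  map_add' x y := by ext <;> simp

theorem sum_decompose (x : S) : ∑ i : ZMod 2, (DirectSum.decompose 𝒮 x i : S) = x := by
  classical
  conv_rhs => rw [← DirectSum.sum_support_decompose 𝒮 x]
  symm
  refine Finset.sum_subset (Finset.subset_univ _) fun i _ hi => ?_
  simpa using hi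

instance : GradedRing (grading 𝒮 e) where
  toDecomposition := DirectSum.Decomposition.ofAddHom (grading 𝒮 e)
    (∑ i : ZMod 2, (DirectSum.of (fun i => grading 𝒮 e i) i).comp (component i))
    (by
      refine AddMonoidHom.ext fun x => ?_
      simp only [AddMonoidHom.comp_apply, AddMonoidHom.finsetSum_apply, map_sum,
        DirectSum.coeAddMonoidHom_of, AddMonoidHom.id_apply]
      ext
      · rw [← reHom_apply, map_sum]
        exact sum_decompose x.re
      · rw [← imHom_apply, map_sum]
        exact (Equiv.sum_comp (Equiv.addRight e)
          fun i => (DirectSum.decompose 𝒮 x.im i : S)).trans (sum_decompose x.im))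
    (by
      refine DirectSum.addHom_ext fun i x => ?_
      simp only [AddMonoidHom.comp_apply, AddMonoidHom.finsetSum_apply,
        DirectSum.coeAddMonoidHom_of, AddMonoidHom.id_apply]
      rw [Finset.sum_eq_single i]
      · congr 1
        refine Subtype.ext (DualExt.ext ?_ ?_)
        · exact DirectSum.decompose_of_mem_same 𝒮 x.2.1
        · exact DirectSum.decompose_of_mem_same 𝒮 x.2.2
      · intro j _ hj
        have : component j (x : DualExt 𝒮 e) = 0 := by
          refine Subtype.ext (DualExt.ext ?_ ?_)
          · exact DirectSum.decompose_of_mem_ne 𝒮 x.2.1 hj.symm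
          · exact DirectSum.decompose_of_mem_ne 𝒮 x.2.2 fun h => hj.symm (add_right_cancel h)
        rw [this, map_zero]
      · simp)

theorem neg_one_pow_re (n : ℕ) (x : DualExt 𝒮 e) : ((-1) ^ n * x).re = (-1) ^ n * x.re := by
  rcases Nat.even_or_odd n with h | h <;> simp [h.neg_one_pow]

theorem neg_one_pow_im (n : ℕ) (x : DualExt 𝒮 e) : ((-1) ^ n * x).im = (-1) ^ n * x.im := by
  rcases Nat.even_or_odd n with h | h <;> simp [h.neg_one_pow]

instance [IsSupercommutative 𝒮] : IsSupercommutative (grading 𝒮 e) where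
  mul_comm' {i j x y} hx hy := by
    have h1 := IsSupercommutative.mul_comm' hx.1 hy.1
    have h2 := IsSupercommutative.mul_comm' hx.1 hy.2
    have h3 := IsSupercommutative.mul_comm' hx.2 hy.1
    ext
    · rw [neg_one_pow_re]
      exact h1
    · rw [neg_one_pow_im, mul_im, mul_im, twist_apply hx.1, twist_apply hy.1]
      clear h1
      have e1 : ZMod.val (1 : ZMod 2) = 1 := rfl
      have e2 : (1 + 1 : ZMod 2) = 0 := rfl
      rcases zmod_two_cases i with rfl | rfl <;> rcases zmod_two_cases j with rfl | rfl <;>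
        rcases zmod_two_cases e with rfl | rfl <;>
        simp [e1, e2] at h2 h3 ⊢ <;> rw [h2, h3] <;> abel
  odd_mul_self {x} hx := by
    have h1 := IsSupercommutative.odd_mul_self hx.1
    have h2 := IsSupercommutative.mul_comm' hx.1 hx.2
    ext
    · exact h1
    · rw [mul_im, twist_apply hx.1]
      have e1 : ZMod.val (1 : ZMod 2) = 1 := rfl
      have e2 : (1 + 1 : ZMod 2) = 0 := rfl
      rcases zmod_two_cases e with rfl | rfl <;> simp [e1, e2] at h2 ⊢ <;> rw [h2] <;> abel

end DualExt

/-! ## The derivative of the characteristic function -/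

/-- The exact Taylor formula for the generic determinant at the identity matrix, whose adjugate is
the identity. -/
theorem det_one_add_of_mul_eq_zero {R : Type*} [CommRing R] {n : Type*} [Fintype n]
    [DecidableEq n] {W : Matrix n n R} (h : ∀ i j k l, W i j * W k l = 0) :
    (1 + W).det = 1 + W.trace := by
  have key := aeval_add_of_mul_eq_zero (fun ij : n × n => (1 : Matrix n n R) ij.1 ij.2)
    (fun ij => W ij.1 ij.2) (fun _ _ => h _ _ _ _) Finset.univ (by simp)
    (Matrix.mvPolynomialX n n ℤ).det
  have hdet : ∀ x : n × n → R, MvPolynomial.aeval x (Matrix.mvPolynomialX n n ℤ).det =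
      (Matrix.of fun i j => x (i, j)).det := fun x => by
    refine ((MvPolynomial.aeval (R := ℤ) x).toRingHom.map_det _).trans (congrArg _ ?_)
    ext i j
    simp [Matrix.mvPolynomialX]
  have hadj : ∀ i j, MvPolynomial.aeval (fun ij : n × n => (1 : Matrix n n R) ij.1 ij.2)
      ((Matrix.mvPolynomialX n n ℤ).adjugate i j) = (1 : Matrix n n R) i j := fun i j => by
    have := congrFun (congrFun ((MvPolynomial.aeval (R := ℤ) fun ij : n × n =>
      (1 : Matrix n n R) ij.1 ij.2).toRingHom.map_adjugate (Matrix.mvPolynomialX n n ℤ)) i) j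
    refine this.trans ?_
    rw [← Matrix.adjugate_one (n := n) (α := R)]
    congr 2
    ext i j
    simp [Matrix.mvPolynomialX]
  rw [hdet, hdet] at key
  refine key.trans ?_
  congr 1
  · exact Matrix.det_one
  · rw [Fintype.sum_prod_type, Matrix.trace]
    refine Finset.sum_congr rfl fun a _ => ?_
    have : ∀ b, MvPolynomial.aeval (fun ij : n × n => (1 : Matrix n n R) ij.1 ij.2)
        (MvPolynomial.pderiv (a, b) (Matrix.mvPolynomialX n n ℤ).det) = (1 : Matrix n n R) b a := by
      intro b
      rw [derivation_det, map_sum, Finset.sum_eq_single a, map_sum, Finset.sum_eq_single b]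
      · rw [← hadj, map_mul, Matrix.mvPolynomialX_apply, MvPolynomial.pderiv_X_self, map_one, mul_one]
      · intro j _ hj
        simp [Matrix.mvPolynomialX, hj.symm]
      · simp
      · intro i _ hi
        rw [map_sum]
        exact Finset.sum_eq_zero fun j _ => by simp [Matrix.mvPolynomialX, hi.symm]
      · simp
    simp_rw [this, Matrix.one_apply]
    simp

/-! ### The supertrace and the linearized Berezinian. -/

section Supertrace

variable {S : Type*} [Ring S] {p q : ℕ}

/-- The supertrace of a matrix, for the format of even matrices. -/
def supertrace : Matrix (Fin p ⊕ Fin q) (Fin p ⊕ Fin q) S →ₗ[S] S where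
  toFun M := ∑ i, M (Sum.inl i) (Sum.inl i) - ∑ α, M (Sum.inr α) (Sum.inr α)
  map_add' M N := by
    simp only [Matrix.add_apply, Finset.sum_add_distrib]
    abel
  map_smul' s M := by
    simp only [Matrix.smul_apply, smul_eq_mul, RingHom.id_apply, mul_sub, Finset.mul_sum]

theorem supertrace_apply (M : Matrix (Fin p ⊕ Fin q) (Fin p ⊕ Fin q) S) :
    supertrace M = ∑ i, M (Sum.inl i) (Sum.inl i) - ∑ α, M (Sum.inr α) (Sum.inr α) := rfl

theorem supertrace_map {S' : Type*} [Ring S'] (f : S →+ S')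
    (M : Matrix (Fin p ⊕ Fin q) (Fin p ⊕ Fin q) S) : supertrace (M.map f) = f (supertrace M) := by
  simp [supertrace_apply]

/-- Multiplication by a matrix unit moves the chosen entry onto the diagonal; the supertrace returns
it up to sign. -/
theorem eq_zero_of_supertrace_mul_single {M : Matrix (Fin p ⊕ Fin q) (Fin p ⊕ Fin q) S}
    {i j : Fin p ⊕ Fin q} (h : supertrace (M * Matrix.single j i 1) = 0) : M i j = 0 := by
  have key : ∀ a, (M * Matrix.single j i (1 : S)) a a = if a = i then M i j else 0 := by
    intro a
    split_ifs with ha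
    · subst ha
      simp
    · exact Matrix.mul_single_apply_of_ne _ _ _ _ _ ha _
  rw [supertrace_apply] at h
  simp only [key] at h
  rcases i with i | i
  · simpa using h
  · simpa using h

variable {𝒮 : ZMod 2 → AddSubgroup S} [GradedRing 𝒮] [IsSupercommutative 𝒮]

/-- As all products of two entries vanish, the Schur correction disappears and both determinants
become linear, leaving (1 + tr W₁₁)(1 - tr W₂₂). -/
theorem berezinian_one_add_of_mul_eq_zero {W : Matrix (Fin p ⊕ Fin q) (Fin p ⊕ Fin q) S}
    (hW : IsEvenMatrix 𝒮 W) (h : ∀ i j k l, W i j * W k l = 0) :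
    IsUnit (evenDet 𝒮 (1 + W).toBlocks₂₂) ∧ (berezinian 𝒮 (1 + W) : S) = 1 + supertrace W := by
  obtain ⟨w₁, hw₁⟩ : ∃ w : Matrix (Fin p) (Fin p) (EvenPart 𝒮), w.map Subtype.val = W.toBlocks₁₁ :=
    ⟨_, hW.toBlocks₁₁.map_evenProj⟩
  obtain ⟨w₂, hw₂⟩ : ∃ w : Matrix (Fin q) (Fin q) (EvenPart 𝒮), w.map Subtype.val = W.toBlocks₂₂ :=
    ⟨_, hW.toBlocks₂₂.map_evenProj⟩
  have e₁ : ∀ i j, (w₁ i j : S) = W (Sum.inl i) (Sum.inl j) := fun i j =>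
    congrFun (congrFun hw₁ i) j
  have e₂ : ∀ i j, (w₂ i j : S) = W (Sum.inr i) (Sum.inr j) := fun i j =>
    congrFun (congrFun hw₂ i) j
  have h₁ : ∀ i j k l, w₁ i j * w₁ k l = 0 := fun i j k l => Subtype.ext (by
    rw [Subring.coe_mul, e₁, e₁, h]
    rfl)
  have h₂ : ∀ i j k l, w₂ i j * w₂ k l = 0 := fun i j k l => Subtype.ext (by
    rw [Subring.coe_mul, e₂, e₂, h]
    rfl)
  have h₁₂ : ∀ i j k l, w₁ i j * w₂ k l = 0 := fun i j k l => Subtype.ext (by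
    rw [Subring.coe_mul, e₁, e₂, h]
    rfl)
  have hb₂ : (1 + W).toBlocks₂₂ = (1 + w₂).map Subtype.val := by
    ext i j
    simp [Matrix.toBlocks₂₂, e₂, Matrix.one_apply, apply_ite]
  have hb₁ : (1 + W).toBlocks₁₁ = (1 + w₁).map Subtype.val := by
    ext i j
    simp [Matrix.toBlocks₁₁, e₁, Matrix.one_apply, apply_ite]
  have hd₁ := det_one_add_of_mul_eq_zero h₁
  have hd₂ := det_one_add_of_mul_eq_zero h₂
  have ht₂ : w₂.trace * w₂.trace = 0 := by
    rw [Matrix.trace, Finset.sum_mul_sum]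
    exact Finset.sum_eq_zero fun i _ => Finset.sum_eq_zero fun j _ => h₂ _ _ _ _
  have ht₁₂ : w₁.trace * w₂.trace = 0 := by
    rw [Matrix.trace, Matrix.trace, Finset.sum_mul_sum]
    exact Finset.sum_eq_zero fun i _ => Finset.sum_eq_zero fun j _ => h₁₂ _ _ _ _
  have hinv : (1 + w₂).det * (1 - w₂.trace) = 1 := by
    rw [hd₂]
    linear_combination -ht₂
  have hu : IsUnit (1 + w₂).det := IsUnit.of_mul_eq_one _ hinv
  refine ⟨by rwa [hb₂, evenDet_map_coe], ?_⟩
  have hmid : (1 + W).toBlocks₁₂ * (1 + w₂)⁻¹.map Subtype.val * (1 + W).toBlocks₂₁ = 0 := by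
    ext i j
    rw [Matrix.mul_apply]
    refine Finset.sum_eq_zero fun b _ => ?_
    rw [Matrix.mul_apply, Finset.sum_mul]
    refine Finset.sum_eq_zero fun a _ => ?_
    simp only [Matrix.toBlocks₁₂, Matrix.toBlocks₂₁, Matrix.of_apply, Matrix.add_apply,
      Matrix.map_apply]
    rw [Matrix.one_apply_ne (by simp), Matrix.one_apply_ne (by simp), zero_add, zero_add,
      ← even_comm 𝒮 ((1 + w₂)⁻¹ a b).2, mul_assoc, h, mul_zero]
  have hber : berezinian 𝒮 (1 + W) = (1 + w₁).det * Ring.inverse (1 + w₂).det := by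
    rw [berezinian]
    simp only [hb₂, hb₁, map_coe_map_evenProj, hmid, sub_zero]
  have hinv' : Ring.inverse (1 + w₂).det = 1 - w₂.trace := by
    rw [← Ring.inverse_mul_cancel_left _ (1 - w₂.trace) hu, hinv, mul_one]
  rw [hber, hinv', hd₁, show (1 + w₁.trace) * (1 - w₂.trace) = 1 + (w₁.trace - w₂.trace) by
    linear_combination -ht₁₂]
  simp [supertrace_apply, Matrix.trace, e₁, e₂]

theorem IsEvenMatrix.geomMatrix {A : Matrix (Fin p ⊕ Fin q) (Fin p ⊕ Fin q) S}
    (hA : IsEvenMatrix 𝒮 A) : IsEvenMatrix (psGrading 𝒮) (SuperCH.geomMatrix A) := fun i j k => by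
  have hneg : IsEvenMatrix 𝒮 (-A) := fun i j => neg_mem (hA i j)
  simpa [SuperCH.geomMatrix] using hneg.pow k i j

end Supertrace

theorem coeff_succ_mul_X_mul_C {R : Type*} [Ring R] (f : PowerSeries R) (a : R) (n : ℕ) :
    PowerSeries.coeff (n + 1) (f * (PowerSeries.X * PowerSeries.C a)) =
      PowerSeries.coeff n f * a := by
  rw [← mul_assoc, PowerSeries.coeff_mul_C, PowerSeries.coeff_succ_mul_X]

theorem coeff_zero_mul_X_mul_C {R : Type*} [Ring R] (f : PowerSeries R) (a : R) :
    PowerSeries.coeff 0 (f * (PowerSeries.X * PowerSeries.C a)) = 0 := by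
  rw [← mul_assoc, PowerSeries.coeff_mul_C, PowerSeries.coeff_zero_mul_X, zero_mul]

theorem coeff_succ_geomMatrix_mul_scaleX {R : Type*} [Ring R] {ι : Type*} [Fintype ι]
    [DecidableEq ι] (A N : Matrix ι ι R) (i j : ι) (n : ℕ) :
    PowerSeries.coeff (n + 1) ((geomMatrix A * scaleX N) i j) = ((-A) ^ n * N) i j := by
  simp only [Matrix.mul_apply, map_sum, scaleX, Matrix.map_apply,
    coeff_succ_mul_X_mul_C]
  simp [geomMatrix]

theorem coeff_zero_geomMatrix_mul_scaleX {R : Type*} [Ring R] {ι : Type*} [Fintype ι]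
    [DecidableEq ι] (A N : Matrix ι ι R) (i j : ι) :
    PowerSeries.coeff 0 ((geomMatrix A * scaleX N) i j) = 0 := by
  simp only [Matrix.mul_apply, map_sum, scaleX, Matrix.map_apply,
    coeff_zero_mul_X_mul_C, Finset.sum_const_zero]

/-! ### First variation of the characteristic function and the Cayley–Hamilton identity. -/

section Derivative

variable {S : Type*} [Ring S] {𝒮 : ZMod 2 → AddSubgroup S} [GradedRing 𝒮] {p q : ℕ}

variable (𝒮) in
/-- The matrix `A + N θ` over `S ⊕ S θ`. -/
def perturb (e : ZMod 2) (A N : Matrix (Fin p ⊕ Fin q) (Fin p ⊕ Fin q) S) :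
    Matrix (Fin p ⊕ Fin q) (Fin p ⊕ Fin q) (DualExt 𝒮 e) :=
  A.map (DualExt.inlHom 𝒮 e) + N.map (DualExt.inrHom 𝒮 e)

variable {e : ZMod 2} {A N : Matrix (Fin p ⊕ Fin q) (Fin p ⊕ Fin q) S}

theorem DualExt.inlHom_mem {i : ZMod 2} {a : S} (ha : a ∈ 𝒮 i) :
    DualExt.inlHom 𝒮 e a ∈ DualExt.grading 𝒮 e i := ⟨ha, zero_mem _⟩

theorem DualExt.inrHom_mem {i : ZMod 2} {a : S} (ha : a ∈ 𝒮 (i + e)) :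
    DualExt.inrHom 𝒮 e a ∈ DualExt.grading 𝒮 e i := ⟨zero_mem _, ha⟩

theorem IsEvenMatrix.map_inlHom (hA : IsEvenMatrix 𝒮 A) :
    IsEvenMatrix (DualExt.grading 𝒮 e) (A.map (DualExt.inlHom 𝒮 e)) :=
  fun i j => DualExt.inlHom_mem (hA i j)

theorem IsEvenMatrix.perturb (hA : IsEvenMatrix 𝒮 A)
    (hN : ∀ i j, N i j ∈ 𝒮 (parity i + parity j + e)) :
    IsEvenMatrix (DualExt.grading 𝒮 e) (perturb 𝒮 e A N) :=
  hA.map_inlHom.add fun i j => DualExt.inrHom_mem (hN i j)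

variable [IsSupercommutative 𝒮]

/-- The factorization 1 + z(A + Nθ) = (1 + zA)(1 + W) with W = (1 + zA)⁻¹ zNθ reduces to
multiplicativity and the linearized Berezinian, since all entries of `W` are multiples of θ. The
parity condition on `N` makes Nθ even. -/
theorem coe_charFun_perturb (hA : IsEvenMatrix 𝒮 A)
    (hN : ∀ i j, N i j ∈ 𝒮 (parity i + parity j + e)) :
    (charFun (DualExt.grading 𝒮 e) (perturb 𝒮 e A N) : PowerSeries (DualExt 𝒮 e)) =
      charFun (DualExt.grading 𝒮 e) (A.map (DualExt.inlHom 𝒮 e)) *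
        (1 + supertrace (geomMatrix (A.map (DualExt.inlHom 𝒮 e)) *
          scaleX (N.map (DualExt.inrHom 𝒮 e)))) := by
  set A' := A.map (DualExt.inlHom 𝒮 e)
  set N' := N.map (DualExt.inrHom 𝒮 e)
  set W := geomMatrix A' * scaleX N' with hW
  have hA' : IsEvenMatrix (DualExt.grading 𝒮 e) A' := hA.map_inlHom
  have hN' : IsEvenMatrix (DualExt.grading 𝒮 e) N' := fun i j => DualExt.inrHom_mem (hN i j)
  have hWe : IsEvenMatrix (psGrading (DualExt.grading 𝒮 e)) W := hA'.geomMatrix.mul hN'.scaleX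
  have hre : ∀ i j k, (PowerSeries.coeff k (W i j)).re = 0 := by
    intro i j k
    cases k with
    | zero => rw [hW, coeff_zero_geomMatrix_mul_scaleX]; rfl
    | succ k =>
      rw [hW, coeff_succ_geomMatrix_mul_scaleX, Matrix.mul_apply, ← DualExt.reHom_apply, map_sum]
      exact Finset.sum_eq_zero fun a _ => by simp [N']
  have h0 : ∀ i j k l, W i j * W k l = 0 := by
    intro i j k l
    ext1 n
    rw [PowerSeries.coeff_mul, map_zero]
    exact Finset.sum_eq_zero fun x _ => DualExt.mul_eq_zero_of_re_eq_zero (hre _ _ _) (hre _ _ _)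
  have hfac : 1 + scaleX (perturb 𝒮 e A N) = (1 + scaleX A') * (1 + W) := by
    have hadd : scaleX (perturb 𝒮 e A N) = scaleX A' + scaleX N' := by
      ext1 i j
      simp [scaleX, perturb, mul_add, A', N']
    rw [mul_add, mul_one, hW, ← mul_assoc, one_add_scaleX_mul_geomMatrix, one_mul, hadd, add_assoc]
  obtain ⟨hu, hber⟩ := berezinian_one_add_of_mul_eq_zero hWe h0
  rw [charFun_eq, charFun_eq, hfac,
    berezinian_mul hA'.one_add_scaleX hA'.isUnit_one_add_scaleX (IsEvenMatrix.one.add hWe) hu,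
    Subring.coe_mul, hber]

theorem c_map_inlHom (hA : IsEvenMatrix 𝒮 A) (k : ℤ) :
    (c (DualExt.grading 𝒮 e) (A.map (DualExt.inlHom 𝒮 e)) k : DualExt 𝒮 e) =
      DualExt.inlHom 𝒮 e (c 𝒮 A k : S) :=
  c_map _ hA hA.map_inlHom k

theorem coeff_supertrace_geomMatrix_mul_scaleX (n : ℕ) :
    PowerSeries.coeff (n + 1) (supertrace (geomMatrix (A.map (DualExt.inlHom 𝒮 e)) *
          scaleX (N.map (DualExt.inrHom 𝒮 e)))) =
      DualExt.inrHom 𝒮 e (supertrace ((-A) ^ n * N)) := by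
  have : (-A.map (DualExt.inlHom 𝒮 e)) ^ n * N.map (DualExt.inrHom 𝒮 e) =
      ((-A) ^ n * N).map (DualExt.inrHom 𝒮 e) := by
    have h1 : (-A.map (DualExt.inlHom 𝒮 e)) ^ n = ((-A) ^ n).map (DualExt.inlHom 𝒮 e) := by
      have := map_pow (DualExt.inlHom 𝒮 e).mapMatrix (-A) n
      rw [map_neg] at this
      exact this.symm
    rw [h1]
    ext1 i j
    simp only [Matrix.mul_apply, Matrix.map_apply, map_sum, DualExt.inlHom_mul_inrHom]
  rw [← supertrace_map, ← this, supertrace_apply, supertrace_apply]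
  simp only [map_sub, map_sum, coeff_succ_geomMatrix_mul_scaleX]

theorem c_perturb_natCast (hA : IsEvenMatrix 𝒮 A)
    (hN : ∀ i j, N i j ∈ 𝒮 (parity i + parity j + e)) (n : ℕ) :
    (c (DualExt.grading 𝒮 e) (perturb 𝒮 e A N) (n + 1 : ℕ) : DualExt 𝒮 e) =
      DualExt.inlHom 𝒮 e (c 𝒮 A (n + 1 : ℕ) : S) +
        DualExt.inrHom 𝒮 e (∑ x ∈ Finset.HasAntidiagonal.antidiagonal n,
          (c 𝒮 A x.1 : S) * supertrace ((-A) ^ x.2 * N)) := by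
  rw [coe_c_natCast, coe_charFun_perturb hA hN, mul_add, mul_one, map_add, ← coe_c_natCast,
    c_map_inlHom hA, PowerSeries.coeff_mul, Finset.Nat.sum_antidiagonal_succ']
  congr 1
  have h0 : PowerSeries.coeff 0 (supertrace (geomMatrix (A.map (DualExt.inlHom 𝒮 e)) *
          scaleX (N.map (DualExt.inrHom 𝒮 e)))) = 0 := by
    rw [supertrace_apply]
    simp only [map_sub, map_sum, coeff_zero_geomMatrix_mul_scaleX]
    simp
  simp only [h0, mul_zero, zero_add, coeff_supertrace_geomMatrix_mul_scaleX, map_sum]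
  refine Finset.sum_congr rfl fun x _ => ?_
  rw [← coe_c_natCast, c_map_inlHom hA, DualExt.inlHom_mul_inrHom]

theorem signedCHPoly_natCast {R : Type*} [CommRing R] (x : ℤ → R) (n : ℕ) :
    signedCHPoly x n = ∑ k ∈ Finset.HasAntidiagonal.antidiagonal n, C (x k.1) * (-X) ^ k.2 := by
  rw [signedCHPoly_eq, Finset.Nat.sum_antidiagonal_eq_sum_range_succ
    (fun i j => C (x i) * (-X) ^ j)]
  symm
  refine Finset.sum_bij (fun i _ => (i : ℤ)) ?_ ?_ ?_ ?_
  · intro i hi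
    simp only [Finset.mem_range] at hi
    simp only [Finset.mem_Icc]
    omega
  · intro i _ j _ h
    exact_mod_cast h
  · intro k hk
    simp only [Finset.mem_Icc] at hk
    exact ⟨k.toNat, by simp only [Finset.mem_range]; omega, by omega⟩
  · intro i hi
    simp only [Finset.mem_range] at hi
    rw [show ((n : ℤ) - i).toNat = n - i by omega]

theorem evenPart_smul_matrix (a : EvenPart 𝒮) (M : Matrix (Fin p ⊕ Fin q) (Fin p ⊕ Fin q) S) :
    a • M = (a : S) • M := rfl

theorem supertrace_smul_mul (a : EvenPart 𝒮) (M N : Matrix (Fin p ⊕ Fin q) (Fin p ⊕ Fin q) S) :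
    supertrace (a • M * N) = (a : S) * supertrace (M * N) := by
  rw [smul_mul_assoc, evenPart_smul_matrix, map_smul, smul_eq_mul]

/-- The variation of R_A is R_A(z) str((1+zA)⁻¹ zN). Its coefficient of z^{r+1} is a convolution of
the c_k with the powers of -A, which is (-1)^r H_r evaluated at `A`. For r = -1 the formula says
that c_0 = 1 does not vary. -/
theorem c_perturb (hA : IsEvenMatrix 𝒮 A)
    (hN : ∀ i j, N i j ∈ 𝒮 (parity i + parity j + e)) (r : ℤ) :
    (c (DualExt.grading 𝒮 e) (perturb 𝒮 e A N) (r + 1) : DualExt 𝒮 e) =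
      DualExt.inlHom 𝒮 e (c 𝒮 A (r + 1) : S) +
        DualExt.inrHom 𝒮 e (supertrace (aeval A (signedCHPoly (c 𝒮 A) r) * N)) := by
  rcases lt_or_ge r 0 with hr | hr
  · rw [signedCHPoly_of_neg _ hr, map_zero, zero_mul, map_zero, map_zero, add_zero]
    rcases lt_or_ge (r + 1) 0 with hr' | hr'
    · rw [c_of_neg _ hr', c_of_neg _ hr']
      rfl
    · rw [show r + 1 = 0 by omega, c_zero hA, c_zero (hA.perturb hN)]
      rfl
  · obtain ⟨n, rfl⟩ := Int.eq_ofNat_of_zero_le hr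
    refine (c_perturb_natCast hA hN n).trans ?_
    rw [signedCHPoly_natCast, map_sum (aeval A), Finset.sum_mul, map_sum supertrace]
    congr 2
    refine Finset.sum_congr rfl fun x _ => ?_
    rw [map_mul (aeval A), aeval_C, map_pow, map_neg, aeval_X, ← Algebra.smul_def, supertrace_smul_mul]

theorem twist_coe (a : EvenPart 𝒮) : twist 𝒮 e (a : S) = a := by
  simpa using twist_apply (e := e) a.2

variable (𝒮 e) in
/-- The inclusion of the even part of `S` in that of `S ⊕ S θ`. -/
def inlEven : EvenPart 𝒮 →+* EvenPart (DualExt.grading 𝒮 e) :=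
  ((DualExt.inlHom 𝒮 e).comp (EvenPart 𝒮).subtype).codRestrict (EvenPart (DualExt.grading 𝒮 e))
    fun a => DualExt.inlHom_mem a.2

theorem coe_inlEven (a : EvenPart 𝒮) :
    (inlEven 𝒮 e a : DualExt 𝒮 e) = DualExt.inlHom 𝒮 e (a : S) := rfl

theorem modifiedPoly_eq_sum_signedCHPoly {R : Type*} [CommRing R] (p q : ℕ) (x : ℤ → R) :
    modifiedPoly p q x = ∑ r ∈ Finset.Icc ((p : ℤ) - q) (p + q),
      C (MvPolynomial.aeval x (hankelPartial p q (r + 1))) * signedCHPoly x r := by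
  rw [modifiedPoly]
  refine Finset.sum_congr rfl fun r _ => ?_
  rw [signedCHPoly, map_mul]
  ring

/-- The Hankel determinant of order q+1 vanishes for `A` and for A + Nθ, so its differential along
the variation of the c_k is zero. With the variations from `c_perturb` this differential is ∑
F_{r+1} str((-1)^r H_r(A) N). -/
theorem supertrace_aeval_modifiedCharPoly_mul (hA : IsEvenMatrix 𝒮 A)
    (hN : ∀ i j, N i j ∈ 𝒮 (parity i + parity j + e)) :
    supertrace (aeval A (modifiedCharPoly 𝒮 A) * N) = 0 := by
  set x : ℤ → EvenPart (DualExt.grading 𝒮 e) := fun r => inlEven 𝒮 e (c 𝒮 A r) with hx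
  -- These are the indices of the c_k occurring in the determinant. The increment `y` is cut off
  -- outside them to make the Taylor sum finite, which the determinant does not notice.
  set s := Finset.Icc ((p : ℤ) - q + 1) (p + q + 1) with hs
  set y : ℤ → EvenPart (DualExt.grading 𝒮 e) := fun r =>
    if r ∈ s then c (DualExt.grading 𝒮 e) (perturb 𝒮 e A N) r - x r else 0 with hy
  have hyr : ∀ r ∈ s, (y r : DualExt 𝒮 e) =
      DualExt.inrHom 𝒮 e (supertrace (aeval A (signedCHPoly (c 𝒮 A) (r - 1)) * N)) := by
    intro r hr
    have := c_perturb hA hN (r - 1)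
    rw [sub_add_cancel] at this
    simp only [hy, if_pos hr, AddSubgroupClass.coe_sub, this, hx, coe_inlEven,
      add_sub_cancel_left]
  have hy0 : ∀ r, (y r : DualExt 𝒮 e).re = 0 := by
    intro r
    by_cases hr : r ∈ s
    · rw [hyr r hr]
      rfl
    · simp only [hy, if_neg hr]
      rfl
  have key := aeval_add_of_mul_eq_zero x y
    (fun i j => Subtype.ext (DualExt.mul_eq_zero_of_re_eq_zero (hy0 i) (hy0 j)))
    s (fun r hr => by simp only [hy, if_neg hr])
    (hankelDet (MvPolynomial.X : ℤ → MvPolynomial ℤ ℤ) (p - q + 1) (q + 1))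
  have h1 : hankelDet (x + y) ((p : ℤ) - q + 1) (q + 1) = 0 := by
    rw [← hankelDet_c_eq_zero (hA.perturb hN)]
    refine hankelDet_congr fun i j => ?_
    have : (p : ℤ) - q + 1 + i + j ∈ s := by
      rw [hs, Finset.mem_Icc]
      omega
    simp only [Pi.add_apply, hy, if_pos this]
    ring
  have h2 : hankelDet x ((p : ℤ) - q + 1) (q + 1) = 0 := by
    rw [hx, ← map_hankelDet, hankelDet_c_eq_zero hA, map_zero]
  rw [aeval_hankelDet, aeval_hankelDet, h1, h2, zero_add] at key
  have h3 : ∀ g : MvPolynomial ℤ ℤ, MvPolynomial.aeval x g =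
      inlEven 𝒮 e (MvPolynomial.aeval (c 𝒮 A) g) := by
    intro g
    induction g using MvPolynomial.induction_on with
    | C a => simp
    | add g g' hg hg' => rw [map_add, map_add, map_add, hg, hg']
    | mul_X g r hg => rw [map_mul, map_mul, map_mul, hg, MvPolynomial.aeval_X, MvPolynomial.aeval_X]
  -- Comparison of the coefficients of θ; the F_r are even, so `twist` does not affect them.
  have h4 := congrArg (fun z : EvenPart (DualExt.grading 𝒮 e) => DualExt.imHom 𝒮 e z) key
  simp only [Subring.coe_zero, map_zero, AddSubmonoidClass.coe_finsetSum, map_sum,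
    Subring.coe_mul, h3, coe_inlEven] at h4
  rw [modifiedCharPoly, modifiedPoly_eq_sum_signedCHPoly, map_sum, Finset.sum_mul, map_sum, h4]
  refine Finset.sum_bij (fun r _ => r + 1) ?_ ?_ ?_ ?_
  · intro r hr
    simp only [hs, Finset.mem_Icc] at hr ⊢
    omega
  · intro r _ r' _ h
    exact add_right_cancel h
  · intro r hr
    simp only [hs, Finset.mem_Icc] at hr
    exact ⟨r - 1, by simp only [Finset.mem_Icc]; omega, by ring⟩
  · intro r hr
    have hr' : r + 1 ∈ s := by
      simp only [hs, Finset.mem_Icc] at hr ⊢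
      omega
    rw [map_mul (aeval A), aeval_C, ← Algebra.smul_def, supertrace_smul_mul, hyr _ hr', add_sub_cancel_right,
      even_comm 𝒮 (MvPolynomial.aeval (c 𝒮 A) (hankelPartial p q (r + 1))).2]
    simp only [DualExt.imHom_apply, DualExt.mul_im, DualExt.inrHom_re, DualExt.inrHom_im,
      DualExt.inlHom_re, DualExt.inlHom_im, mul_zero, zero_add]
    rw [twist_coe, hankelPartial]

/-- For each position (i, j) the parity of θ is chosen so that the matrix unit E_{ji} times θ is
even. Both parities of θ are therefore needed. -/
theorem aeval_modifiedCharPoly (hA : IsEvenMatrix 𝒮 A) : aeval A (modifiedCharPoly 𝒮 A) = 0 := by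
  ext i j
  refine eq_zero_of_supertrace_mul_single
    (supertrace_aeval_modifiedCharPoly_mul (e := parity i + parity j) hA fun a b => ?_)
  rw [Matrix.single_apply]
  split_ifs with h
  · rw [← h.1, ← h.2, add_comm (parity i), CharTwo.add_self_eq_zero]
    exact SetLike.GradedOne.one_mem
  · exact zero_mem _

/-- Newton's identities for even supermatrices. -/
theorem newton_identity (hA : IsEvenMatrix 𝒮 A) (n : ℕ) :
    (n + 1) * (c 𝒮 A (n + 1 : ℕ) : S) = ∑ x ∈ Finset.HasAntidiagonal.antidiagonal n,
      (c 𝒮 A x.1 : S) * ((-1) ^ x.2 * supertrace (A ^ (x.2 + 1))) := by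
  -- Euler's relation: u = 1 + θ with θ even, so A + Aθ = uA and u^k = 1 + kθ. The scaling law for
  -- c_{n+1} is compared with its variation along N = A.
  set u : EvenPart (DualExt.grading 𝒮 0) := ⟨⟨1, 1⟩, SetLike.GradedOne.one_mem, by
    simpa using SetLike.GradedOne.one_mem (A := 𝒮)⟩ with hu
  have hpow : ∀ k : ℕ, ((u ^ k : EvenPart (DualExt.grading 𝒮 0)) : DualExt 𝒮 0) = ⟨1, k⟩ := by
    intro k
    induction k with
    | zero => ext <;> simp
    | succ k ih =>
      rw [pow_succ, Subring.coe_mul, ih]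
      ext <;> simp [hu, twist_zero, add_comm]
  have hN : ∀ i j, A i j ∈ 𝒮 (parity i + parity j + 0) := fun i j => by simpa using hA i j
  have hpert : perturb 𝒮 0 A A = (u : DualExt 𝒮 0) • A.map (DualExt.inlHom 𝒮 0) := by
    ext i j <;> simp [perturb, hu, twist_zero]
  have h := c_perturb_natCast hA hN n
  rw [hpert, c_smul hA.map_inlHom, Subring.coe_mul, hpow, c_map_inlHom hA] at h
  have h' := congrArg DualExt.im h
  simp only [DualExt.mul_im, DualExt.inlHom_re, DualExt.inlHom_im, twist_zero, RingHom.id_apply,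
    mul_zero, zero_add, DualExt.add_im, DualExt.inrHom_im] at h'
  push_cast at h' ⊢
  rw [h']
  refine Finset.sum_congr rfl fun x _ => ?_
  congr 1
  rw [neg_pow, mul_assoc, ← pow_succ]
  rcases neg_one_pow_eq_or S x.2 with h1 | h1 <;> rcases Nat.even_or_odd x.2 with h2 | h2 <;>
    simp [h2.neg_one_pow]

end Derivative

/-! ## Minimality -/

/-- Cramer's rule with unknowns in a module. It is applied to vectors with entries in the
noncommutative ring over its even part. -/
theorem eq_zero_of_sum_smul_eq_zero {R M n : Type*} [CommRing R] [AddCommGroup M] [Module R M]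
    [Fintype n] [DecidableEq n] {V : Matrix n n R} (hV : IsUnit V.det) {w : n → M}
    (h : ∀ i, ∑ j, V i j • w j = 0) : w = 0 := by
  ext k
  have h1 : ∑ i, V⁻¹ k i • ∑ j, V i j • w j = 0 :=
    Finset.sum_eq_zero fun i _ => by rw [h, smul_zero]
  simp_rw [Finset.smul_sum, smul_smul] at h1
  rw [Finset.sum_comm] at h1
  simp_rw [← Finset.sum_smul, ← Matrix.mul_apply, Matrix.nonsing_inv_mul _ hV,
    Matrix.one_apply] at h1
  simpa using h1

theorem isUnit_det_vandermonde {R : Type*} [CommRing R] {n : ℕ} {v : Fin n → R}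
    (h : ∀ i j, i ≠ j → IsUnit (v i - v j)) : IsUnit (Matrix.vandermonde v).det := by
  rw [Matrix.det_vandermonde]
  refine IsUnit.prod_univ_iff.mpr fun i => IsUnit.prod_iff.mpr fun j hj => h j i ?_
  exact (Finset.mem_Ioi.mp hj).ne'

/-! ### Supertraces of powers and annihilating polynomials of low degree. -/

section Newton

variable {S : Type*} [Ring S] {𝒮 : ZMod 2 → AddSubgroup S} [GradedRing 𝒮] [IsSupercommutative 𝒮]
  {p q : ℕ} {A B : Matrix (Fin p ⊕ Fin q) (Fin p ⊕ Fin q) S}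

/-- In Newton's identity the highest power occurs with the coefficient ±c_0 = ±1, so the power
supertraces are determined recursively without dividing by integers. -/
theorem supertrace_pow_eq_of_c_eq (hA : IsEvenMatrix 𝒮 A) (hB : IsEvenMatrix 𝒮 B)
    (h : ∀ n : ℕ, c 𝒮 A n = c 𝒮 B n) (n : ℕ) : supertrace (A ^ n) = supertrace (B ^ n) := by
  induction n using Nat.strong_induction_on with
  | _ n ih =>
    cases n with
    | zero => simp
    | succ n =>
      have hA' := newton_identity hA n
      have hB' := newton_identity hB n
      rw [h, hB', Finset.Nat.sum_antidiagonal_eq_sum_range_succ (fun a b =>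
        (c 𝒮 B a : S) * ((-1) ^ b * supertrace (B ^ (b + 1)))),
        Finset.Nat.sum_antidiagonal_eq_sum_range_succ (fun a b =>
        (c 𝒮 A a : S) * ((-1) ^ b * supertrace (A ^ (b + 1)))),
        Finset.sum_range_succ', Finset.sum_range_succ'] at hA'
      have hsum : ∑ k ∈ Finset.range n, (c 𝒮 A (k + 1 : ℕ) : S) *
            ((-1) ^ (n - (k + 1)) * supertrace (A ^ (n - (k + 1) + 1))) =
          ∑ k ∈ Finset.range n, (c 𝒮 B (k + 1 : ℕ) : S) *
            ((-1) ^ (n - (k + 1)) * supertrace (B ^ (n - (k + 1) + 1))) :=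
        Finset.sum_congr rfl fun k hk => by
          rw [h, ih (n - (k + 1) + 1) (by have := Finset.mem_range.mp hk; omega)]
      rw [hsum] at hA'
      have hA'' := (add_left_cancel hA').symm
      simp only [Nat.cast_zero, c_zero hA, c_zero hB, Subring.coe_one, one_mul,
        Nat.sub_zero] at hA''
      rcases neg_one_pow_eq_or S n with h1 | h1 <;> rw [h1] at hA''
      · simpa using hA''
      · simpa using hA''

theorem IsCharFraction.c_eq {P Q : (EvenPart 𝒮)[X]} (hA : IsCharFraction 𝒮 A P Q)
    (hB : IsCharFraction 𝒮 B P Q) (n : ℕ) : c 𝒮 A n = c 𝒮 B n := by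
  have hu : IsUnit (Q : PowerSeries (EvenPart 𝒮)) := by
    rw [PowerSeries.isUnit_iff_constantCoeff, Polynomial.constantCoeff_coe, hA.coeff_zero_den]
    exact isUnit_one
  have := congrArg (PowerSeries.coeff n) (hu.mul_right_cancel (hA.mul_den.trans hB.mul_den.symm))
  simpa [charSeries] using this

theorem isDiagonalizedTo_diagonal (l : Fin p → EvenPart 𝒮) (m : Fin q → EvenPart 𝒮) :
    IsDiagonalizedTo 𝒮
      (Matrix.diagonal (Sum.elim (fun i => (l i : S)) (fun α => (m α : S)))) l m :=
  ⟨1, IsEvenMatrix.one, by simp⟩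

theorem isEvenMatrix_diagonal (l : Fin p → EvenPart 𝒮) (m : Fin q → EvenPart 𝒮) :
    IsEvenMatrix 𝒮 (Matrix.diagonal (Sum.elim (fun i => (l i : S)) (fun α => (m α : S)))) := by
  intro i j
  rw [Matrix.diagonal_apply]
  split_ifs with h
  · subst h
    rw [CharTwo.add_self_eq_zero]
    rcases i with i | i
    · exact (l i).2
    · exact (m i).2
  · exact zero_mem _

/-- `A` is compared with the diagonal matrix of its eigenvalues, which has the same c_n; no
similarity between the two is required. -/
theorem IsEigenvalueSystem.supertrace_pow {l : Fin p → EvenPart 𝒮} {m : Fin q → EvenPart 𝒮}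
    (hA : IsEvenMatrix 𝒮 A) (h : IsEigenvalueSystem 𝒮 A l m) (n : ℕ) :
    supertrace (A ^ n) = ∑ i, (l i : S) ^ n - ∑ α, (m α : S) ^ n := by
  rw [supertrace_pow_eq_of_c_eq hA (isEvenMatrix_diagonal l m)
    (h.c_eq (isDiagonalizedTo_diagonal l m).isEigenvalueSystem), Matrix.diagonal_pow,
    supertrace_apply]
  simp

/-- Evaluation at a matrix of a polynomial with coefficients in the whole ring, as `eval₂`. -/
theorem sum_smul_pow_eq_eval₂ (f : S[X]) :
    (f.sum fun k s => s • A ^ k) = f.eval₂ (Matrix.scalar (Fin p ⊕ Fin q)) A := by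
  rw [eval₂_eq_sum]
  simp only [Matrix.scalar_apply, ← Matrix.smul_eq_diagonal_mul]

theorem eval₂_map_coe (f : (EvenPart 𝒮)[X]) :
    (f.map (EvenPart 𝒮).subtype).eval₂ (Matrix.scalar (Fin p ⊕ Fin q)) A = aeval A f := by
  rw [eval₂_map, aeval_def]
  congr 1

/-- From f(A) = 0 follows 0 = str(f(A) A^n) = ∑ ± f(ν_a) ν_a^n over all eigenvalues ν_a. The
Vandermonde matrix of the p+q eigenvalues is invertible: one use gives f(ν_a) = 0, another gives f =
0. Coefficients outside the even part do no harm, as the ν_a are central. -/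
theorem eq_zero_of_eval₂_eq_zero {l : Fin p → EvenPart 𝒮} {m : Fin q → EvenPart 𝒮}
    (hA : IsEvenMatrix 𝒮 A) (h : IsEigenvalueSystem 𝒮 A l m) (hlm : AllDifferencesInvertible l m)
    {f : S[X]} (hf : f.degree < (p + q : ℕ))
    (h0 : f.eval₂ (Matrix.scalar (Fin p ⊕ Fin q)) A = 0) : f = 0 := by
  by_contra hne
  have hdeg : f.natDegree < p + q := (natDegree_lt_iff_degree_lt hne).mpr hf
  set ν : Fin p ⊕ Fin q → EvenPart 𝒮 := Sum.elim l m with hν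
  set ν' : Fin (p + q) → EvenPart 𝒮 := fun a => ν (finSumFinEquiv.symm a) with hν'
  have hdiff : ∀ a b, a ≠ b → IsUnit (ν a - ν b) := by
    rintro (i | i) (j | j) hij
    · exact hlm.even_even i j fun h => hij (by rw [h])
    · exact hlm.even_odd i j
    · have := (hlm.even_odd j i).neg
      rwa [neg_sub] at this
    · exact hlm.odd_odd i j fun h => hij (by rw [h])
  have hdet : IsUnit (Matrix.vandermonde ν').det := isUnit_det_vandermonde fun i j hij =>
    hdiff _ _ fun h => hij (finSumFinEquiv.symm.injective h)
  set ε : Fin p ⊕ Fin q → S := Sum.elim (fun _ => 1) (fun _ => -1) with hε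
  have hstr : ∀ n, supertrace (A ^ n) = ∑ a, ε a * (ν a : S) ^ n := by
    intro n
    rw [h.supertrace_pow hA, Fintype.sum_sum_type]
    simp [hε, hν, sub_eq_add_neg]
  -- The value of f at the eigenvalue ν_a.
  set w : Fin p ⊕ Fin q → S := fun a =>
    ∑ k ∈ Finset.range (p + q), ((ν a : S) ^ k * f.coeff k) with hw
  have hcomm : ∀ (a) (n : ℕ) (s : S), (ν a : S) ^ n * s = s * (ν a : S) ^ n := fun a n s => by
    simpa using even_comm 𝒮 (ν a ^ n).2 s
  have hsum : ∀ n : ℕ, ∑ a, (ν a : S) ^ n * (w a * ε a) = 0 := by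
    intro n
    have h1 : supertrace (f.eval₂ (Matrix.scalar (Fin p ⊕ Fin q)) A * A ^ n) = 0 := by
      rw [h0, zero_mul, map_zero]
    rw [eval₂_eq_sum_range' _ hdeg, Finset.sum_mul, map_sum supertrace] at h1
    rw [← h1]
    simp only [hw, Finset.sum_mul, Finset.mul_sum]
    rw [Finset.sum_comm]
    refine Finset.sum_congr rfl fun k _ => ?_
    rw [Matrix.scalar_apply, ← Matrix.smul_eq_diagonal_mul, smul_mul_assoc, ← pow_add, map_smul,
      hstr, smul_eq_mul, Finset.mul_sum]
    refine Finset.sum_congr rfl fun a _ => ?_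
    rw [hcomm a n, hcomm a k, pow_add, mul_assoc, mul_assoc, hcomm a k, mul_assoc,
      pow_mul_comm]
  have hwε : ∀ a, w a * ε a = 0 := by
    have := eq_zero_of_sum_smul_eq_zero (V := (Matrix.vandermonde ν').transpose)
      (by rwa [Matrix.det_transpose]) (w := fun a => w (finSumFinEquiv.symm a) *
        ε (finSumFinEquiv.symm a)) fun n => by
          rw [← hsum n, ← Equiv.sum_comp finSumFinEquiv.symm]
          refine Finset.sum_congr rfl fun a _ => ?_
          rw [Algebra.smul_def]
          simp only [Matrix.transpose_apply, Matrix.vandermonde_apply, hν']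
          rw [map_pow]
          rfl
    intro a
    have h1 := congrFun this (finSumFinEquiv a)
    simpa using h1
  have hw0 : ∀ a, w a = 0 := by
    intro a
    have := hwε a
    rcases a with a | a <;> simpa [hε] using this
  have hfin := eq_zero_of_sum_smul_eq_zero hdet (w := fun k : Fin (p + q) => f.coeff k)
    fun a => by
      refine Eq.trans ?_ ((Fin.sum_univ_eq_sum_range (fun k =>
        (ν (finSumFinEquiv.symm a) : S) ^ k * f.coeff k) _).trans (hw0 (finSumFinEquiv.symm a)))
      refine Finset.sum_congr rfl fun k _ => ?_
      rw [Algebra.smul_def, Matrix.vandermonde_apply, map_pow]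
      rfl
  apply hne
  ext k
  rcases lt_or_ge k (p + q) with hk | hk
  · exact congrFun hfin ⟨k, hk⟩
  · exact coeff_eq_zero_of_natDegree_lt (hdeg.trans_le hk)

end Newton

/-! ### Division by the monic associate of the modified characteristic polynomial. -/

section Minimality

variable {R : Type*} [CommRing R]

theorem natDegree_reflectNeg_le (n : ℕ) (P : R[X]) : (reflectNeg n P).natDegree ≤ n := by
  refine natDegree_sum_le_of_forall_le _ _ fun i _ => ?_
  refine (natDegree_C_mul_le _ _).trans ((natDegree_pow_le).trans ?_)
  rw [natDegree_neg]
  exact (Nat.mul_le_mul le_rfl natDegree_X_le).trans (by omega)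

theorem coeff_reflectNeg (n : ℕ) (P : R[X]) :
    (reflectNeg n P).coeff n = (-1) ^ n * P.coeff 0 := by
  rw [reflectNeg, finsetSum_coeff, Finset.sum_eq_single 0]
  · rw [coeff_C_mul, Nat.sub_zero, neg_pow, ← C_1, ← C_neg, ← C_pow, coeff_C_mul, coeff_X_pow_self,
      mul_one, mul_comm]
  · intro i hi hi0
    rw [coeff_C_mul, neg_pow, ← C_1, ← C_neg, ← C_pow, coeff_C_mul, coeff_X_pow,
      if_neg (by have := Finset.mem_range.mp hi; omega), mul_zero, mul_zero]
  · simp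

variable {S : Type u} [Ring S] {𝒮 : ZMod 2 → AddSubgroup S} [GradedRing 𝒮] [IsSupercommutative 𝒮]
  {p q : ℕ} {A : Matrix (Fin p ⊕ Fin q) (Fin p ⊕ Fin q) S}

/-- The reflected `P` and `Q` have top coefficients (-1)^p and (-1)^q, because both constant terms
are 1; the unit is the Hankel determinant with the sign (-1)^{p+q}. -/
theorem exists_monic_associated_modifiedCharPoly (hA : IsEvenMatrix 𝒮 A)
    (h : IsUnit (hankelDet (c 𝒮 A) ((p : ℤ) - q + 1) q)) :
    ∃ (u : (EvenPart 𝒮)ˣ) (G : (EvenPart 𝒮)[X]), G.Monic ∧ G.natDegree ≤ p + q ∧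
      G.coeff (p + q) = 1 ∧ modifiedCharPoly 𝒮 A = C (u : EvenPart 𝒮) * G := by
  obtain ⟨⟨P, Q⟩, hPQ, -⟩ := existsUnique_isCharFraction hA h
  obtain ⟨u, hu⟩ := h
  set G : (EvenPart 𝒮)[X] := C ((-1) ^ (p + q)) * (reflectNeg p P * reflectNeg q Q) with hG
  have hdeg : (reflectNeg p P * reflectNeg q Q).natDegree ≤ p + q :=
    natDegree_mul_le.trans (add_le_add (natDegree_reflectNeg_le p P) (natDegree_reflectNeg_le q Q))
  have hG' : G.natDegree ≤ p + q := (natDegree_C_mul_le _ _).trans hdeg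
  have hs : ((-1 : EvenPart 𝒮)) ^ (p + q) * (-1) ^ (p + q) = 1 := by
    rw [← mul_pow, neg_one_mul, neg_neg, one_pow]
  have hcoeff : G.coeff (p + q) = 1 := by
    rw [hG, coeff_C_mul, coeff_mul_add_eq_of_natDegree_le (natDegree_reflectNeg_le p P)
      (natDegree_reflectNeg_le q Q), coeff_reflectNeg, coeff_reflectNeg, hPQ.coeff_zero_num,
      hPQ.coeff_zero_den, mul_one, mul_one, ← pow_add, hs]
  refine ⟨u * (-1) ^ (p + q), G, monic_of_natDegree_le_of_coeff_eq_one _ hG' hcoeff, hG', hcoeff, ?_⟩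
  rw [modifiedCharPoly, hPQ.isFraction.modifiedPoly_eq, ← hu, hG, ← mul_assoc (C _) (C _), ← C_mul]
  congr 2
  rw [Units.val_mul, Units.val_pow_eq_pow_val, Units.val_neg, Units.val_one, mul_assoc, hs, mul_one]

theorem isMinimalPolynomial_modifiedCharPoly (hA : IsEvenMatrix 𝒮 A)
    {T : Type v} [Ring T] {𝒯 : ZMod 2 → AddSubgroup T} [GradedRing 𝒯] [IsSupercommutative 𝒯]
    (φ : S →+* T) (hφ : Function.Injective φ) (hφ' : ∀ (i : ZMod 2) (s : S), s ∈ 𝒮 i → φ s ∈ 𝒯 i)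
    {l : Fin p → EvenPart 𝒯} {m : Fin q → EvenPart 𝒯} (hlm : IsEigenvalueSystem 𝒯 (A.map φ) l m)
    (hd : AllDifferencesInvertible l m)
    (h : IsUnit (hankelDet (c 𝒮 A) ((p : ℤ) - q + 1) q)) :
    IsMinimalPolynomial 𝒮 A (modifiedCharPoly 𝒮 A) := by
  obtain ⟨u, G, hG, hGdeg, hGcoeff, hGu⟩ := exists_monic_associated_modifiedCharPoly hA h
  have hA0 := aeval_modifiedCharPoly hA
  have hG0 : aeval A G = 0 := by
    have : G = C ((u⁻¹ : (EvenPart 𝒮)ˣ) : EvenPart 𝒮) * modifiedCharPoly 𝒮 A := by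
      rw [hGu, ← mul_assoc, ← C_mul, Units.inv_mul, C_1, one_mul]
    rw [this, map_mul, hA0, mul_zero]
  have hdvd : modifiedCharPoly 𝒮 A ∣ G := by
    refine ⟨C ((u⁻¹ : (EvenPart 𝒮)ˣ) : EvenPart 𝒮), ?_⟩
    rw [hGu, mul_right_comm, ← C_mul, Units.mul_inv, C_1, one_mul]
  -- Over the zero ring the degree of `G` need not be p+q.
  rcases subsingleton_or_nontrivial S with hS | hS
  · exact
      { annihilates := hA0
        isUnit_leadingCoeff := isUnit_of_subsingleton _
        natDegree_le := fun f hf => absurd (Subsingleton.elim f 0) hf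
        dvd_even := fun f _ => ⟨0, Subsingleton.elim _ _⟩
        dvd := fun f _ => ⟨0, Subsingleton.elim _ _⟩ }
  -- The relation is carried along `φ` to `T`, where the eigenvalues live; injectivity of `φ`
  -- returns f = 0.
  have key : ∀ f : S[X], f.degree < (p + q : ℕ) →
      f.eval₂ (Matrix.scalar (Fin p ⊕ Fin q)) A = 0 → f = 0 := by
    intro f hf hf0
    have h1 : (f.map φ).eval₂ (Matrix.scalar (Fin p ⊕ Fin q)) (A.map φ) = 0 := by
      have := congrArg φ.mapMatrix hf0
      rw [hom_eval₂, map_zero] at this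
      rw [eval₂_map, ← this]
      congr 1
      ext s i j
      simp [Matrix.diagonal_apply, apply_ite φ]
    have h2 := eq_zero_of_eval₂_eq_zero (fun i j => hφ' _ _ (hA i j)) hlm hd
      (degree_map_le.trans_lt hf) h1
    exact (Polynomial.map_injective φ hφ) (by rw [h2, Polynomial.map_zero])
  have hle : (modifiedCharPoly 𝒮 A).natDegree ≤ p + q := by
    rw [hGu]
    exact (natDegree_C_mul_le _ _).trans hGdeg
  have hdegG : G.degree = (p + q : ℕ) := by
    refine le_antisymm (degree_le_of_natDegree_le hGdeg) (le_degree_of_ne_zero ?_)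
    rw [hGcoeff]
    exact one_ne_zero
  refine ⟨hA0, ?_, ?_, ?_, ?_⟩
  · rw [hGu, leadingCoeff_mul_monic hG, leadingCoeff_C]
    exact u.isUnit
  · intro f hf hf0
    rw [sum_smul_pow_eq_eval₂] at hf0
    by_contra hlt
    exact hf (key f ((natDegree_lt_iff_degree_lt hf).mp ((not_le.mp hlt).trans_le hle)) hf0)
  · intro f hf0
    have hr : f %ₘ G = 0 := by
      refine Polynomial.map_injective _ (EvenPart 𝒮).subtype_injective ?_
      rw [Polynomial.map_zero]
      refine key _ (degree_map_le.trans_lt ?_) ?_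
      · rw [← hdegG]
        exact degree_modByMonic_lt f hG
      · rw [eval₂_map_coe]
        have := congrArg (aeval A) (modByMonic_add_div f G)
        rwa [map_add, map_mul, hG0, zero_mul, add_zero, hf0] at this
    exact hdvd.trans ((modByMonic_eq_zero_iff_dvd hG).mp hr)
  · intro f hf0
    rw [sum_smul_pow_eq_eval₂] at hf0
    set G' := G.map (EvenPart 𝒮).subtype with hG'
    have hG'm : G'.Monic := hG.map _
    have hadd := modByMonic_add_div f G'
    -- Evaluation at `A` is not multiplicative over a noncommutative coefficient ring. The even,
    -- hence central, coefficients of `G'` allow it to be the right-hand factor, for which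
    -- multiplicativity holds.
    have hcomm : G' * (f /ₘ G') = (f /ₘ G') * G' := by
      ext n
      rw [coeff_mul, coeff_mul, ← Finset.Nat.sum_antidiagonal_swap]
      refine Finset.sum_congr rfl fun x _ => ?_
      simp only [Prod.fst_swap, Prod.snd_swap, hG', coeff_map]
      exact even_comm 𝒮 (G.coeff _).2 _
    have hr : f %ₘ G' = 0 := by
      refine key _ ?_ ?_
      · rw [← hdegG]
        exact (degree_modByMonic_lt f hG'm).trans_le degree_map_le
      · have h1 := congrArg (eval₂ (Matrix.scalar (Fin p ⊕ Fin q)) A) hadd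
        rw [eval₂_add, hcomm, eval₂_mul_noncomm, hG', eval₂_map_coe, hG0, mul_zero, add_zero,
          hf0] at h1
        · exact h1
        · intro k
          rw [hG', coeff_map]
          ext i j
          rw [Matrix.scalar_apply, Matrix.diagonal_mul, Matrix.mul_diagonal]
          exact even_comm 𝒮 (G.coeff k).2 _
    rw [hr, zero_add] at hadd
    exact ((map_dvd (mapRingHom (EvenPart 𝒮).subtype) hdvd).trans (Dvd.intro _ hadd))

end Minimality
end SuperCH

end

theorem mainTheorem8 (p q : ℕ) :
    -- the coefficients are polynomials in the matrix entries
    (∃ f : ℕ → FreeAlgebra ℤ ((Fin p ⊕ Fin q) × (Fin p ⊕ Fin q)),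
      ∀ (S : Type u) [Ring S] (𝒮 : ZMod 2 → AddSubgroup S) [GradedRing 𝒮]
        [SuperCH.IsSupercommutative 𝒮] (A : Matrix (Fin p ⊕ Fin q) (Fin p ⊕ Fin q) S),
        SuperCH.IsEvenMatrix 𝒮 A → ∀ n : ℕ,
          (((SuperCH.modifiedCharPoly 𝒮 A).coeff n : SuperCH.EvenPart 𝒮) : S) =
            FreeAlgebra.lift ℤ (fun ij : (Fin p ⊕ Fin q) × (Fin p ⊕ Fin q) => A ij.1 ij.2) (f n)) ∧
    ∀ (S : Type u) [Ring S] (𝒮 : ZMod 2 → AddSubgroup S) [GradedRing 𝒮]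
      [SuperCH.IsSupercommutative 𝒮] (A : Matrix (Fin p ⊕ Fin q) (Fin p ⊕ Fin q) S),
      SuperCH.IsEvenMatrix 𝒮 A →
      -- the polynomial annihilates `A`
      Polynomial.aeval A (SuperCH.modifiedCharPoly 𝒮 A) = 0 ∧
      -- it is invariant under similarity
      (∀ B : (Matrix (Fin p ⊕ Fin q) (Fin p ⊕ Fin q) S)ˣ, SuperCH.IsEvenMatrix 𝒮 B.val →
        SuperCH.modifiedCharPoly 𝒮 (B.inv * A * B.val) = SuperCH.modifiedCharPoly 𝒮 A) ∧
      -- the factorization in terms of the numerator and denominator of the characteristic function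
      (IsUnit (SuperCH.hankelDet (SuperCH.c 𝒮 A) (p - q + 1) q) →
        ∃! PQ : Polynomial (SuperCH.EvenPart 𝒮) × Polynomial (SuperCH.EvenPart 𝒮),
          SuperCH.IsCharFraction 𝒮 A PQ.1 PQ.2) ∧
      (∀ P Q : Polynomial (SuperCH.EvenPart 𝒮), SuperCH.IsCharFraction 𝒮 A P Q →
        SuperCH.hankelDet (SuperCH.c 𝒮 A) (p - q + 1) q =
            (-1) ^ (q * (q - 1) / 2) * Polynomial.resultant P Q p q ∧
        SuperCH.modifiedCharPoly 𝒮 A =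
          Polynomial.C ((-1) ^ (q * (q - 1) / 2) * Polynomial.resultant P Q p q) *
            (SuperCH.reflectNeg p P * SuperCH.reflectNeg q Q)) ∧
      -- the factorization in terms of the eigenvalues
      (∀ (l : Fin p → SuperCH.EvenPart 𝒮) (m : Fin q → SuperCH.EvenPart 𝒮),
        SuperCH.IsDiagonalizedTo 𝒮 A l m → SuperCH.IsEigenvalueSystem 𝒮 A l m) ∧
      (∀ (l : Fin p → SuperCH.EvenPart 𝒮) (m : Fin q → SuperCH.EvenPart 𝒮),
        SuperCH.IsEigenvalueSystem 𝒮 A l m →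
        Polynomial.resultant (∏ i, (1 + Polynomial.C (l i) * Polynomial.X))
            (∏ α, (1 + Polynomial.C (m α) * Polynomial.X)) p q = ∏ i, ∏ α, (l i - m α) ∧
        SuperCH.modifiedCharPoly 𝒮 A =
          Polynomial.C ((-1) ^ (q * (q - 1) / 2) * ∏ i, ∏ α, (l i - m α)) *
            ((∏ i, (Polynomial.C (l i) - Polynomial.X)) *
              ∏ α, (Polynomial.C (m α) - Polynomial.X))) ∧
      -- minimality for generic `A`, the eigenvalues being taken in an extension `T` of `S`
      (∀ (T : Type v) [Ring T] (𝒯 : ZMod 2 → AddSubgroup T) [GradedRing 𝒯]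
        [SuperCH.IsSupercommutative 𝒯] (φ : S →+* T), Function.Injective φ →
        (∀ (i : ZMod 2) (s : S), s ∈ 𝒮 i → φ s ∈ 𝒯 i) →
        ∀ (l : Fin p → SuperCH.EvenPart 𝒯) (m : Fin q → SuperCH.EvenPart 𝒯),
          SuperCH.IsEigenvalueSystem 𝒯 (A.map φ) l m →
          SuperCH.AllDifferencesInvertible l m →
          IsUnit (SuperCH.hankelDet (SuperCH.c 𝒮 A) (p - q + 1) q) →
          SuperCH.IsMinimalPolynomial 𝒮 A (SuperCH.modifiedCharPoly 𝒮 A)) := by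
  refine ⟨?_, fun S _ 𝒮 _ _ A hA => ⟨SuperCH.aeval_modifiedCharPoly hA, fun B hB => ?_,
    SuperCH.existsUnique_isCharFraction hA, fun P Q h => ?_, fun l m => fun h => h.isEigenvalueSystem,
    fun l m h => ?_, fun T _ 𝒯 _ _ φ hφ hφ' l m hlm hd h =>
      SuperCH.isMinimalPolynomial_modifiedCharPoly hA φ hφ hφ' hlm hd h⟩⟩
  · choose f hf using SuperCH.exists_lift_eq_coeff_modifiedCharPoly.{u} p q
    exact ⟨f, fun S _ 𝒮 _ _ A hA n => hf n S 𝒮 A hA⟩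
  · rw [SuperCH.modifiedCharPoly, SuperCH.c_conj hA hB B.val_inv B.inv_val,
      SuperCH.modifiedCharPoly]
  · rw [SuperCH.modifiedCharPoly, h.isFraction.modifiedPoly_eq, h.isFraction.hankelDet_eq]
    exact ⟨rfl, rfl⟩
  · rw [SuperCH.modifiedCharPoly, SuperCH.IsFraction.modifiedPoly_eq h.isFraction,
      SuperCH.IsFraction.hankelDet_eq h.isFraction, SuperCH.resultant_prod_linear,
      SuperCH.reflectNeg_prod_linear, SuperCH.reflectNeg_prod_linear]
    exact ⟨rfl, rfl⟩
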